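/- Let $n\in\mathbb N$ and $q>2$. For $z\in\mathbb R/\mathbb Z$ let $|z|=\min_{k\in\mathbb Z}|z-k|$. For $s\in(0,1)$ put $[f]_{W^{s,q}}=\bigl(\iint_{(\mathbb R/\mathbb Z)^2}\frac{|f(x)-f(y)|^q}{|x-y|^{1+sq}}\,dx\,dy\bigr)^{1/q}$ and $\|f\|_{W^{s,q}}=\|f\|_{L^q}+[f]_{W^{s,q}}$. The space $W^{2-1/q,q}=W^{2-1/q,q}(\mathbb R/\mathbb Z,\mathbb R^n)$ consists of all $u\in L^q$ with weak derivative $u'\in L^q$ and $[u']_{W^{1-1/q,q}}<\infty$, and is normed by $\|u\|_{L^q}+\|u'\|_{W^{1-1/q,q}}$; its elements are ($C^1$ and) identified with their continuous representatives. Let $\mathcal C$ be the set of those $u\in W^{2-1/q,q}$ that are embedded (injective) and regular ($\min|u'|>0$), and put $$\mathrm{bil}(u)=\sup_{x\ne y}\frac{|x-y|}{|u(x)-u(y)|}.$$ Write $\langle a\wedge b,c\wedge d\rangle=\langle a,c\rangle\langle b,d\rangle-\langle a,d\rangle\langle b,c\rangle$, $|a\wedge b|^2=\langle a\wedge b,a\wedge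 b\rangle$, $Du=u(x)-u(y)$, and write $u'$ for $u'(y)$ in the integrands below. The tangent-point functional is $$\mathrm{TP}(u)=\frac1q\iint_{(\mathbb R/\mathbb Z)^2}\frac{|u'\wedge Du|^q}{|Du|^{2q}}\,dx\,dy .$$ Then the integrand of $\mathrm{TP}(u)$ is integrable for every $u\in\mathcal C$, and $\mathrm{TP}$ is twice continuously (Fréchet) differentiable on $W^{2-1/q,q}$ near every $u\in\mathcal C$. Its second variation is a bounded bilinear form, given for all $v,w\in W^{2-1/q,q}$ by $$\delta^2\mathrm{TP}(u)[v,w]=\iint_{(\mathbb R/\mathbb Z)^2}\Bigl\{(q-2)\bigl(N(u,v,u,u,w,u)+N(u,v,u,u,u,w)+N(v,u,u,u,w,u)+N(v,u,u,u,u,w)\bigr)$$ $$+N(u,u,w,u,u,v)+N(u,u,u,w,u,v)+N(u,u,w,u,v,u)+N(u,u,u,w,v,u)-2q\bigl(P(u,v,w)+P(v,u,w)\bigr)$$ $$+M(v,w)+M(w,v)-2q\bigl(B(u,v,w,u,u,u)+B(u,v,u,w,u,u)\bigr)+4(q+1)B(u,v,u,u,u,w)-2A(v,w)\Bigr\}\,dx\,dy,$$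 where the expression in braces is integrable and, $x-y$ denoting the representative in $(-\tfrac12,\tfrac12]$, $$M(v,w)=\frac{|u'\wedge Du|^{q-2}}{|Du|^{2q}}\bigl\langle u'\wedge Du,\;v'\wedge(Dw-(x-y)w')\bigr\rangle,\qquad A(v,w)=\frac{|u'\wedge Du|^{q}}{|Du|^{2q+2}}\langle Dv,Dw\rangle,$$ $$N(v,w,\phi,\psi,\xi,\eta)=\frac{|u'\wedge Du|^{q-4}}{|Du|^{2q}}\langle u'\wedge Du,v'\wedge Dw\rangle\langle\phi'\wedge D\psi,\xi'\wedge D\eta\rangle,$$ $$P(v,w,\phi)=\frac{|u'\wedge Du|^{q-2}}{|Du|^{2q+2}}\langle u'\wedge Du,v'\wedge Dw\rangle\langle Du,D\phi\rangle,$$ $$B(v,w,\phi,\psi,\xi,\eta)=\frac{|u'\wedge Du|^{q-2}}{|Du|^{2q+4}}\langle Dv,Dw\rangle\langle u'\wedge Du,\phi'\wedge D\psi\rangle\langle D\xi,D\eta\rangle$$ (for $q<4$, the function $N$ is read as $0$ where $u'\wedge Du=0$). Moreover, there is a constant $C>0$ depending only on $n$ and $q$ such that for all $u\in\mathcal C$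 and all $v,w\in W^{2-1/q,q}$ $$|\delta^2\mathrm{TP}(u)[v,w]|\le C\,\mathrm{bil}(u)^{2q+4}\,\|u'\|_{L^\infty}^{q+2}\,\|u'\|_{W^{1-1/q,q}}^{q}\,\|v'\|_{W^{1-1/q,q}}\,\|w'\|_{W^{1-1/q,q}}.$$ -/

import Mathlib

open MeasureTheory Set
open scoped ENNReal

noncomputable section

namespace TangentPoint

/-- Euclidean space `ℝⁿ`. -/
abbrev Euc (n : ℕ) : Type := EuclideanSpace ℝ (Fin n)

/-- The domain `ℝ/ℤ`. Its norm is `|z| = min_k |z - k|`, its volume is the Lebesgue measure of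
total mass one. -/
abbrev Circ : Type := UnitAddCircle

/-! ### Sobolev–Slobodeckij spaces on `ℝ/ℤ` -/

/-- The Sobolev–Slobodeckij seminorm
`[f]_{W^{s,q}} = (∬ |f(x) - f(y)|^q / |x-y|^{1+sq} dx dy)^{1/q}`, with values in `[0, ∞]`. -/
def slobodeckij {n : ℕ} (s q : ℝ) (f : Circ → Euc n) : ℝ≥0∞ :=
  (∫⁻ p : Circ × Circ, ‖f p.1 - f p.2‖ₑ ^ q / ‖p.1 - p.2‖ₑ ^ (1 + s * q)) ^ (1 / q)

/-- The norm `‖f‖_{W^{s,q}} = ‖f‖_{L^q} + [f]_{W^{s,q}}` (for `0 < s < 1`). -/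
def wNorm {n : ℕ} (s q : ℝ) (f : Circ → Euc n) : ℝ :=
  (eLpNorm f (ENNReal.ofReal q) volume).toReal + (slobodeckij s q f).toReal

instance factOneLe {q : ℝ} [hq : Fact (2 < q)] : Fact (1 ≤ ENNReal.ofReal q) :=
  ⟨by rw [← ENNReal.ofReal_one]; exact ENNReal.ofReal_le_ofReal (by linarith [hq.out])⟩

lemma quot_rpow {s q : ℝ} (hq : 0 < q) (a b : ℝ≥0∞) :
    a ^ q / b ^ (1 + s * q) = (a * (b ^ ((1 + s * q) / q))⁻¹) ^ q := by
  rw [ENNReal.mul_rpow_of_nonneg _ _ hq.le, ENNReal.inv_rpow, ← ENNReal.rpow_mul,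
    div_mul_cancel₀ _ hq.ne', div_eq_mul_inv]

lemma slobodeckij_congr {n : ℕ} {s q : ℝ} {f g : Circ → Euc n} (h : f =ᵐ[volume] g) :
    slobodeckij s q f = slobodeckij s q g := by
  unfold slobodeckij
  congr 1
  apply lintegral_congr_ae
  have h1 : ∀ᵐ p : Circ × Circ, f p.1 = g p.1 := Measure.quasiMeasurePreserving_fst.ae h
  have h2 : ∀ᵐ p : Circ × Circ, f p.2 = g p.2 := Measure.quasiMeasurePreserving_snd.ae h
  filter_upwards [h1, h2] with p hp1 hp2
  rw [hp1, hp2]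

lemma slobodeckij_add_le {n : ℕ} {s q : ℝ} (hq : 1 ≤ q) {f g : Circ → Euc n}
    (hf : AEStronglyMeasurable f volume) (hg : AEStronglyMeasurable g volume) :
    slobodeckij s q (f + g) ≤ slobodeckij s q f + slobodeckij s q g := by
  have hq0 : 0 < q := by linarith
  unfold slobodeckij
  simp only [quot_rpow hq0]
  have meas : ∀ h : Circ → Euc n, AEStronglyMeasurable h volume →
      AEMeasurable (fun p : Circ × Circ =>
        ‖h p.1 - h p.2‖ₑ * (‖p.1 - p.2‖ₑ ^ ((1 + s * q) / q))⁻¹) := by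
    intro h hh
    have h1 : AEStronglyMeasurable (fun p : Circ × Circ => h p.1) volume :=
      hh.comp_quasiMeasurePreserving Measure.quasiMeasurePreserving_fst
    have h2 : AEStronglyMeasurable (fun p : Circ × Circ => h p.2) volume :=
      hh.comp_quasiMeasurePreserving Measure.quasiMeasurePreserving_snd
    have h3 : Continuous (fun p : Circ × Circ => p.1 - p.2) := by fun_prop
    exact (h1.sub h2).enorm.mul ((h3.enorm.measurable.pow_const _).inv).aemeasurable
  refine le_trans ?_ (ENNReal.lintegral_Lp_add_le (meas f hf) (meas g hg) hq)
  gcongr with p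
  simp only [Pi.add_apply]
  rw [← add_mul, add_sub_add_comm]
  gcongr
  exact enorm_add_le _ _

lemma slobodeckij_smul {n : ℕ} {s q : ℝ} (hq : 0 < q) (c : ℝ) (f : Circ → Euc n) :
    slobodeckij s q (c • f) = ‖c‖ₑ * slobodeckij s q f := by
  unfold slobodeckij
  have : ∀ p : Circ × Circ, ‖(c • f) p.1 - (c • f) p.2‖ₑ ^ q / ‖p.1 - p.2‖ₑ ^ (1 + s * q)
      = ‖c‖ₑ ^ q * (‖f p.1 - f p.2‖ₑ ^ q / ‖p.1 - p.2‖ₑ ^ (1 + s * q)) := by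
    intro p
    rw [Pi.smul_apply, Pi.smul_apply, ← smul_sub, enorm_smul,
      ENNReal.mul_rpow_of_nonneg _ _ hq.le, mul_div_assoc]
  simp_rw [this]
  rw [lintegral_const_mul' _ _ (ENNReal.rpow_ne_top_of_nonneg hq.le enorm_ne_top),
    ENNReal.mul_rpow_of_nonneg _ _ (by positivity), ← ENNReal.rpow_mul,
    mul_one_div_cancel hq.ne', ENNReal.rpow_one]

lemma slobodeckij_zero {n : ℕ} {s q : ℝ} (hq : 0 < q) :
    slobodeckij s q (0 : Circ → Euc n) = 0 := by
  simpa using slobodeckij_smul (s := s) hq 0 (0 : Circ → Euc n)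

lemma intervalIntegrable_coe {n : ℕ} {q : ℝ} [Fact (2 < q)]
    (g : Lp (Euc n) (ENNReal.ofReal q) (volume : Measure Circ)) {t : ℝ} (ht : t ∈ Icc (0 : ℝ) 1) :
    IntervalIntegrable (fun r : ℝ => g (r : Circ)) volume 0 t := by
  rw [intervalIntegrable_iff_integrableOn_Ioc_of_le ht.1]
  have h1 : Integrable g volume := (Lp.memLp g).integrable (Fact.out)
  have h2 : Integrable (fun r : ℝ => g (r : Circ)) (volume.restrict (Ioc 0 (0 + 1))) :=
    (UnitAddCircle.measurePreserving_mk 0).integrable_comp_of_integrable h1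
  exact IntegrableOn.mono_set h2 (Ioc_subset_Ioc_right (by linarith [ht.2]))

lemma integral_congr_coe {n : ℕ} {f g : Circ → Euc n} (h : f =ᵐ[volume] g)
    {t : ℝ} (ht : t ∈ Icc (0 : ℝ) 1) :
    ∫ r in (0 : ℝ)..t, f (r : Circ) = ∫ r in (0 : ℝ)..t, g (r : Circ) := by
  rw [intervalIntegral.integral_of_le ht.1, intervalIntegral.integral_of_le ht.1]
  apply integral_congr_ae
  have h2 : ∀ᵐ r : ℝ ∂(volume.restrict (Ioc 0 (0 + 1))), f (r : Circ) = g (r : Circ) :=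
    (UnitAddCircle.measurePreserving_mk 0).quasiMeasurePreserving.ae h
  exact ae_mono (Measure.restrict_mono (Ioc_subset_Ioc_right (by linarith [ht.2])) le_rfl) h2

/-- Pairs `(u, u')` of a continuous closed curve `u : ℝ/ℤ → ℝⁿ` and a (class of a) function
`u' ∈ L^q(ℝ/ℤ, ℝⁿ)`, where `u` is absolutely continuous with derivative `u'`, i.e. `u` is the
continuous representative of a `W^{1,q}` function with weak derivative `u'`, and
`[u']_{W^{1-1/q,q}} < ∞`. -/
def curveSubmodule (n : ℕ) (q : ℝ) [hq : Fact (2 < q)] :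
    Submodule ℝ (C(Circ, Euc n) × Lp (Euc n) (ENNReal.ofReal q) (volume : Measure Circ)) where
  carrier := {p | (∀ t ∈ Icc (0 : ℝ) 1,
      p.1 (t : Circ) = p.1 ((0 : ℝ) : Circ) + ∫ r in (0 : ℝ)..t, p.2 (r : Circ)) ∧
    slobodeckij (1 - 1 / q) q p.2 < ∞}
  add_mem' := by
    rintro a b ⟨ha, ha'⟩ ⟨hb, hb'⟩
    refine ⟨fun t ht => ?_, ?_⟩
    · rw [Prod.snd_add, Prod.fst_add, integral_congr_coe (Lp.coeFn_add a.2 b.2) ht]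
      simp only [Pi.add_apply, ContinuousMap.add_apply]
      rw [intervalIntegral.integral_add (intervalIntegrable_coe a.2 ht)
        (intervalIntegrable_coe b.2 ht), ha t ht, hb t ht]
      abel
    · rw [Prod.snd_add, slobodeckij_congr (Lp.coeFn_add a.2 b.2)]
      exact (slobodeckij_add_le (by linarith [hq.out]) (Lp.aestronglyMeasurable _)
        (Lp.aestronglyMeasurable _)).trans_lt (ENNReal.add_lt_top.2 ⟨ha', hb'⟩)
  zero_mem' := by
    have hq0 : (0 : ℝ) < q := by linarith [hq.out]
    refine ⟨fun t ht => ?_, ?_⟩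
    · rw [Prod.snd_zero, integral_congr_coe (Lp.coeFn_zero _ _ _) ht]
      simp
    · rw [Prod.snd_zero, slobodeckij_congr (Lp.coeFn_zero _ _ _), slobodeckij_zero hq0]
      exact ENNReal.zero_lt_top
  smul_mem' := by
    have hq0 : (0 : ℝ) < q := by linarith [hq.out]
    rintro c a ⟨ha, ha'⟩
    refine ⟨fun t ht => ?_, ?_⟩
    · rw [Prod.smul_snd, Prod.smul_fst, integral_congr_coe (Lp.coeFn_smul c a.2) ht]
      simp only [Pi.smul_apply, ContinuousMap.smul_apply]
      rw [intervalIntegral.integral_smul, ha t ht, smul_add]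
    · rw [Prod.smul_snd, slobodeckij_congr (Lp.coeFn_smul c a.2), slobodeckij_smul hq0]
      exact ENNReal.mul_lt_top enorm_lt_top ha'

/-- The Sobolev–Slobodeckij space `W^{2-1/q,q}(ℝ/ℤ, ℝⁿ)`, `q > 2`, whose elements are represented
by their continuous representatives. It carries the norm
`‖u‖_{W^{2-1/q,q}} = ‖u‖_{L^q} + ‖u'‖_{L^q} + [u']_{W^{1-1/q,q}}`, see below. -/
def CurveSpace (n : ℕ) (q : ℝ) [Fact (2 < q)] : Type := curveSubmodule n q

variable {n : ℕ} {q : ℝ} [hq : Fact (2 < q)]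

instance instAddCommGroup : AddCommGroup (CurveSpace n q) := inferInstanceAs (AddCommGroup (curveSubmodule n q))

instance instModule : Module ℝ (CurveSpace n q) := inferInstanceAs (Module ℝ (curveSubmodule n q))

/-- The curve `u : ℝ/ℤ → ℝⁿ` itself. -/
def CurveSpace.curve (u : CurveSpace n q) : C(Circ, Euc n) := u.1.1

/-- The derivative `u'`, an element of `L^q`. -/
def CurveSpace.vel (u : CurveSpace n q) : Lp (Euc n) (ENNReal.ofReal q) (volume : Measure Circ) :=
  u.1.2

@[simp] lemma curve_add (u v : CurveSpace n q) : (u + v).curve = u.curve + v.curve := rfl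

@[simp] lemma vel_add (u v : CurveSpace n q) : (u + v).vel = u.vel + v.vel := rfl

@[simp] lemma curve_smul (c : ℝ) (u : CurveSpace n q) : (c • u).curve = c • u.curve := rfl

@[simp] lemma vel_smul (c : ℝ) (u : CurveSpace n q) : (c • u).vel = c • u.vel := rfl

@[simp] lemma curve_zero : (0 : CurveSpace n q).curve = 0 := rfl

@[simp] lemma vel_zero : (0 : CurveSpace n q).vel = 0 := rfl

lemma slobodeckij_vel_ne_top (u : CurveSpace n q) : slobodeckij (1 - 1 / q) q u.vel ≠ ∞ :=
  u.2.2.ne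

/-- The norm `‖u‖_{W^{2-1/q,q}} = ‖u‖_{L^q} + ‖u'‖_{L^q} + [u']_{W^{1-1/q,q}}`. -/
instance instNorm : Norm (CurveSpace n q) where
  norm u := (eLpNorm u.curve (ENNReal.ofReal q) volume).toReal + wNorm (1 - 1 / q) q u.vel

lemma norm_def (u : CurveSpace n q) :
    ‖u‖ = (eLpNorm u.curve (ENNReal.ofReal q) volume).toReal + wNorm (1 - 1 / q) q u.vel := rfl

lemma memLp_curve (r : ℝ≥0∞) (u : C(Circ, Euc n)) : MemLp u r (volume : Measure Circ) :=
  u.continuous.memLp_of_hasCompactSupport (HasCompactSupport.of_compactSpace _)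

lemma wNorm_nonneg (s q : ℝ) (f : Circ → Euc n) : 0 ≤ wNorm s q f := by
  unfold wNorm
  positivity

lemma wNorm_congr {s q : ℝ} {f g : Circ → Euc n} (h : f =ᵐ[volume] g) :
    wNorm s q f = wNorm s q g := by
  unfold wNorm
  rw [eLpNorm_congr_ae h, slobodeckij_congr h]

lemma wNorm_smul {s q : ℝ} (hq : 0 < q) (c : ℝ) (f : Circ → Euc n) :
    wNorm s q (c • f) = |c| * wNorm s q f := by
  unfold wNorm
  rw [eLpNorm_const_smul, slobodeckij_smul hq, ENNReal.toReal_mul, ENNReal.toReal_mul, toReal_enorm,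
    Real.norm_eq_abs, mul_add]

lemma wNorm_add_le {s q : ℝ} (hq : 1 ≤ q) {f g : Circ → Euc n}
    (hf : MemLp f (ENNReal.ofReal q)) (hg : MemLp g (ENNReal.ofReal q))
    (hf' : slobodeckij s q f ≠ ∞) (hg' : slobodeckij s q g ≠ ∞) :
    wNorm s q (f + g) ≤ wNorm s q f + wNorm s q g := by
  have h1 : (1 : ℝ≥0∞) ≤ ENNReal.ofReal q := by
    rw [← ENNReal.ofReal_one]
    exact ENNReal.ofReal_le_ofReal hq
  have e1 := ENNReal.toReal_mono (ENNReal.add_ne_top.2 ⟨hf.2.ne, hg.2.ne⟩)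
    (eLpNorm_add_le hf.1 hg.1 h1)
  have e2 := ENNReal.toReal_mono (ENNReal.add_ne_top.2 ⟨hf', hg'⟩)
    (slobodeckij_add_le (s := s) hq hf.1 hg.1)
  rw [ENNReal.toReal_add hf.2.ne hg.2.ne] at e1
  rw [ENNReal.toReal_add hf' hg'] at e2
  unfold wNorm
  linarith

lemma normedSpaceCore (n : ℕ) (q : ℝ) [hq : Fact (2 < q)] :
    NormedSpace.Core ℝ (CurveSpace n q) where
  norm_nonneg u := add_nonneg ENNReal.toReal_nonneg (wNorm_nonneg _ _ _)
  norm_smul c u := by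
    have hq0 : (0 : ℝ) < q := by linarith [hq.out]
    rw [norm_def, norm_def, curve_smul, vel_smul, wNorm_congr (Lp.coeFn_smul c u.vel),
      wNorm_smul hq0, ContinuousMap.coe_smul, eLpNorm_const_smul, ENNReal.toReal_mul, toReal_enorm,
      Real.norm_eq_abs, mul_add]
  norm_triangle u v := by
    have hq1 : (1 : ℝ) ≤ q := by linarith [hq.out]
    have mu := memLp_curve (ENNReal.ofReal q) u.curve
    have mv := memLp_curve (ENNReal.ofReal q) v.curve
    have e1 := ENNReal.toReal_mono (ENNReal.add_ne_top.2 ⟨mu.2.ne, mv.2.ne⟩)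
      (eLpNorm_add_le mu.1 mv.1 Fact.out)
    rw [ENNReal.toReal_add mu.2.ne mv.2.ne] at e1
    have e2 := wNorm_add_le hq1 (Lp.memLp u.vel) (Lp.memLp v.vel)
      (slobodeckij_vel_ne_top u) (slobodeckij_vel_ne_top v)
    rw [norm_def, norm_def, norm_def, curve_add, vel_add, wNorm_congr (Lp.coeFn_add u.vel v.vel),
      ContinuousMap.coe_add]
    linarith
  norm_eq_zero_iff u := by
    have hq0 : (0 : ℝ) < q := by linarith [hq.out]
    have hq1 : ENNReal.ofReal q ≠ 0 := by simpa using hq0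
    have mu := memLp_curve (ENNReal.ofReal q) u.curve
    constructor
    · intro h
      rw [norm_def, wNorm] at h
      have p1 : 0 ≤ (eLpNorm u.curve (ENNReal.ofReal q) (volume : Measure Circ)).toReal :=
        ENNReal.toReal_nonneg
      have p2 : 0 ≤ (eLpNorm u.vel (ENNReal.ofReal q) (volume : Measure Circ)).toReal :=
        ENNReal.toReal_nonneg
      have p3 : 0 ≤ (slobodeckij (1 - 1 / q) q u.vel).toReal := ENNReal.toReal_nonneg
      have z1 := (ENNReal.toReal_eq_zero_iff _).1 (show
        (eLpNorm u.curve (ENNReal.ofReal q) (volume : Measure Circ)).toReal = 0 by linarith)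
      have z2 : (eLpNorm u.vel (ENNReal.ofReal q) (volume : Measure Circ)).toReal = 0 := by linarith
      have y1 := (eLpNorm_eq_zero_iff mu.1 hq1).1 (z1.resolve_right mu.2.ne)
      have y2 : u.vel = 0 := by rwa [← Lp.norm_def, norm_eq_zero] at z2
      have y3 : (u.curve : Circ → Euc n) = 0 :=
        (Continuous.ae_eq_iff_eq volume u.curve.continuous continuous_zero).1 y1
      exact Subtype.ext (Prod.ext (ContinuousMap.ext fun x => congrFun y3 x) y2)
    · rintro rfl
      rw [norm_def, wNorm, curve_zero, vel_zero, eLpNorm_congr_ae (Lp.coeFn_zero _ _ _),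
        slobodeckij_congr (Lp.coeFn_zero _ _ _), slobodeckij_zero hq0, ContinuousMap.coe_zero]
      simp

instance instNormedAddCommGroup : NormedAddCommGroup (CurveSpace n q) :=
  NormedAddCommGroup.ofCore (normedSpaceCore n q)

instance instNormedSpace : NormedSpace ℝ (CurveSpace n q) :=
  NormedSpace.ofCore (normedSpaceCore n q)

/-! ### Embedded regular curves, the bi-Lipschitz constant -/

/-- The set of all `u ∈ W^{2-1/q,q}(ℝ/ℤ, ℝⁿ)` that are embedded (injective) and regular
(`u'(t) ≠ 0` for all `t`; here `u` is of class `C¹`, so that this means `min |u'| > 0`). -/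
def embeddedRegular (n : ℕ) (q : ℝ) [Fact (2 < q)] : Set (CurveSpace n q) :=
  {u | Function.Injective u.curve ∧ ∀ t : ℝ, deriv (fun r : ℝ => u.curve (r : Circ)) t ≠ 0}

/-- `bil(u) = sup_{x ≠ y} |x - y| / |u(x) - u(y)|`, with values in `[0, ∞]`. -/
def bil (u : CurveSpace n q) : ℝ≥0∞ :=
  ⨆ (x : Circ) (y : Circ) (_ : x ≠ y), ‖x - y‖ₑ / ‖u.curve x - u.curve y‖ₑ

/-! ### The tangent-point functional -/

/-- `⟨a ∧ b, c ∧ d⟩ = ⟨a, c⟩⟨b, d⟩ - ⟨a, d⟩⟨b, c⟩`. -/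
def wedgeInner (a b c d : Euc n) : ℝ :=
  inner ℝ a c * inner ℝ b d - inner ℝ a d * inner ℝ b c

/-- `|a ∧ b|`. -/
def wedgeNorm (a b : Euc n) : ℝ := √(wedgeInner a b a b)

/-- `u(x) - u(y)` at `p = (x, y)`. -/
def dif (u : CurveSpace n q) (p : Circ × Circ) : Euc n := u.curve p.1 - u.curve p.2

/-- `u'(y)` at `p = (x, y)`. -/
def velY (u : CurveSpace n q) (p : Circ × Circ) : Euc n := u.vel p.2

/-- `x - y` at `p = (x, y)`, as a real number in `(-1/2, 1/2]`. -/
def signedDif (p : Circ × Circ) : ℝ := AddCircle.equivIoc (1 : ℝ) (-1 / 2) (p.1 - p.2)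

/-- `|u'(y) ∧ (u(x) - u(y))|` -/
def wdg (u : CurveSpace n q) (p : Circ × Circ) : ℝ := wedgeNorm (velY u p) (dif u p)

/-- The integrand `|u'(y) ∧ (u(x) - u(y))|^q / |u(x) - u(y)|^{2q}`. -/
def energyIntegrand (u : CurveSpace n q) (p : Circ × Circ) : ℝ :=
  wdg u p ^ q / ‖dif u p‖ ^ (2 * q)

/-- The tangent-point functional. -/
def TP (u : CurveSpace n q) : ℝ := 1 / q * ∫ p : Circ × Circ, energyIntegrand u p

/-- The integrand of `𝓜(u; v, w)`. -/
def integrandM (u v w : CurveSpace n q) (p : Circ × Circ) : ℝ :=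
  wdg u p ^ (q - 2) / ‖dif u p‖ ^ (2 * q) *
    wedgeInner (velY u p) (dif u p) (velY v p) (dif w p - signedDif p • velY w p)

/-- The integrand of `𝓐(u; v, w)`. -/
def integrandA (u v w : CurveSpace n q) (p : Circ × Circ) : ℝ :=
  wdg u p ^ q / ‖dif u p‖ ^ (2 * q + 2) * inner ℝ (dif v p) (dif w p)

/-- The integrand of `𝓝(u; v, w, φ, ψ, ξ, η)`. -/
def integrandN (u v w φ ψ ξ η : CurveSpace n q) (p : Circ × Circ) : ℝ :=
  wdg u p ^ (q - 4) / ‖dif u p‖ ^ (2 * q) *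
    wedgeInner (velY u p) (dif u p) (velY v p) (dif w p) *
    wedgeInner (velY φ p) (dif ψ p) (velY ξ p) (dif η p)

/-- The integrand of `𝓟(u; v, w, φ)`. -/
def integrandP (u v w φ : CurveSpace n q) (p : Circ × Circ) : ℝ :=
  wdg u p ^ (q - 2) / ‖dif u p‖ ^ (2 * q + 2) *
    wedgeInner (velY u p) (dif u p) (velY v p) (dif w p) *
    inner ℝ (dif u p) (dif φ p)

/-- The integrand of `𝓑(u; v, w, φ, ψ, ξ, η)`. -/
def integrandB (u v w φ ψ ξ η : CurveSpace n q) (p : Circ × Circ) : ℝ :=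
  wdg u p ^ (q - 2) / ‖dif u p‖ ^ (2 * q + 4) * inner ℝ (dif v p) (dif w p) *
    wedgeInner (velY u p) (dif u p) (velY φ p) (dif ψ p) *
    inner ℝ (dif ξ p) (dif η p)

/-- The integrand of the explicit formula for the second variation. The terms are combined under
one integral, since only suitable sums of them (not each one alone) are integrable. -/
def secondVariationIntegrand (u v w : CurveSpace n q) (p : Circ × Circ) : ℝ :=
  (q - 2) * (integrandN u u v u u w u p + integrandN u u v u u u w p
      + integrandN u v u u u w u p + integrandN u v u u u u w p)
    + integrandN u u u w u u v p + integrandN u u u u w u v p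
    + integrandN u u u w u v u p + integrandN u u u u w v u p
    - 2 * q * (integrandP u u v w p + integrandP u v u w p)
    + integrandM u v w p + integrandM u w v p
    - 2 * q * (integrandB u u v w u u u p + integrandB u u v u w u u p)
    + 4 * (q + 1) * integrandB u u v u u u w p
    - 2 * integrandA u v w p

/-- The second variation `δ²TP(u)[v, w]`, i.e. the second Fréchet derivative of `TP` on
`W^{2-1/q,q}(ℝ/ℤ, ℝⁿ)` at `u` in the directions `v` and `w`. -/
def secondVariation (u v w : CurveSpace n q) : ℝ :=
  fderiv ℝ (fun z : CurveSpace n q => fderiv ℝ TP z) u v w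

end TangentPoint

end

noncomputable section

set_option maxSynthPendingDepth 3

namespace TangentPoint

open Filter Topology

/-! ### Fréchet differentiability from continuous directional derivatives -/

/-! Since `u' ∧ u' = 0`, the numerator `u'(y) ∧ Du` equals `u'(y) ∧ (Du - (x - y) u'(y))`. Dividing
by `(x - y)²` above and below, the integrand of `TP` becomes `‖F(u)‖ ^ q` with `F(u) = β(u, u) /
σ(u, u)`, where `β(u, v) = u'(y) ∧ (Dv - (x - y) v'(y)) / (x - y)²` and `σ(u, v) = ⟨Du, Dv⟩ / |x -
y|²` are bilinear.

The map `β` is bounded from `W^{2-1/q,q}` into `L^q` of the torus with values in bivectors. The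
Taylor remainder is an average of differences of `u'`, and averaging over dilations does not
increase the Slobodeckij integral (`lintegral_remainder_le`); the factor `u'(y)` is bounded by
Morrey's embedding (`exists_continuous_vel`). The map `σ` takes values in the Banach algebra of
continuous functions on the torus (`continuous_inner_secant`), and `σ(u, u)` is a unit there when
`u` is embedded and regular (`isUnit_metricForm`). Inversion is smooth at units, so `F` is smooth
near `u` and its derivatives are given by the quotient rule.

Now `TP = (1/q) E ∘ F` with `E(f) = ∫ ‖f‖ ^ q`. For `q > 2` the Hessian of `‖x‖ ^ q` is continuous
with growth of order `q - 2`, so it induces a continuous superposition operator from `L^q` to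
`L^{q/(q-2)}` (`tendsto_lpHess`), and Hölder's inequality makes `E` of class `C²`
(`contDiff_lpEnergy`). The chain rule (`fderiv_fderiv_comp_quadQuot`) yields `δ²TP = (1/q)
(E''(F)[F₁ v, F₁ w] + E'(F)[F₂(v, w)])`. Both summands are integrals of integrable functions, and a
pointwise expansion (`powHess_add_powGrad_quotient`) turns their sum into the stated integrand.

The bound is Hölder's inequality for `E'` and `E''` combined with norm estimates for `F` and its
derivatives, in which `1 / σ(u, u) ≤ bil(u)²`. The summands carry different powers of `bil(u)` and
`‖u'‖_∞`; they are brought to a common form by `1 ≤ bil(u) ‖u'‖_∞` and by Morrey's bound of `‖u'‖_∞`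
by the Sobolev–Slobodeckij norm of `u'`. -/

/-- A map into a space of operators with directional derivatives (in the weak sense, tested on
vectors) that depend continuously on the point is Fréchet differentiable. -/
lemma hasFDerivAt_of_weak_lineDeriv {X Y F : Type*} [NormedAddCommGroup X] [NormedSpace ℝ X]
    [NormedAddCommGroup Y] [NormedSpace ℝ Y] [NormedAddCommGroup F] [NormedSpace ℝ F]
    {f : X → Y →L[ℝ] F} {f' : X → X →L[ℝ] Y →L[ℝ] F}
    (h : ∀ u v w, HasDerivAt (fun t : ℝ => f (u + t • v) w) (f' u v w) 0)
    (hc : ∀ u, Tendsto (fun y => ‖f' y - f' u‖) (𝓝 u) (𝓝 0)) (u : X) :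
    HasFDerivAt f (f' u) u := by
  have h' : ∀ v w t, HasDerivAt (fun t : ℝ => f (u + t • v) w) (f' (u + t • v) v w) t := by
    intro v w t
    have h1 := h (u + t • v) v w
    have h2 : HasDerivAt (fun s : ℝ => s - t) 1 t := (hasDerivAt_id t).sub_const t
    have h3 := HasDerivAt.scomp_of_eq (g₁ := fun s => f (u + t • v + s • v) w) t h1 h2 (by simp)
    rw [one_smul] at h3
    refine h3.congr_of_eventuallyEq (Eventually.of_forall fun s => ?_)
    simp only [Function.comp, add_assoc, ← add_smul]
    congr 4
    ring
  rw [hasFDerivAt_iff_isLittleO_nhds_zero, Asymptotics.isLittleO_iff]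
  intro ε hε
  obtain ⟨δ, hδ, hball⟩ := Metric.eventually_nhds_iff.1 ((hc u).eventually (gt_mem_nhds hε))
  filter_upwards [Metric.ball_mem_nhds (0 : X) hδ] with v hv
  rw [mem_ball_zero_iff] at hv
  refine ContinuousLinearMap.opNorm_le_bound _ (by positivity) fun w => ?_
  -- For fixed `w`, the mean value inequality is applied to the linearisation error along the
  -- segment. Its bound is linear in `‖w‖` with a constant independent of `w`, so weak derivatives
  -- control the operator norm.
  have hd : ∀ t ∈ Icc (0 : ℝ) 1, HasDerivWithinAt
      (fun t : ℝ => f (u + t • v) w - t • f' u v w) ((f' (u + t • v) - f' u) v w) (Icc 0 1) t := by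
    intro t _
    have h5 : HasDerivAt (fun t : ℝ => t • f' u v w) ((1 : ℝ) • f' u v w) t :=
      (hasDerivAt_id t).smul_const _
    have h4 := (h' v w t).sub h5
    rw [one_smul] at h4
    exact h4.hasDerivWithinAt
  have hb : ∀ t ∈ Ico (0 : ℝ) 1, ‖(f' (u + t • v) - f' u) v w‖ ≤ ε * ‖v‖ * ‖w‖ := by
    intro t ht
    refine (ContinuousLinearMap.le_opNorm₂ _ _ _).trans ?_
    gcongr
    refine le_of_lt (hball ?_)
    rw [dist_eq_norm, add_sub_cancel_left, norm_smul, Real.norm_of_nonneg ht.1]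
    nlinarith [ht.1, ht.2, norm_nonneg v]
  have := norm_image_sub_le_of_norm_deriv_le_segment' hd hb 1 (by simp)
  simpa [sub_right_comm] using this

/-- A function with continuous second directional derivatives is of class `C²`. -/
lemma hasFDerivAt_of_lineDeriv {X F : Type*} [NormedAddCommGroup X] [NormedSpace ℝ X]
    [NormedAddCommGroup F] [NormedSpace ℝ F] {f : X → F} {f' : X → X →L[ℝ] F}
    (h : ∀ u v, HasDerivAt (fun t : ℝ => f (u + t • v)) (f' u v) 0)
    (hc : ∀ u, Tendsto (fun y => ‖f' y - f' u‖) (𝓝 u) (𝓝 0)) (u : X) : HasFDerivAt f (f' u) u := by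
  -- Vectors of `F` are viewed as operators on `ℝ`, which reduces this to the operator-valued case;
  -- evaluation at `1` undoes the encoding.
  have key := hasFDerivAt_of_weak_lineDeriv (Y := ℝ)
    (f := fun x => ContinuousLinearMap.toSpanSingleton ℝ (f x))
    (f' := fun x => (ContinuousLinearMap.toSpanSingletonCLE (𝕜 := ℝ) (E := F)
      : F →L[ℝ] (ℝ →L[ℝ] F)).comp (f' x)) (fun u v w => ?_) ?_ u
  · have h2 := ((ContinuousLinearMap.apply ℝ F (1 : ℝ)).hasFDerivAt).comp u key
    convert h2 using 1
    · ext x; simp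
    · ext x; simp
  · simpa [Pi.smul_def] using (h u v).const_smul w
  · intro u
    refine squeeze_zero (fun _ => ContinuousLinearMap.opNorm_nonneg _) (fun y => ?_) (hc u)
    refine ContinuousLinearMap.opNorm_le_bound₂ _ (norm_nonneg _) fun v w => ?_
    have := (f' y - f' u).le_opNorm v
    simp only [sub_apply, ContinuousLinearMap.comp_apply,
      ContinuousLinearEquiv.coe_coe, ContinuousLinearMap.toSpanSingletonCLE_apply_apply] at this ⊢
    rw [← smul_sub, norm_smul, mul_comm]
    gcongr

/-! ### The power `‖x‖ ^ q` in an inner product space, for `q > 2` -/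

section NormPower

variable {H : Type*} [NormedAddCommGroup H] [InnerProductSpace ℝ H]

/-- The real inner product as a continuous bilinear map. -/
def innerCLM : H →L[ℝ] H →L[ℝ] ℝ :=
  (innerₗ H).mkContinuous₂ 1 fun x y => by simpa using norm_inner_le_norm (𝕜 := ℝ) x y

@[simp] lemma innerCLM_apply (x y : H) : innerCLM x y = inner ℝ x y := rfl

lemma innerCLM_eq_innerSL (x : H) : innerCLM x = innerSL ℝ x := by
  ext y; simp

/-- The gradient of `‖x‖ ^ q`, as a functional. -/
def powGrad (q : ℝ) (x : H) : H →L[ℝ] ℝ := (q * ‖x‖ ^ (q - 2)) • innerCLM x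

/-- The Hessian of `‖x‖ ^ q`, as a bilinear form. -/
def powHess (q : ℝ) (x : H) : H →L[ℝ] H →L[ℝ] ℝ :=
  (q * ‖x‖ ^ (q - 2)) • innerCLM +
    (q * (q - 2) * ‖x‖ ^ (q - 4)) • (innerCLM x).smulRight (innerCLM x)

lemma powGrad_apply (q : ℝ) (x a : H) : powGrad q x a = q * ‖x‖ ^ (q - 2) * inner ℝ x a := by
  simp [powGrad]

lemma powHess_apply (q : ℝ) (x a b : H) : powHess q x a b =
    q * ‖x‖ ^ (q - 2) * inner ℝ a b + q * (q - 2) * ‖x‖ ^ (q - 4) * (inner ℝ x a * inner ℝ x b) := by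
  simp [powHess]

lemma norm_powGrad_le {q : ℝ} (hq : 2 < q) (x : H) : ‖powGrad q x‖ ≤ q * ‖x‖ ^ (q - 1) := by
  rw [powGrad, norm_smul, innerCLM_eq_innerSL, innerSL_apply_norm, Real.norm_of_nonneg (by positivity), mul_assoc]
  gcongr
  rw [← Real.rpow_add_one' (norm_nonneg _) (by linarith)]
  ring_nf
  rfl

/-- For `q < 4` the factor `‖x‖ ^ (q - 4)` is singular at the origin, but it multiplies a form that
is quadratic in `x`. The resulting growth of order `q - 2` dictates the exponent `q / (q - 2)` used
for the Hessian below. -/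
lemma norm_powHess_le {q : ℝ} (hq : 2 < q) (x : H) :
    ‖powHess q x‖ ≤ q * (q - 1) * ‖x‖ ^ (q - 2) := by
  have hq2 : 0 < q - 2 := by linarith
  refine ContinuousLinearMap.opNorm_le_bound₂ _
    (mul_nonneg (mul_nonneg (by linarith) (by linarith)) (by positivity)) fun a b => ?_
  rw [powHess_apply]
  have h1 := abs_real_inner_le_norm a b
  have h2 := abs_real_inner_le_norm x a
  have h3 := abs_real_inner_le_norm x b
  have h4 : ‖x‖ ^ (q - 4) * (‖x‖ * ‖x‖) ≤ ‖x‖ ^ (q - 2) := by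
    rcases eq_or_ne x 0 with rfl | hx
    · simp
      positivity
    · have : 0 < ‖x‖ := norm_pos_iff.2 hx
      rw [← mul_assoc, ← Real.rpow_add_one this.ne', ← Real.rpow_add_one this.ne']
      ring_nf
      rfl
  have h5 : |inner ℝ x a * inner ℝ x b| ≤ (‖x‖ * ‖x‖) * (‖a‖ * ‖b‖) := by
    rw [abs_mul]
    calc _ ≤ (‖x‖ * ‖a‖) * (‖x‖ * ‖b‖) := by gcongr
      _ = _ := by ring
  rw [Real.norm_eq_abs]
  calc _ ≤ |q * ‖x‖ ^ (q - 2) * inner ℝ a b|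
        + |q * (q - 2) * ‖x‖ ^ (q - 4) * (inner ℝ x a * inner ℝ x b)| := abs_add_le _ _
    _ = q * ‖x‖ ^ (q - 2) * |inner ℝ a b|
        + q * (q - 2) * ‖x‖ ^ (q - 4) * |inner ℝ x a * inner ℝ x b| := by
      have e1 : 0 ≤ q * ‖x‖ ^ (q - 2) := by positivity
      have e2 : 0 ≤ q * (q - 2) * ‖x‖ ^ (q - 4) := by positivity
      rw [abs_mul, abs_mul (q * (q - 2) * ‖x‖ ^ (q - 4)), abs_of_nonneg e1, abs_of_nonneg e2]
    _ ≤ q * ‖x‖ ^ (q - 2) * (‖a‖ * ‖b‖)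
        + q * (q - 2) * ‖x‖ ^ (q - 4) * ((‖x‖ * ‖x‖) * (‖a‖ * ‖b‖)) := by gcongr
    _ = q * ‖x‖ ^ (q - 2) * (‖a‖ * ‖b‖)
        + q * (q - 2) * (‖x‖ ^ (q - 4) * (‖x‖ * ‖x‖)) * (‖a‖ * ‖b‖) := by ring
    _ ≤ q * ‖x‖ ^ (q - 2) * (‖a‖ * ‖b‖)
        + q * (q - 2) * ‖x‖ ^ (q - 2) * (‖a‖ * ‖b‖) := by gcongr
    _ = _ := by ring

lemma continuous_powGrad {q : ℝ} (hq : 2 < q) : Continuous (powGrad q : H → H →L[ℝ] ℝ) := by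
  unfold powGrad
  have : Continuous fun x : H => ‖x‖ ^ (q - 2) :=
    continuous_norm.rpow_const fun _ => Or.inr (by linarith)
  fun_prop

/-- At the origin the growth bound squeezes the Hessian to zero, because `q - 2 > 0`; elsewhere all
powers of the norm are continuous. -/
lemma continuous_powHess {q : ℝ} (hq : 2 < q) :
    Continuous (powHess q : H → H →L[ℝ] H →L[ℝ] ℝ) := by
  rw [continuous_iff_continuousAt]
  intro x
  by_cases hx : x = 0
  · subst hx
    have h0 : powHess q (0 : H) = 0 := by
      ext a b
      rw [powHess_apply]
      simp [Real.zero_rpow (show q - 2 ≠ 0 by linarith)]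
    rw [ContinuousAt, h0]
    refine tendsto_zero_iff_norm_tendsto_zero.2 ?_
    have hc : Continuous fun x : H => q * (q - 1) * ‖x‖ ^ (q - 2) :=
      continuous_const.mul (continuous_norm.rpow_const fun _ => Or.inr (by linarith))
    refine squeeze_zero (fun _ => norm_nonneg _) (fun y => norm_powHess_le hq y)
      (hc.tendsto' 0 0 ?_)
    simp [Real.zero_rpow (show q - 2 ≠ 0 by linarith)]
  · have hx' : ‖x‖ ≠ 0 := norm_ne_zero_iff.2 hx
    unfold powHess
    have h1 : ContinuousAt (fun x : H => ‖x‖ ^ (q - 2)) x :=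
      continuous_norm.continuousAt.rpow_const (Or.inl hx')
    have h2 : ContinuousAt (fun x : H => ‖x‖ ^ (q - 4)) x :=
      continuous_norm.continuousAt.rpow_const (Or.inl hx')
    have h3 : Continuous fun x : H => (innerCLM x).smulRight (innerCLM x) :=
      (((ContinuousLinearMap.smulRightL ℝ H (H →L[ℝ] ℝ)).continuous.comp
        (innerCLM).continuous).clm_apply (innerCLM).continuous)
    have h4 := h3.continuousAt (x := x)
    exact ((continuousAt_const.mul h1).smul continuousAt_const).add
      ((continuousAt_const.mul h2).smul h4)

lemma hasDerivAt_norm_rpow_line {q : ℝ} (hq : 2 < q) (x y : H) (t : ℝ) :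
    HasDerivAt (fun t : ℝ => ‖x + t • y‖ ^ q) (powGrad q (x + t • y) y) t := by
  have h1 : HasDerivAt (fun t : ℝ => x + t • y) y t := by
    simpa using ((hasDerivAt_id t).smul_const y).const_add x
  rw [powGrad, innerCLM_eq_innerSL]
  exact (hasFDerivAt_norm_rpow (x + t • y) (by linarith)).comp_hasDerivAt t h1

/-- At the origin the gradient is of order `‖x‖ ^ (q - 1) = o(‖x‖)`. Elsewhere `‖x‖ ^ (q - 2)` is
the power `(q - 2) / 2` of the smooth function `‖x‖²`, and the product rule applies. -/
lemma hasFDerivAt_powGrad {q : ℝ} (hq : 2 < q) (x : H) :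
    HasFDerivAt (powGrad q) (powHess q x) x := by
  by_cases hx : x = 0
  · subst hx
    have h0 : powHess q (0 : H) = 0 := by
      ext a b
      rw [powHess_apply]
      simp [Real.zero_rpow (show q - 2 ≠ 0 by linarith)]
    have h1 : powGrad q (0 : H) = 0 := by
      ext a
      simp [powGrad_apply]
    rw [h0]
    refine .of_isLittleO ?_
    have hc : Continuous fun x : H => q * ‖x‖ ^ (q - 2) :=
      continuous_const.mul (continuous_norm.rpow_const fun _ => Or.inr (by linarith))
    rw [Asymptotics.isLittleO_iff]
    intro ε hε
    have h2 := (hc.tendsto' 0 0 (by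
      simp [Real.zero_rpow (show q - 2 ≠ 0 by linarith)])).eventually (gt_mem_nhds hε)
    filter_upwards [h2] with y hy
    rw [h1]
    simp only [sub_zero, zero_apply]
    refine (norm_powGrad_le hq y).trans ?_
    rw [show q - 1 = q - 2 + 1 by ring, Real.rpow_add_one' (norm_nonneg _) (by linarith),
      ← mul_assoc]
    gcongr
  · have hs := ((((hasStrictFDerivAt_norm_sq x).rpow_const (p := (q - 2) / 2)
      (by simp [hx])).const_mul q).smul (innerCLM (H := H)).hasStrictFDerivAt).hasFDerivAt
    have hx' : ‖x‖ ≠ 0 := norm_ne_zero_iff.2 hx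
    refine (hs.congr_fderiv ?_).congr_of_eventuallyEq (Eventually.of_forall fun y => ?_)
    · ext a b
      rw [powHess_apply]
      simp only [← Real.rpow_natCast_mul (norm_nonneg _)]
      simp only [Nat.cast_ofNat, add_apply, smul_apply,
        innerCLM_apply, smul_eq_mul, ContinuousLinearMap.smulRight_apply,
        innerSL_apply_apply, two_smul]
      rw [show (2 : ℝ) * ((q - 2) / 2) = q - 2 by ring,
        show (2 : ℝ) * ((q - 2) / 2 - 1) = q - 4 by ring]
      ring
    · simp only [← Real.rpow_natCast_mul (norm_nonneg _)]
      rw [powGrad]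
      congr 3
      push_cast
      ring

lemma hasDerivAt_powGrad_line {q : ℝ} (hq : 2 < q) (x y a : H) (t : ℝ) :
    HasDerivAt (fun t : ℝ => powGrad q (x + t • y) a) (powHess q (x + t • y) y a) t := by
  have h1 : HasDerivAt (fun t : ℝ => x + t • y) y t := by
    simpa using ((hasDerivAt_id t).smul_const y).const_add x
  exact ((ContinuousLinearMap.apply ℝ ℝ a).hasFDerivAt.comp_hasDerivAt t
    ((hasFDerivAt_powGrad hq (x + t • y)).comp_hasDerivAt t h1))

end NormPower

/-! ### Superposition operators between `Lp` spaces -/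

section Superposition

variable {Q : Type*} [MeasurableSpace Q] {μ : Measure Q}
  {H : Type*} [NormedAddCommGroup H] {M : Type*} [NormedAddCommGroup M]
  {K : H → M} {C q r : ℝ}

lemma memLp_comp_of_growth (hr : 0 < r) (hK : Continuous K)
    (hb : ∀ x, ‖K x‖ ≤ C * ‖x‖ ^ r) {f : Q → H} (hf : MemLp f (ENNReal.ofReal q) μ) :
    MemLp (fun x => K (f x)) (ENNReal.ofReal (q / r)) μ := by
  have h1 := hf.norm_rpow_div (ENNReal.ofReal r)
  rw [ENNReal.toReal_ofReal hr.le, ← ENNReal.ofReal_div_of_pos hr] at h1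
  refine h1.of_le_mul (hK.comp_aestronglyMeasurable hf.1) (c := C) (.of_forall fun x => ?_)
  rw [Real.norm_of_nonneg (by positivity)]
  exact hb _

lemma eLpNorm_comp_le_of_growth (hr : 0 < r)
    (hb : ∀ x, ‖K x‖ ≤ C * ‖x‖ ^ r) (f : Q → H) :
    eLpNorm (fun x => K (f x)) (ENNReal.ofReal (q / r)) μ ≤
      ENNReal.ofReal C * eLpNorm f (ENNReal.ofReal q) μ ^ r := by
  have h1 : eLpNorm (fun x => K (f x)) (ENNReal.ofReal (q / r)) μ ≤
      ENNReal.ofReal C * eLpNorm (fun x => ‖f x‖ ^ r) (ENNReal.ofReal (q / r)) μ :=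
    eLpNorm_le_mul_eLpNorm_of_ae_le_mul (.of_forall fun x => by
      rw [Real.norm_of_nonneg (by positivity)]
      exact hb _) _
  rw [eLpNorm_norm_rpow f hr] at h1
  rwa [ENNReal.ofReal_div_of_pos hr,
    ENNReal.div_mul_cancel (by simpa using hr) ENNReal.ofReal_ne_top,
    ← ENNReal.ofReal_div_of_pos hr] at h1

/-- Both `‖a‖` and `‖b‖` are at most twice the larger of `‖a - b‖` and `‖b‖`. With `a = f k x` and
`b = g x` the bound is a sum of a term whose integral tends to zero and a fixed integrable one,
which is the domination needed for continuity of superposition operators. -/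
lemma norm_comp_sub_rpow_le (hr : 0 < r) (hq : 0 < q) (hC : 0 ≤ C)
    (hb : ∀ x, ‖K x‖ ≤ C * ‖x‖ ^ r) (a b : H) :
    ‖K a - K b‖ ^ (q / r) ≤ (2 * C) ^ (q / r) * 2 ^ q * (‖a - b‖ ^ q + ‖b‖ ^ q) := by
  set m := max ‖a - b‖ ‖b‖ with hm
  have hm0 : 0 ≤ m := le_max_of_le_right (norm_nonneg _)
  have ha : ‖a‖ ≤ 2 * m := by
    calc ‖a‖ = ‖a - b + b‖ := by simp
      _ ≤ ‖a - b‖ + ‖b‖ := norm_add_le _ _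
      _ ≤ 2 * m := by linarith [le_max_left ‖a - b‖ ‖b‖, le_max_right ‖a - b‖ ‖b‖]
  have hb' : ‖b‖ ≤ 2 * m := by linarith [le_max_right ‖a - b‖ ‖b‖]
  have h1 : ‖K a - K b‖ ≤ 2 * C * (2 * m) ^ r := by
    calc ‖K a - K b‖ ≤ ‖K a‖ + ‖K b‖ := norm_sub_le _ _
      _ ≤ C * ‖a‖ ^ r + C * ‖b‖ ^ r := add_le_add (hb _) (hb _)
      _ ≤ C * (2 * m) ^ r + C * (2 * m) ^ r := by gcongr
      _ = _ := by ring
  calc ‖K a - K b‖ ^ (q / r) ≤ (2 * C * (2 * m) ^ r) ^ (q / r) := by gcongr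
    _ = (2 * C) ^ (q / r) * 2 ^ q * m ^ q := by
      rw [Real.mul_rpow (by positivity) (by positivity), ← Real.rpow_mul (by positivity),
        mul_div_cancel₀ _ hr.ne', Real.mul_rpow (by positivity) hm0, mul_assoc]
    _ ≤ _ := by
      gcongr
      rcases max_choice ‖a - b‖ ‖b‖ with h | h <;> rw [hm, h]
      · linarith [Real.rpow_nonneg (norm_nonneg b) q]
      · linarith [Real.rpow_nonneg (norm_nonneg (a - b)) q]

lemma enorm_comp_sub_rpow_le (hr : 0 < r) (hq : 0 < q) (hC : 0 ≤ C)
    (hb : ∀ x, ‖K x‖ ≤ C * ‖x‖ ^ r) (a b : H) :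
    ‖K a - K b‖ₑ ^ (q / r) ≤
      ENNReal.ofReal ((2 * C) ^ (q / r) * 2 ^ q) * (‖a - b‖ₑ ^ q + ‖b‖ₑ ^ q) := by
  have h := ENNReal.ofReal_le_ofReal (norm_comp_sub_rpow_le hr hq hC hb a b)
  rw [ENNReal.ofReal_mul (by positivity), ENNReal.ofReal_add (by positivity) (by positivity),
    ← ENNReal.ofReal_rpow_of_nonneg (norm_nonneg _) (by positivity),
    ← ENNReal.ofReal_rpow_of_nonneg (norm_nonneg _) hq.le,
    ← ENNReal.ofReal_rpow_of_nonneg (norm_nonneg _) hq.le] at h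
  simpa only [ofReal_norm] using h

lemma lintegral_rpow_eq_eLpNorm (hq : 0 < q) (f : Q → H) :
    ∫⁻ x, ‖f x‖ₑ ^ q ∂μ = eLpNorm f (ENNReal.ofReal q) μ ^ q := by
  rw [eLpNorm_eq_lintegral_rpow_enorm_toReal (by simpa using hq) ENNReal.ofReal_ne_top,
    ENNReal.toReal_ofReal hq.le, ← ENNReal.rpow_mul, one_div_mul_cancel hq.ne', ENNReal.rpow_one]

/-- Continuity of superposition operators of growth `r`, from `L^q` to `L^{q/r}`. -/
lemma tendsto_eLpNorm_comp_sub (hr : 0 < r) (hq : 0 < q) (hC : 0 ≤ C) (hK : Continuous K)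
    (hb : ∀ x, ‖K x‖ ≤ C * ‖x‖ ^ r) {f : ℕ → Q → H} {g : Q → H}
    (hf : ∀ k, MemLp (f k) (ENNReal.ofReal q) μ) (hg : MemLp g (ENNReal.ofReal q) μ)
    (h : Tendsto (fun k => eLpNorm (f k - g) (ENNReal.ofReal q) μ) atTop (𝓝 0)) :
    Tendsto (fun k => eLpNorm (fun x => K (f k x) - K (g x)) (ENNReal.ofReal (q / r)) μ)
      atTop (𝓝 0) := by
  have hqr : 0 < q / r := div_pos hq hr
  set D := ENNReal.ofReal ((2 * C) ^ (q / r) * 2 ^ q) with hD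
  have hDtop : D ≠ ∞ := ENNReal.ofReal_ne_top
  suffices hs : Tendsto (fun k => ∫⁻ x, ‖K (f k x) - K (g x)‖ₑ ^ (q / r) ∂μ) atTop (𝓝 0) by
    have h1 := (ENNReal.continuous_rpow_const (y := 1 / (q / r))).tendsto' 0 0
      (ENNReal.zero_rpow_of_pos (by positivity)) |>.comp hs
    refine h1.congr fun k => ?_
    rw [eLpNorm_eq_lintegral_rpow_enorm_toReal (by simpa using hqr) ENNReal.ofReal_ne_top,
      ENNReal.toReal_ofReal hqr.le]
    rfl
  -- Convergence in `L^q` gives convergence almost everywhere only along a subsequence, so the limit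
  -- is checked on a further subsequence of each subsequence.
  refine tendsto_of_subseq_tendsto fun ns hns => ?_
  have h1 : Tendsto (fun k => eLpNorm (f (ns k) - g) (ENNReal.ofReal q) μ) atTop (𝓝 0) :=
    h.comp hns
  obtain ⟨ms, hmono, hms⟩ := (tendstoInMeasure_of_tendsto_eLpNorm (by simpa using hq)
    (fun k => (hf (ns k)).1) hg.1 h1).exists_seq_tendsto_ae
  have h1' : Tendsto (fun k => eLpNorm (f (ns (ms k)) - g) (ENNReal.ofReal q) μ) atTop (𝓝 0) :=
    h1.comp hmono.tendsto_atTop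
  refine ⟨ms, ?_⟩
  have hmeas : ∀ k, AEMeasurable (fun x => ‖K (f k x) - K (g x)‖ₑ ^ (q / r)) μ := fun k =>
    (((hK.comp_aestronglyMeasurable (hf k).1).sub
      (hK.comp_aestronglyMeasurable hg.1)).enorm).pow_const _
  have hmeas' : ∀ k, AEMeasurable (fun x => ‖f k x - g x‖ₑ ^ q) μ := fun k =>
    (((hf k).1.sub hg.1).enorm).pow_const _
  -- the part that is dominated by `‖g‖ ^ q`
  have h2 : Tendsto (fun k => ∫⁻ x, (‖K (f (ns (ms k)) x) - K (g x)‖ₑ ^ (q / r)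
      - D * ‖f (ns (ms k)) x - g x‖ₑ ^ q) ∂μ) atTop (𝓝 (∫⁻ _, 0 ∂μ)) := by
    refine tendsto_lintegral_of_dominated_convergence' (fun x => D * ‖g x‖ₑ ^ q)
      (fun k => (hmeas _).sub ((hmeas' _).const_mul _)) (fun k => .of_forall fun x => ?_) ?_ ?_
    · rw [tsub_le_iff_left, ← mul_add]
      exact enorm_comp_sub_rpow_le hr hq hC hb _ _
    · rw [lintegral_const_mul' _ _ hDtop, lintegral_rpow_eq_eLpNorm hq]
      exact ENNReal.mul_ne_top hDtop (ENNReal.rpow_ne_top_of_nonneg hq.le hg.2.ne)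
    · filter_upwards [hms] with x hx
      have h3 : Tendsto (fun k => ‖K (f (ns (ms k)) x) - K (g x)‖ₑ ^ (q / r)) atTop (𝓝 0) := by
        have h4 : Continuous fun y => ‖K y - K (g x)‖ₑ ^ (q / r) :=
          ENNReal.continuous_rpow_const.comp (hK.sub continuous_const).enorm
        exact (h4.tendsto' (g x) 0 (by simp [hqr])).comp hx
      exact tendsto_of_tendsto_of_tendsto_of_le_of_le tendsto_const_nhds h3
        (fun _ => zero_le) (fun _ => tsub_le_self)
  -- The part removed by the truncated subtraction vanishes in the limit by norm convergence.
  have h5 : Tendsto (fun k => D * eLpNorm (f (ns (ms k)) - g) (ENNReal.ofReal q) μ ^ q)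
      atTop (𝓝 0) := by
    have h6 : Continuous fun y : ℝ≥0∞ => D * y ^ q :=
      (ENNReal.continuous_const_mul hDtop).comp ENNReal.continuous_rpow_const
    exact (h6.tendsto' 0 0 (by simp [hq])).comp h1'
  have h7 := h2.add h5
  simp only [lintegral_zero, add_zero] at h7
  refine tendsto_of_tendsto_of_tendsto_of_le_of_le tendsto_const_nhds h7
    (fun _ => zero_le) fun k => ?_
  have h8 : D * eLpNorm (f (ns (ms k)) - g) (ENNReal.ofReal q) μ ^ q =
      ∫⁻ x, D * ‖f (ns (ms k)) x - g x‖ₑ ^ q ∂μ := by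
    rw [lintegral_const_mul' _ _ hDtop, ← lintegral_rpow_eq_eLpNorm hq]
    rfl
  rw [h8, ← lintegral_add_right' _ ((hmeas' _).const_mul _)]
  exact lintegral_mono fun x => le_tsub_add

end Superposition

/-! ### The functional `∫ ‖f‖ ^ q` on `Lp` is of class `C²` -/

section LpEnergy

variable {Q : Type*} [MeasurableSpace Q] {μ : Measure Q}
  {H : Type*} [NormedAddCommGroup H] [InnerProductSpace ℝ H] {q : ℝ} [hq : Fact (2 < q)]

/-- A Hessian in `L^{q/(q-2)}` contracted with one `L^q` function lies in `L^{q/(q-1)}`; that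
exponent is conjugate to `q`, so a second contraction is integrable. -/
instance holderTripleHess : ENNReal.HolderTriple (ENNReal.ofReal (q / (q - 2)))
    (ENNReal.ofReal q) (ENNReal.ofReal (q / (q - 1))) := by
  have h := hq.out
  refine Real.HolderTriple.ennrealOfReal ⟨?_, ?_, ?_⟩
  · have : q - 2 ≠ 0 := by linarith
    have : q - 1 ≠ 0 := by linarith
    have : q ≠ 0 := by linarith
    field_simp
    ring
  · exact div_pos (by linarith) (by linarith)
  · linarith

instance holderConjugateGrad : ENNReal.HolderConjugate (ENNReal.ofReal (q / (q - 1)))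
    (ENNReal.ofReal q) := by
  have h := hq.out
  refine Real.HolderConjugate.ennrealOfReal ⟨?_, ?_, ?_⟩
  · have : q - 1 ≠ 0 := by linarith
    have : q ≠ 0 := by linarith
    field_simp
    ring
  · exact div_pos (by linarith) (by linarith)
  · linarith

instance factOneLeHess : Fact (1 ≤ ENNReal.ofReal (q / (q - 2))) :=
  ⟨by
    have h := hq.out
    rw [← ENNReal.ofReal_one]
    apply ENNReal.ofReal_le_ofReal
    rw [le_div_iff₀ (by linarith)]
    linarith⟩

instance factOneLeGrad : Fact (1 ≤ ENNReal.ofReal (q / (q - 1))) :=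
  ⟨by
    have h := hq.out
    rw [← ENNReal.ofReal_one]
    apply ENNReal.ofReal_le_ofReal
    rw [le_div_iff₀ (by linarith)]
    linarith⟩

/-- The class of `powGrad q ∘ f` in `L^{q/(q-1)}`. -/
def lpGrad (f : Lp H (ENNReal.ofReal q) μ) : Lp (H →L[ℝ] ℝ) (ENNReal.ofReal (q / (q - 1))) μ :=
  (memLp_comp_of_growth (by linarith [hq.out]) (continuous_powGrad hq.out)
    (norm_powGrad_le hq.out) (Lp.memLp f)).toLp

/-- The class of `powHess q ∘ f` in `L^{q/(q-2)}`. -/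
def lpHess (f : Lp H (ENNReal.ofReal q) μ) :
    Lp (H →L[ℝ] H →L[ℝ] ℝ) (ENNReal.ofReal (q / (q - 2))) μ :=
  (memLp_comp_of_growth (by linarith [hq.out]) (continuous_powHess hq.out)
    (norm_powHess_le hq.out) (Lp.memLp f)).toLp

lemma coeFn_lpGrad (f : Lp H (ENNReal.ofReal q) μ) : lpGrad f =ᵐ[μ] fun x => powGrad q (f x) :=
  MemLp.coeFn_toLp _

lemma coeFn_lpHess (f : Lp H (ENNReal.ofReal q) μ) : lpHess f =ᵐ[μ] fun x => powHess q (f x) :=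
  MemLp.coeFn_toLp _

lemma norm_lpGrad_le (f : Lp H (ENNReal.ofReal q) μ) : ‖lpGrad f‖ ≤ q * ‖f‖ ^ (q - 1) := by
  have h := eLpNorm_comp_le_of_growth (μ := μ) (q := q) (r := q - 1) (by linarith [hq.out])
    (norm_powGrad_le (H := H) hq.out) f
  have h0 : 0 ≤ q := by linarith [hq.out]
  rw [Lp.norm_def, eLpNorm_congr_ae (coeFn_lpGrad f)]
  refine (ENNReal.toReal_mono ?_ h).trans_eq ?_
  · exact ENNReal.mul_ne_top ENNReal.ofReal_ne_top
      (ENNReal.rpow_ne_top_of_nonneg (by linarith [hq.out]) (Lp.memLp f).2.ne)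
  · rw [ENNReal.toReal_mul, ENNReal.toReal_ofReal h0, ← ENNReal.toReal_rpow, ← Lp.norm_def]

lemma norm_lpHess_le (f : Lp H (ENNReal.ofReal q) μ) :
    ‖lpHess f‖ ≤ q * (q - 1) * ‖f‖ ^ (q - 2) := by
  have h := eLpNorm_comp_le_of_growth (μ := μ) (q := q) (r := q - 2) (by linarith [hq.out])
    (norm_powHess_le (H := H) hq.out) f
  have h0 : 0 ≤ q * (q - 1) := mul_nonneg (by linarith [hq.out]) (by linarith [hq.out])
  rw [Lp.norm_def, eLpNorm_congr_ae (coeFn_lpHess f)]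
  refine (ENNReal.toReal_mono ?_ h).trans_eq ?_
  · exact ENNReal.mul_ne_top ENNReal.ofReal_ne_top
      (ENNReal.rpow_ne_top_of_nonneg (by linarith [hq.out]) (Lp.memLp f).2.ne)
  · rw [ENNReal.toReal_mul, ENNReal.toReal_ofReal h0, ← ENNReal.toReal_rpow, ← Lp.norm_def]

lemma tendsto_lpHess (f : Lp H (ENNReal.ofReal q) μ) :
    Tendsto (fun g => ‖lpHess g - lpHess f‖) (𝓝 f) (𝓝 0) := by
  refine tendsto_of_seq_tendsto fun g hg => ?_
  have h1 : Tendsto (fun k => eLpNorm (⇑(g k) - ⇑f) (ENNReal.ofReal q) μ) atTop (𝓝 0) :=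
    (Lp.tendsto_Lp_iff_tendsto_eLpNorm' g f).1 hg
  have h2 := tendsto_eLpNorm_comp_sub (r := q - 2) (by linarith [hq.out]) (by linarith [hq.out])
    (mul_nonneg (by linarith [hq.out]) (by linarith [hq.out]))
    (continuous_powHess hq.out) (norm_powHess_le hq.out) (fun k => Lp.memLp (g k)) (Lp.memLp f) h1
  have h3 := (ENNReal.tendsto_toReal ENNReal.zero_ne_top).comp h2
  refine h3.congr fun k => ?_
  simp only [Function.comp]
  rw [Lp.norm_def]
  congr 1
  refine eLpNorm_congr_ae ?_
  filter_upwards [Lp.coeFn_sub (lpHess (g k)) (lpHess f), coeFn_lpHess (g k), coeFn_lpHess f]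
    with x h4 h5 h6
  rw [h4, Pi.sub_apply, h5, h6]

/-- The functional `∫ ‖f‖ ^ q` on `L^q`. -/
def lpEnergy (f : Lp H (ENNReal.ofReal q) μ) : ℝ := ∫ x, ‖f x‖ ^ q ∂μ

/-- Pairing a function with values in the dual with a function. -/
def dualPairing : Lp (H →L[ℝ] ℝ) (ENNReal.ofReal (q / (q - 1))) μ →L[ℝ]
    Lp H (ENNReal.ofReal q) μ →L[ℝ] ℝ :=
  (ContinuousLinearMap.id ℝ (H →L[ℝ] ℝ)).lpPairing μ _ _

/-- Applying a function with values in bilinear forms to a function. -/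
def bilinApply : Lp (H →L[ℝ] H →L[ℝ] ℝ) (ENNReal.ofReal (q / (q - 2))) μ →L[ℝ]
    Lp H (ENNReal.ofReal q) μ →L[ℝ] Lp (H →L[ℝ] ℝ) (ENNReal.ofReal (q / (q - 1))) μ :=
  (ContinuousLinearMap.id ℝ (H →L[ℝ] H →L[ℝ] ℝ)).holderL μ _ _ _

lemma abs_dualPairing_le (f : Lp (H →L[ℝ] ℝ) (ENNReal.ofReal (q / (q - 1))) μ)
    (g : Lp H (ENNReal.ofReal q) μ) : |dualPairing f g| ≤ ‖f‖ * ‖g‖ := by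
  have h1 : dualPairing f g =
      L1.integral ((ContinuousLinearMap.id ℝ (H →L[ℝ] ℝ)).holder 1 f g) := by
    rw [L1.integral_eq]; rfl
  rw [h1]
  refine (L1.norm_integral_le (E := ℝ) _).trans
    ((ContinuousLinearMap.norm_holder_apply_apply_le _ _ _).trans ?_)
  gcongr
  have := ContinuousLinearMap.norm_id_le (𝕜 := ℝ) (E := H →L[ℝ] ℝ)
  calc _ ≤ 1 * ‖f‖ := by gcongr
    _ = ‖f‖ := one_mul _

lemma norm_bilinApply_le (f : Lp (H →L[ℝ] H →L[ℝ] ℝ) (ENNReal.ofReal (q / (q - 2))) μ)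
    (g : Lp H (ENNReal.ofReal q) μ) : ‖bilinApply f g‖ ≤ ‖f‖ * ‖g‖ := by
  refine (ContinuousLinearMap.norm_holder_apply_apply_le _ _ _).trans ?_
  gcongr
  have := ContinuousLinearMap.norm_id_le (𝕜 := ℝ) (E := H →L[ℝ] H →L[ℝ] ℝ)
  calc _ ≤ 1 * ‖f‖ := by gcongr
    _ = ‖f‖ := one_mul _

/-- The first derivative of `lpEnergy`. -/
def lpEnergyDeriv (f : Lp H (ENNReal.ofReal q) μ) : Lp H (ENNReal.ofReal q) μ →L[ℝ] ℝ :=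
  dualPairing (lpGrad f)

/-- The second derivative of `lpEnergy`. -/
def lpEnergyDeriv₂ (f : Lp H (ENNReal.ofReal q) μ) :
    Lp H (ENNReal.ofReal q) μ →L[ℝ] Lp H (ENNReal.ofReal q) μ →L[ℝ] ℝ :=
  dualPairing.comp (bilinApply (lpHess f))

lemma lpEnergyDeriv_apply (f a : Lp H (ENNReal.ofReal q) μ) :
    lpEnergyDeriv f a = ∫ x, powGrad q (f x) (a x) ∂μ := by
  rw [lpEnergyDeriv, dualPairing, ContinuousLinearMap.lpPairing_eq_integral]
  refine integral_congr_ae ?_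
  filter_upwards [coeFn_lpGrad f] with x hx
  simp [hx]

lemma lpEnergyDeriv₂_apply (f a b : Lp H (ENNReal.ofReal q) μ) :
    lpEnergyDeriv₂ f a b = ∫ x, powHess q (f x) (a x) (b x) ∂μ := by
  rw [lpEnergyDeriv₂, ContinuousLinearMap.comp_apply, dualPairing,
    ContinuousLinearMap.lpPairing_eq_integral]
  refine integral_congr_ae ?_
  have h : bilinApply (lpHess f) a =ᵐ[μ] _ :=
    (ContinuousLinearMap.id ℝ (H →L[ℝ] H →L[ℝ] ℝ)).coeFn_holder (lpHess f) a
  filter_upwards [coeFn_lpHess f, h] with x hx hx'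
  simp [hx, hx']

lemma integrable_powGrad (f a : Lp H (ENNReal.ofReal q) μ) :
    Integrable (fun x => powGrad q (f x) (a x)) μ := by
  refine (memLp_one_iff_integrable.1 ((ContinuousLinearMap.id ℝ (H →L[ℝ] ℝ)).memLp_of_bilin 1
    (Lp.memLp (lpGrad f)) (Lp.memLp a))).congr ?_
  filter_upwards [coeFn_lpGrad f] with x hx
  simp [hx]

lemma integrable_powHess (f a b : Lp H (ENNReal.ofReal q) μ) :
    Integrable (fun x => powHess q (f x) (a x) (b x)) μ := by
  refine (memLp_one_iff_integrable.1 ((ContinuousLinearMap.id ℝ (H →L[ℝ] ℝ)).memLp_of_bilin 1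
    (Lp.memLp (bilinApply (lpHess f) a)) (Lp.memLp b))).congr ?_
  have h : bilinApply (lpHess f) a =ᵐ[μ] _ :=
    (ContinuousLinearMap.id ℝ (H →L[ℝ] H →L[ℝ] ℝ)).coeFn_holder (lpHess f) a
  filter_upwards [coeFn_lpHess f, h] with x hx hx'
  simp [hx, hx']

lemma abs_lpEnergyDeriv_le (f a : Lp H (ENNReal.ofReal q) μ) :
    |lpEnergyDeriv f a| ≤ q * ‖f‖ ^ (q - 1) * ‖a‖ := by
  refine (abs_dualPairing_le _ _).trans ?_
  gcongr
  exact norm_lpGrad_le f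

lemma abs_lpEnergyDeriv₂_le (f a b : Lp H (ENNReal.ofReal q) μ) :
    |lpEnergyDeriv₂ f a b| ≤ q * (q - 1) * ‖f‖ ^ (q - 2) * ‖a‖ * ‖b‖ := by
  refine (abs_dualPairing_le _ _).trans ?_
  gcongr
  refine (norm_bilinApply_le _ _).trans ?_
  gcongr
  exact norm_lpHess_le f

/-- The second derivative is a linear image of `lpHess` under a map of norm at most one, so its
continuity is that of the superposition operator. -/
lemma tendsto_lpEnergyDeriv₂ (f : Lp H (ENNReal.ofReal q) μ) :
    Tendsto (fun g => ‖lpEnergyDeriv₂ g - lpEnergyDeriv₂ f‖) (𝓝 f) (𝓝 0) := by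
  refine squeeze_zero (fun _ => norm_nonneg _) (fun g => ?_) (tendsto_lpHess f)
  refine ContinuousLinearMap.opNorm_le_bound₂ _ (norm_nonneg _) fun a b => ?_
  have : (lpEnergyDeriv₂ g - lpEnergyDeriv₂ f) a b =
      dualPairing (bilinApply (lpHess g - lpHess f) a) b := by
    simp [lpEnergyDeriv₂]
  rw [this]
  refine (abs_dualPairing_le _ _).trans ?_
  gcongr
  exact norm_bilinApply_le _ _

omit [InnerProductSpace ℝ H] in
lemma integrable_norm_add_rpow {f g : Q → H} (hf : MemLp f (ENNReal.ofReal q) μ)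
    (hg : MemLp g (ENNReal.ofReal q) μ) : Integrable (fun x => (‖f x‖ + ‖g x‖) ^ q) μ := by
  have h0 : 0 < q := by linarith [hq.out]
  have h := (hf.norm.add hg.norm).integrable_norm_rpow (by simpa using h0) ENNReal.ofReal_ne_top
  refine h.congr (.of_forall fun x => ?_)
  simp only [Pi.add_apply, ENNReal.toReal_ofReal h0.le]
  rw [Real.norm_of_nonneg (by positivity)]

omit [InnerProductSpace ℝ H] in
lemma integrable_norm_rpow_Lp (f : Lp H (ENNReal.ofReal q) μ) :
    Integrable (fun x => ‖f x‖ ^ q) μ := by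
  have h0 : 0 < q := by linarith [hq.out]
  have h := (Lp.memLp f).integrable_norm_rpow (by simpa using h0) ENNReal.ofReal_ne_top
  simpa only [ENNReal.toReal_ofReal h0.le] using h

omit hq in
lemma coeFn_add_smul (f h : Lp H (ENNReal.ofReal q) μ) (t : ℝ) :
    ⇑(f + t • h) =ᵐ[μ] fun x => f x + t • h x := by
  filter_upwards [Lp.coeFn_add f (t • h), Lp.coeFn_smul t h] with x h1 h2
  rw [h1, Pi.add_apply, h2, Pi.smul_apply]

/-- Differentiation under the integral sign: for `|t| < 1` the derivative of the integrand is
dominated by a multiple of `(‖f‖ + ‖h‖) ^ q`. -/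
lemma hasDerivAt_lpEnergy_line (f h : Lp H (ENNReal.ofReal q) μ) :
    HasDerivAt (fun t : ℝ => lpEnergy (f + t • h)) (lpEnergyDeriv f h) 0 := by
  have h0 : 0 < q := by linarith [hq.out]
  have e1 : ∀ t : ℝ, lpEnergy (f + t • h) = ∫ x, ‖f x + t • h x‖ ^ q ∂μ := fun t =>
    integral_congr_ae ((coeFn_add_smul f h t).mono fun x hx => by simp only [hx])
  have e2 : lpEnergyDeriv f h = ∫ x, powGrad q (f x + (0 : ℝ) • h x) (h x) ∂μ := by
    simp only [zero_smul, add_zero, lpEnergyDeriv_apply]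
  simp only [e1, e2]
  refine (hasDerivAt_integral_of_dominated_loc_of_deriv_le (s := Metric.ball (0 : ℝ) 1)
    (F := fun t x => ‖f x + t • h x‖ ^ q)
    (bound := fun x => q * (‖f x‖ + ‖h x‖) ^ q) (Metric.ball_mem_nhds _ one_pos)
    (.of_forall fun t => ?_) ?_ ?_ (.of_forall fun x t ht => ?_) ?_
    (.of_forall fun x t _ => hasDerivAt_norm_rpow_line hq.out _ _ _)).2
  · exact ((integrable_norm_rpow_Lp (f + t • h)).congr
      ((coeFn_add_smul f h t).mono fun x hx => by simp only [hx])).1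
  · simpa using integrable_norm_rpow_Lp f
  · simpa using (integrable_powGrad f h).1
  · have ht' : |t| ≤ 1 := by simpa using (mem_ball_zero_iff.1 ht).le
    have h1 : ‖f x + t • h x‖ ≤ ‖f x‖ + ‖h x‖ := by
      refine (norm_add_le _ _).trans ?_
      rw [norm_smul]
      gcongr
      exact mul_le_of_le_one_left (norm_nonneg _) ht'
    calc ‖powGrad q (f x + t • h x) (h x)‖
        ≤ ‖powGrad q (f x + t • h x)‖ * ‖h x‖ := ContinuousLinearMap.le_opNorm _ _
      _ ≤ q * ‖f x + t • h x‖ ^ (q - 1) * ‖h x‖ := by gcongr; exact norm_powGrad_le hq.out _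
      _ ≤ q * (‖f x‖ + ‖h x‖) ^ (q - 1) * (‖f x‖ + ‖h x‖) := by
        gcongr
        · linarith [hq.out]
        · linarith [norm_nonneg (f x)]
      _ = q * (‖f x‖ + ‖h x‖) ^ q := by
        rw [mul_assoc, ← Real.rpow_add_one' (by positivity) (by linarith)]
        ring_nf
  · exact (integrable_norm_add_rpow (Lp.memLp f) (Lp.memLp h)).const_mul q

lemma hasDerivAt_lpEnergyDeriv_line (f h a : Lp H (ENNReal.ofReal q) μ) :
    HasDerivAt (fun t : ℝ => lpEnergyDeriv (f + t • h) a) (lpEnergyDeriv₂ f h a) 0 := by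
  have h0 : 0 < q := by linarith [hq.out]
  have e1 : ∀ t : ℝ, lpEnergyDeriv (f + t • h) a =
      ∫ x, powGrad q (f x + t • h x) (a x) ∂μ := fun t => by
    rw [lpEnergyDeriv_apply]
    exact integral_congr_ae ((coeFn_add_smul f h t).mono fun x hx => by simp only [hx])
  have e2 : lpEnergyDeriv₂ f h a =
      ∫ x, powHess q (f x + (0 : ℝ) • h x) (h x) (a x) ∂μ := by
    simp only [zero_smul, add_zero, lpEnergyDeriv₂_apply]
  simp only [e1, e2]
  refine (hasDerivAt_integral_of_dominated_loc_of_deriv_le (s := Metric.ball (0 : ℝ) 1)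
    (F := fun t x => powGrad q (f x + t • h x) (a x))
    -- The nested norms put the majorant into the form of `integrable_norm_add_rpow` for the scalar
    -- functions `‖f‖ + ‖h‖` and `‖a‖`.
    (bound := fun x => q * (q - 1) * (‖‖f x‖ + ‖h x‖‖ + ‖‖a x‖‖) ^ q)
    (Metric.ball_mem_nhds _ one_pos)
    (.of_forall fun t => ?_) ?_ ?_ (.of_forall fun x t ht => ?_) ?_
    (.of_forall fun x t _ => hasDerivAt_powGrad_line hq.out _ _ _ _)).2
  · exact ((integrable_powGrad (f + t • h) a).congr
      ((coeFn_add_smul f h t).mono fun x hx => by simp only [hx])).1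
  · simpa using integrable_powGrad f a
  · simpa using (integrable_powHess f h a).1
  · have ht' : |t| ≤ 1 := by simpa using (mem_ball_zero_iff.1 ht).le
    have h1 : ‖f x + t • h x‖ ≤ ‖f x‖ + ‖h x‖ := by
      refine (norm_add_le _ _).trans ?_
      rw [norm_smul]
      gcongr
      exact mul_le_of_le_one_left (norm_nonneg _) ht'
    have hq1 : 0 ≤ q * (q - 1) := mul_nonneg h0.le (by linarith [hq.out])
    rw [norm_norm, Real.norm_of_nonneg (show 0 ≤ ‖f x‖ + ‖h x‖ by positivity)]
    set m := ‖f x‖ + ‖h x‖ + ‖a x‖ with hm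
    have hm0 : 0 ≤ m := by positivity
    calc ‖powHess q (f x + t • h x) (h x) (a x)‖
        ≤ ‖powHess q (f x + t • h x)‖ * ‖h x‖ * ‖a x‖ := ContinuousLinearMap.le_opNorm₂ _ _ _
      _ ≤ q * (q - 1) * ‖f x + t • h x‖ ^ (q - 2) * ‖h x‖ * ‖a x‖ := by
        gcongr; exact norm_powHess_le hq.out _
      _ ≤ q * (q - 1) * m ^ (q - 2) * m * m := by
        gcongr
        · linarith [hq.out]
        · linarith [norm_nonneg (a x)]
        · linarith [norm_nonneg (f x), norm_nonneg (a x)]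
        · linarith [norm_nonneg (f x), norm_nonneg (h x)]
      _ = q * (q - 1) * m ^ q := by
        rw [mul_assoc, mul_assoc, ← mul_assoc (m ^ (q - 2)),
          ← Real.rpow_add_one' hm0 (by linarith [hq.out]),
          ← Real.rpow_add_one' hm0 (by linarith [hq.out])]
        ring_nf
  · exact (integrable_norm_add_rpow ((Lp.memLp f).norm.add (Lp.memLp h).norm)
      (Lp.memLp a).norm).const_mul _

end LpEnergy

/-! ### Fréchet differentiability of the energy on `Lp` -/

section LpEnergySmooth

variable {Q : Type*} [MeasurableSpace Q] {μ : Measure Q}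
  {H : Type*} [NormedAddCommGroup H] [InnerProductSpace ℝ H] {q : ℝ} [hq : Fact (2 < q)]

/-- The derivative is treated before the energy itself: its differentiability supplies the
continuity that `hasFDerivAt_lpEnergy` requires. -/
lemma hasFDerivAt_lpEnergyDeriv (f : Lp H (ENNReal.ofReal q) μ) :
    HasFDerivAt lpEnergyDeriv (lpEnergyDeriv₂ f) f := by
  have h := hasFDerivAt_of_weak_lineDeriv (X := Lp H (ENNReal.ofReal q) μ)
    (Y := Lp H (ENNReal.ofReal q) μ) (F := ℝ) (f := lpEnergyDeriv) (f' := lpEnergyDeriv₂)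
    hasDerivAt_lpEnergyDeriv_line tendsto_lpEnergyDeriv₂ f
  exact h

lemma tendsto_lpEnergyDeriv (f : Lp H (ENNReal.ofReal q) μ) :
    Tendsto (fun g => ‖lpEnergyDeriv g - lpEnergyDeriv f‖) (𝓝 f) (𝓝 0) := by
  have h : ContinuousAt lpEnergyDeriv f := (hasFDerivAt_lpEnergyDeriv f).continuousAt
  exact tendsto_iff_norm_sub_tendsto_zero.1 h

lemma hasFDerivAt_lpEnergy (f : Lp H (ENNReal.ofReal q) μ) :
    HasFDerivAt lpEnergy (lpEnergyDeriv f) f := by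
  have h := hasFDerivAt_of_lineDeriv (X := Lp H (ENNReal.ofReal q) μ) (F := ℝ)
    (f := lpEnergy) (f' := lpEnergyDeriv) hasDerivAt_lpEnergy_line tendsto_lpEnergyDeriv f
  exact h

lemma continuous_lpEnergyDeriv₂ :
    Continuous (lpEnergyDeriv₂ : Lp H (ENNReal.ofReal q) μ → _) := by
  rw [continuous_iff_continuousAt]
  intro f
  exact tendsto_iff_norm_sub_tendsto_zero.2 (tendsto_lpEnergyDeriv₂ f)

lemma contDiff_lpEnergy :
    ContDiff ℝ 2 (lpEnergy : Lp H (ENNReal.ofReal q) μ → ℝ) := by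
  have h1 : ContDiff ℝ 1 (lpEnergyDeriv : Lp H (ENNReal.ofReal q) μ → _) :=
    contDiff_one_iff_hasFDerivAt.2
      ⟨lpEnergyDeriv₂, continuous_lpEnergyDeriv₂, hasFDerivAt_lpEnergyDeriv⟩
  have h2 := (contDiff_succ_iff_hasFDerivAt (𝕜 := ℝ) (n := 1)
    (f := (lpEnergy : Lp H (ENNReal.ofReal q) μ → ℝ))).2 ⟨lpEnergyDeriv, h1, hasFDerivAt_lpEnergy⟩
  exact h2

end LpEnergySmooth

/-! ### The continuous representative of the velocity -/

section Morrey

variable {n : ℕ} {q : ℝ} [hq : Fact (2 < q)]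

lemma periodic_coe {E : Type*} (f : Circ → E) : Function.Periodic (fun t : ℝ => f (t : Circ)) 1 :=
  fun t => by simp only [AddCircle.coe_add_period]

lemma intervalIntegrable_vel (u : CurveSpace n q) (a b : ℝ) :
    IntervalIntegrable (fun t : ℝ => u.vel (t : Circ)) volume a b := by
  refine (periodic_coe u.vel).intervalIntegrable one_ne_zero (t := 0) ?_ a b
  rw [zero_add]
  exact intervalIntegrable_coe u.vel ⟨zero_le_one, le_rfl⟩

lemma curve_eq_add_integral (u : CurveSpace n q) {t : ℝ} (ht : t ∈ Icc (0 : ℝ) 1) :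
    u.curve (t : Circ) = u.curve ((0 : ℝ) : Circ) + ∫ r in (0 : ℝ)..t, u.vel (r : Circ) :=
  u.2.1 t ht

/-- The fundamental theorem of calculus for all real parameters. -/
lemma curve_sub_eq_integral (u : CurveSpace n q) (s t : ℝ) :
    u.curve (t : Circ) - u.curve (s : Circ) = ∫ r in s..t, u.vel (r : Circ) := by
  have hint := intervalIntegrable_vel u
  -- The difference between the curve and the primitive of its velocity is periodic, because the
  -- velocity of a closed curve has integral zero over a period. Being constant on one period, it is
  -- constant.
  set d : ℝ → Euc n := fun t => u.curve (t : Circ) - ∫ r in (0 : ℝ)..t, u.vel (r : Circ) with hd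
  have h01 : ∫ r in (0 : ℝ)..1, u.vel (r : Circ) = 0 := by
    have h := curve_eq_add_integral u (t := 1) ⟨zero_le_one, le_rfl⟩
    have h1 : ((1 : ℝ) : Circ) = ((0 : ℝ) : Circ) := by
      simp
    rw [h1] at h
    simpa using h
  have hper : Function.Periodic d 1 := by
    intro t
    simp only [hd, AddCircle.coe_add_period]
    rw [← intervalIntegral.integral_add_adjacent_intervals (hint 0 t) (hint t (t + 1)),
      (periodic_coe u.vel).intervalIntegral_add_eq t 0, zero_add, h01, add_zero]
  have hconst : ∀ t, d t = u.curve ((0 : ℝ) : Circ) := by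
    intro t
    obtain ⟨y, hy, hty⟩ := hper.exists_mem_Ico₀ zero_lt_one t
    rw [hty]
    simp only [hd]
    rw [curve_eq_add_integral u ⟨hy.1, hy.2.le⟩, add_sub_cancel_right]
  have h1 : d t = d s := by rw [hconst, hconst]
  simp only [hd] at h1
  rw [← intervalIntegral.integral_interval_sub_left (hint 0 t) (hint 0 s)]
  rw [sub_eq_sub_iff_add_eq_add] at h1 ⊢
  rw [add_comm (∫ r in (0 : ℝ)..t, u.vel (r : Circ))]
  exact h1

/-- The product of two copies of an interval of length one is the torus. -/
lemma measurePreserving_mk_prod (x : ℝ) : MeasurePreserving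
    (fun p : ℝ × ℝ => ((p.1 : Circ), (p.2 : Circ)))
    ((volume.restrict (Ioc x (x + 1))).prod (volume.restrict (Ioc x (x + 1))))
    (volume : Measure (Circ × Circ)) :=
  (UnitAddCircle.measurePreserving_mk x).prod (UnitAddCircle.measurePreserving_mk x)

lemma norm_coe_le_abs (t : ℝ) : ‖(t : Circ)‖ ≤ |t| := by
  rw [UnitAddCircle.norm_eq]
  simpa using round_le t 0

/-- For `s = 1 - 1/q` the kernel exponent `1 + s q` is exactly `q`. On a window of length `r` one
has `|x - y| ≤ r`, so inserting the kernel costs the factor `r ^ q`; where the kernel is singular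
the difference of `f` is zero. -/
lemma lintegral_difference_le (f : Circ → Euc n) (hf : Measurable f) (x : ℝ) {r : ℝ}
    (hr1 : r ≤ 1) {I J : Set ℝ} (hI : I ⊆ Ioc x (x + r)) (hJ : J ⊆ Ioc x (x + r)) :
    ∫⁻ p, ‖f (p.1 : ℝ) - f (p.2 : ℝ)‖ₑ ^ q ∂((volume.restrict I).prod (volume.restrict J)) ≤
      ENNReal.ofReal r ^ q * slobodeckij (1 - 1 / q) q f ^ q := by
  have h0 : 0 < q := by linarith [hq.out]
  have hexp : 1 + (1 - 1 / q) * q = q := by field_simp; ring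
  have hsl : slobodeckij (1 - 1 / q) q f ^ q =
      ∫⁻ p : Circ × Circ, ‖f p.1 - f p.2‖ₑ ^ q / ‖p.1 - p.2‖ₑ ^ q := by
    rw [slobodeckij, ← ENNReal.rpow_mul, one_div_mul_cancel h0.ne', ENNReal.rpow_one, hexp]
  have hmeas : Measurable fun p : Circ × Circ => ‖f p.1 - f p.2‖ₑ ^ q / ‖p.1 - p.2‖ₑ ^ q := by
    have h1 : Measurable fun p : Circ × Circ => f p.1 - f p.2 :=
      (hf.comp measurable_fst).sub (hf.comp measurable_snd)
    have h2 : Continuous (fun p : Circ × Circ => p.1 - p.2) := by fun_prop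
    exact (h1.enorm.pow_const _).div (h2.enorm.measurable.pow_const _)
  have hIx : I ⊆ Ioc x (x + 1) := hI.trans (Ioc_subset_Ioc_right (by linarith))
  have hJx : J ⊆ Ioc x (x + 1) := hJ.trans (Ioc_subset_Ioc_right (by linarith))
  have hmono : (volume.restrict I).prod (volume.restrict J) ≤
      (volume.restrict (Ioc x (x + 1))).prod (volume.restrict (Ioc x (x + 1))) := by
    rw [Measure.prod_restrict, Measure.prod_restrict]
    exact Measure.restrict_mono (prod_mono hIx hJx) le_rfl
  have hmem : ∀ᵐ p ∂((volume.restrict I).prod (volume.restrict J)),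
      p ∈ Ioc x (x + r) ×ˢ Ioc x (x + r) := by
    rw [Measure.prod_restrict]
    have h1 : ((volume : Measure ℝ).prod volume).restrict (I ×ˢ J) ≤
        ((volume : Measure ℝ).prod volume).restrict (Ioc x (x + r) ×ˢ Ioc x (x + r)) :=
      Measure.restrict_mono (prod_mono hI hJ) le_rfl
    exact ae_mono h1 (ae_restrict_mem (measurableSet_Ioc.prod measurableSet_Ioc))
  calc ∫⁻ p, ‖f (p.1 : ℝ) - f (p.2 : ℝ)‖ₑ ^ q ∂((volume.restrict I).prod (volume.restrict J))
      ≤ ∫⁻ p, ENNReal.ofReal r ^ q * (‖f (p.1 : ℝ) - f (p.2 : ℝ)‖ₑ ^ q /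
          ‖((p.1 : ℝ) : Circ) - ((p.2 : ℝ) : Circ)‖ₑ ^ q)
          ∂((volume.restrict I).prod (volume.restrict J)) := by
        refine lintegral_mono_ae (hmem.mono fun p hp => ?_)
        by_cases hz : ((p.1 : ℝ) : Circ) - ((p.2 : ℝ) : Circ) = 0
        · rw [sub_eq_zero] at hz
          simp [hz, h0]
        · have hz1 : ‖((p.1 : ℝ) : Circ) - ((p.2 : ℝ) : Circ)‖ₑ ≤ ENNReal.ofReal r := by
            rw [← ofReal_norm]
            apply ENNReal.ofReal_le_ofReal
            rw [← AddCircle.coe_sub]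
            refine (norm_coe_le_abs _).trans (abs_le.2 ⟨?_, ?_⟩)
            · linarith [hp.1.1, hp.2.2]
            · linarith [hp.1.2, hp.2.1]
          have hz2 : ‖((p.1 : ℝ) : Circ) - ((p.2 : ℝ) : Circ)‖ₑ ^ q ≠ 0 := by
            rw [Ne, ENNReal.rpow_eq_zero_iff_of_pos h0, enorm_eq_zero]
            exact hz
          have hz3 : ‖((p.1 : ℝ) : Circ) - ((p.2 : ℝ) : Circ)‖ₑ ^ q ≠ ∞ :=
            ENNReal.rpow_ne_top_of_nonneg h0.le enorm_ne_top
          calc _ = ‖((p.1 : ℝ) : Circ) - ((p.2 : ℝ) : Circ)‖ₑ ^ q *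
                (‖f (p.1 : ℝ) - f (p.2 : ℝ)‖ₑ ^ q /
                  ‖((p.1 : ℝ) : Circ) - ((p.2 : ℝ) : Circ)‖ₑ ^ q) :=
                (ENNReal.mul_div_cancel hz2 hz3).symm
            _ ≤ _ := by gcongr
    _ = ENNReal.ofReal r ^ q * ∫⁻ p, (‖f (p.1 : ℝ) - f (p.2 : ℝ)‖ₑ ^ q /
          ‖((p.1 : ℝ) : Circ) - ((p.2 : ℝ) : Circ)‖ₑ ^ q)
          ∂((volume.restrict I).prod (volume.restrict J)) :=
        lintegral_const_mul' _ _ (ENNReal.rpow_ne_top_of_nonneg h0.le ENNReal.ofReal_ne_top)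
    _ ≤ ENNReal.ofReal r ^ q * ∫⁻ p, (‖f (p.1 : ℝ) - f (p.2 : ℝ)‖ₑ ^ q /
          ‖((p.1 : ℝ) : Circ) - ((p.2 : ℝ) : Circ)‖ₑ ^ q)
          ∂((volume.restrict (Ioc x (x + 1))).prod (volume.restrict (Ioc x (x + 1)))) := by
        gcongr
    _ = _ := by
        rw [hsl, ← (measurePreserving_mk_prod x).lintegral_comp hmeas]

/-- The difference of the averages of `u'` over `[x, x + r]` and over `[x, x + r / 2]`. -/
lemma norm_average_sub_le (u : CurveSpace n q) (x : ℝ) {r : ℝ} (hr : 0 < r) (hr1 : r ≤ 1) :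
    ‖r⁻¹ • (u.curve ((x + r : ℝ) : Circ) - u.curve (x : Circ)) -
      (r / 2)⁻¹ • (u.curve ((x + r / 2 : ℝ) : Circ) - u.curve (x : Circ))‖ ≤
      2 * (slobodeckij (1 - 1 / q) q u.vel).toReal * r ^ (1 - 2 / q) := by
  have h0 : 0 < q := by linarith [hq.out]
  set f : Circ → Euc n := ⇑u.vel with hf
  have hfm : Measurable f := (Lp.stronglyMeasurable u.vel).measurable
  set K := slobodeckij (1 - 1 / q) q f with hK
  have hKtop : K ≠ ∞ := slobodeckij_vel_ne_top u
  set I := Ioc x (x + r)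
  set J := Ioc x (x + r / 2)
  set ν := ((volume : Measure ℝ).restrict I).prod (volume.restrict J) with hν
  set F : ℝ × ℝ → Euc n := fun p => f (p.1 : ℝ) - f (p.2 : ℝ) with hF
  have hFm : AEStronglyMeasurable F ν :=
    ((hfm.comp ((AddCircle.measurable_mk').comp measurable_fst)).sub
      (hfm.comp ((AddCircle.measurable_mk').comp measurable_snd))).aestronglyMeasurable
  have hIint : IntegrableOn (fun t : ℝ => f (t : Circ)) I := by
    rw [← intervalIntegrable_iff_integrableOn_Ioc_of_le (by linarith)]
    exact intervalIntegrable_vel u _ _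
  have hJint : IntegrableOn (fun t : ℝ => f (t : Circ)) J := by
    rw [← intervalIntegrable_iff_integrableOn_Ioc_of_le (by linarith)]
    exact intervalIntegrable_vel u _ _
  -- The difference of the two averages is the mean of `f(s) - f(t)` over `I × J`, a rectangle of
  -- area `r² / 2`.
  have hA : ∫ p, F p ∂ν = (r ^ 2 / 2) •
      (r⁻¹ • (u.curve ((x + r : ℝ) : Circ) - u.curve (x : Circ)) -
        (r / 2)⁻¹ • (u.curve ((x + r / 2 : ℝ) : Circ) - u.curve (x : Circ))) := by
    simp only [hF]
    rw [integral_sub (hIint.comp_fst _) (hJint.comp_snd _), integral_fun_fst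
      (f := fun t : ℝ => f (t : Circ)), integral_fun_snd (f := fun t : ℝ => f (t : Circ)),
      curve_sub_eq_integral, curve_sub_eq_integral,
      intervalIntegral.integral_of_le (by linarith), intervalIntegral.integral_of_le (by linarith)]
    simp only [I, J, measureReal_restrict_apply_univ, Real.volume_real_Ioc, add_sub_cancel_left]
    rw [max_eq_left (by linarith), max_eq_left (by linarith), smul_sub, smul_smul, smul_smul]
    congr 2
    · field_simp
    · field_simp
  have hνuniv : ν univ = ENNReal.ofReal (r ^ 2 / 2) := by
    rw [hν, Measure.prod_restrict, Measure.restrict_apply_univ, Measure.prod_prod,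
      Real.volume_Ioc, Real.volume_Ioc, ← ENNReal.ofReal_mul (by linarith)]
    congr 1
    ring
  -- Hölder's inequality on the finite measure `ν` passes from `L^1` to `L^q`, where the seminorm
  -- controls `F`.
  have hB : ‖∫ p, F p ∂ν‖ₑ ≤ ENNReal.ofReal r * K *
      ENNReal.ofReal (r ^ 2 / 2) ^ (1 - 1 / q) := by
    calc ‖∫ p, F p ∂ν‖ₑ ≤ ∫⁻ p, ‖F p‖ₑ ∂ν := enorm_integral_le_lintegral_enorm _
      _ = eLpNorm F 1 ν := eLpNorm_one_eq_lintegral_enorm.symm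
      _ ≤ eLpNorm F (ENNReal.ofReal q) ν *
          ν univ ^ (1 / (1 : ℝ≥0∞).toReal - 1 / (ENNReal.ofReal q).toReal) :=
        eLpNorm_le_eLpNorm_mul_rpow_measure_univ Fact.out hFm
      _ ≤ _ := by
        rw [hνuniv, ENNReal.toReal_ofReal h0.le, ENNReal.toReal_one, div_one]
        gcongr
        rw [eLpNorm_eq_lintegral_rpow_enorm_toReal (by simpa using h0) ENNReal.ofReal_ne_top,
          ENNReal.toReal_ofReal h0.le]
        calc _ ≤ (ENNReal.ofReal r ^ q * K ^ q) ^ (1 / q) := by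
              gcongr
              exact lintegral_difference_le f hfm x hr1 Subset.rfl
                (Ioc_subset_Ioc_right (by linarith))
          _ = _ := by
              rw [← ENNReal.mul_rpow_of_nonneg _ _ h0.le, ← ENNReal.rpow_mul,
                mul_one_div_cancel h0.ne', ENNReal.rpow_one]
  have hB' := ENNReal.toReal_mono (by finiteness) hB
  rw [toReal_enorm, ENNReal.toReal_mul, ENNReal.toReal_mul, ENNReal.toReal_ofReal hr.le,
    ← ENNReal.toReal_rpow, ENNReal.toReal_ofReal (by positivity), hA, norm_smul,
    Real.norm_of_nonneg (by positivity)] at hB'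
  have hc : 0 < r ^ 2 / 2 := by positivity
  -- The powers of `r` combine to `1 + 2 (1 - 1/q) - 2 = 1 - 2/q`, which is positive exactly because
  -- `q > 2`. The constant `2` absorbs `2 ^ (1/q)`.
  have hexp : (r ^ 2 / 2) * (2 * K.toReal * r ^ (1 - 2 / q)) ≥
      r * K.toReal * (r ^ 2 / 2) ^ (1 - 1 / q) := by
    have e1 : (r ^ 2 / 2) ^ (1 - 1 / q) = (r ^ 2 / 2) * ((1 / 2) ^ (-(1 / q)) * r ^ (-(2 / q))) := by
      rw [sub_eq_add_neg, Real.rpow_add hc, Real.rpow_one]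
      congr 1
      rw [show r ^ 2 / 2 = 1 / 2 * r ^ 2 by ring, Real.mul_rpow (by norm_num) (by positivity),
        ← Real.rpow_natCast_mul hr.le]
      congr 2
      push_cast
      ring
    have e2 : r ^ (1 - 2 / q) = r * r ^ (-(2 / q)) := by
      rw [sub_eq_add_neg, Real.rpow_add hr, Real.rpow_one]
    have e3 : ((1 : ℝ) / 2) ^ (-(1 / q)) ≤ 2 := by
      rw [one_div, Real.inv_rpow (by norm_num), ← Real.rpow_neg (by norm_num), neg_neg]
      calc (2 : ℝ) ^ (1 / q) ≤ 2 ^ (1 : ℝ) := by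
            apply Real.rpow_le_rpow_of_exponent_le (by norm_num)
            rw [div_le_one h0]
            linarith [hq.out]
        _ = 2 := by norm_num
    rw [e1, e2]
    have : 0 ≤ r * K.toReal * (r ^ 2 / 2) * r ^ (-(2 / q)) := by positivity
    nlinarith
  exact le_of_mul_le_mul_left (hB'.trans hexp) hc

end Morrey

/-! ### Morrey's embedding and the continuous velocity -/

section ContinuousVelocity

variable {n : ℕ} {q : ℝ} [hq : Fact (2 < q)]

/-- The difference quotient of `u` with step `2⁻ᵏ`. -/
def dyadicQuotient (u : CurveSpace n q) (k : ℕ) : C(Circ, Euc n) :=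
  ((1 / 2 : ℝ) ^ k)⁻¹ • ((u.curve.comp ⟨fun z => z + (((1 / 2 : ℝ) ^ k : ℝ) : Circ), by fun_prop⟩) -
    u.curve)

lemma dyadicQuotient_coe (u : CurveSpace n q) (k : ℕ) (t : ℝ) :
    dyadicQuotient u k (t : Circ) = ((1 / 2 : ℝ) ^ k)⁻¹ •
      (u.curve ((t + (1 / 2) ^ k : ℝ) : Circ) - u.curve (t : Circ)) := by
  simp [dyadicQuotient]

/-- The step of index `0` is a full period. The telescoping series therefore starts at zero, so the
seminorm alone bounds the sup norm of the velocity. -/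
lemma dyadicQuotient_zero (u : CurveSpace n q) : dyadicQuotient u 0 = 0 := by
  ext1 z
  obtain ⟨t, rfl⟩ := QuotientAddGroup.mk_surjective z
  change dyadicQuotient u 0 (t : Circ) = 0
  rw [dyadicQuotient_coe]
  simp

/-- The ratio of the geometric series in Morrey's estimate. -/
def morreyRatio (q : ℝ) : ℝ := (1 / 2) ^ (1 - 2 / q)

lemma morreyRatio_lt_one {q : ℝ} (hq : 2 < q) : morreyRatio q < 1 := by
  apply Real.rpow_lt_one (by norm_num) (by norm_num)
  rw [sub_pos, div_lt_one (by linarith)]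
  exact hq

/-- The constant in Morrey's estimate. -/
def morreyConst (q : ℝ) : ℝ := 2 / (1 - morreyRatio q)

lemma morreyConst_pos {q : ℝ} (hq : 2 < q) : 0 < morreyConst q :=
  div_pos two_pos (sub_pos.2 (morreyRatio_lt_one hq))

lemma dist_dyadicQuotient_le (u : CurveSpace n q) (k : ℕ) :
    dist (dyadicQuotient u k) (dyadicQuotient u (k + 1)) ≤
      2 * (slobodeckij (1 - 1 / q) q u.vel).toReal * morreyRatio q ^ k := by
  have hm : 0 ≤ morreyRatio q := Real.rpow_nonneg (by norm_num) _
  rw [ContinuousMap.dist_le (by positivity)]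
  intro z
  obtain ⟨t, rfl⟩ := QuotientAddGroup.mk_surjective z
  change dist (dyadicQuotient u k (t : Circ)) (dyadicQuotient u (k + 1) (t : Circ)) ≤ _
  rw [dist_eq_norm, dyadicQuotient_coe, dyadicQuotient_coe]
  have h := norm_average_sub_le u t (r := (1 / 2) ^ k) (by positivity)
    (pow_le_one₀ (by norm_num) (by norm_num))
  rw [show ((1 : ℝ) / 2) ^ k / 2 = (1 / 2) ^ (k + 1) by rw [pow_succ]; ring] at h
  refine h.trans_eq ?_
  rw [morreyRatio, ← Real.rpow_natCast, ← Real.rpow_natCast, ← Real.rpow_mul (by norm_num),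
    ← Real.rpow_mul (by norm_num), mul_comm (k : ℝ)]

lemma ae_coe_of_ae_real {p : Circ → Prop} (hp : MeasurableSet {z | p z})
    (h : ∀ᵐ t : ℝ, p (t : Circ)) : ∀ᵐ z : Circ, p z := by
  have hmp := UnitAddCircle.measurePreserving_mk 0
  rw [← hmp.map_eq]
  exact (ae_map_iff hmp.measurable.aemeasurable hp).2 (ae_restrict_of_ae h)

lemma locallyIntegrable_vel (u : CurveSpace n q) :
    LocallyIntegrable (fun t : ℝ => u.vel (t : Circ)) := fun x =>
  ⟨Ioc (x - 1) (x + 1), Ioc_mem_nhds (by linarith) (by linarith),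
    (intervalIntegrable_iff_integrableOn_Ioc_of_le (by linarith)).1 (intervalIntegrable_vel u _ _)⟩

/-- Morrey's embedding: the velocity has a continuous representative, which is bounded by the
Sobolev–Slobodeckij seminorm (the mean value of the velocity of a closed curve is zero). -/
lemma exists_continuous_vel (u : CurveSpace n q) : ∃ g : C(Circ, Euc n),
    (∀ᵐ t : ℝ, g (t : Circ) = u.vel (t : Circ)) ∧
    ‖g‖ ≤ morreyConst q * (slobodeckij (1 - 1 / q) q u.vel).toReal := by
  have hlt := morreyRatio_lt_one hq.out
  have hcauchy := cauchySeq_of_le_geometric _ _ hlt (dist_dyadicQuotient_le u)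
  obtain ⟨g, hg⟩ := cauchySeq_tendsto_of_complete hcauchy
  refine ⟨g, ?_, ?_⟩
  -- Lebesgue's differentiation theorem identifies the uniform limit of the difference quotients
  -- with the velocity almost everywhere.
  · filter_upwards [LocallyIntegrable.ae_hasDerivAt_integral (locallyIntegrable_vel u)] with t ht
    have h1 := (ht t).tendsto_slope_zero
    have h2 : Tendsto (fun k : ℕ => ((1 : ℝ) / 2) ^ k) atTop (𝓝[≠] 0) :=
      tendsto_nhdsWithin_iff.2 ⟨tendsto_pow_atTop_nhds_zero_of_lt_one (by norm_num) (by norm_num),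
        .of_forall fun k => by simp⟩
    have h3 := h1.comp h2
    have h4 : Tendsto (fun k => dyadicQuotient u k (t : Circ)) atTop (𝓝 (g (t : Circ))) :=
      ((continuous_eval_const (t : Circ)).tendsto g).comp hg
    refine tendsto_nhds_unique h4 (h3.congr fun k => ?_)
    simp only [Function.comp, intervalIntegral.integral_same, sub_zero]
    rw [dyadicQuotient_coe, curve_sub_eq_integral]
  · have h := dist_le_of_le_geometric_of_tendsto₀ _ _ hlt (dist_dyadicQuotient_le u) hg
    rw [dyadicQuotient_zero, dist_zero_left] at h
    refine h.trans_eq ?_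
    rw [morreyConst]
    ring

/-- The continuous representative of the velocity. -/
def cvel (u : CurveSpace n q) : C(Circ, Euc n) := (exists_continuous_vel u).choose

lemma ae_cvel_coe (u : CurveSpace n q) : ∀ᵐ t : ℝ, cvel u (t : Circ) = u.vel (t : Circ) :=
  (exists_continuous_vel u).choose_spec.1

lemma norm_cvel_le_slobodeckij (u : CurveSpace n q) :
    ‖cvel u‖ ≤ morreyConst q * (slobodeckij (1 - 1 / q) q u.vel).toReal :=
  (exists_continuous_vel u).choose_spec.2

lemma cvel_ae_eq (u : CurveSpace n q) : cvel u =ᵐ[volume] u.vel :=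
  ae_coe_of_ae_real (measurableSet_eq_fun (cvel u).continuous.measurable
    (Lp.stronglyMeasurable u.vel).measurable) (ae_cvel_coe u)

lemma eq_cvel {u : CurveSpace n q} {g : C(Circ, Euc n)} (h : g =ᵐ[volume] u.vel) : cvel u = g :=
  ContinuousMap.ext fun x => congrFun ((Continuous.ae_eq_iff_eq volume (cvel u).continuous
    g.continuous).1 ((cvel_ae_eq u).trans h.symm)) x

lemma cvel_add (u v : CurveSpace n q) : cvel (u + v) = cvel u + cvel v := by
  apply eq_cvel
  rw [vel_add]
  filter_upwards [Lp.coeFn_add u.vel v.vel, cvel_ae_eq u, cvel_ae_eq v] with x h1 h2 h3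
  rw [h1, Pi.add_apply, ContinuousMap.add_apply, h2, h3]

lemma cvel_smul (c : ℝ) (u : CurveSpace n q) : cvel (c • u) = c • cvel u := by
  apply eq_cvel
  rw [vel_smul]
  filter_upwards [Lp.coeFn_smul c u.vel, cvel_ae_eq u] with x h1 h2
  rw [h1, Pi.smul_apply, ContinuousMap.smul_apply, h2]

lemma curve_sub_eq_integral_cvel (u : CurveSpace n q) (s t : ℝ) :
    u.curve (t : Circ) - u.curve (s : Circ) = ∫ r in s..t, cvel u (r : Circ) := by
  rw [curve_sub_eq_integral]
  exact intervalIntegral.integral_congr_ae ((ae_cvel_coe u).mono fun t ht _ => ht.symm)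

lemma continuous_cvel_coe (u : CurveSpace n q) : Continuous fun t : ℝ => cvel u (t : Circ) :=
  (cvel u).continuous.comp (AddCircle.continuous_mk' 1)

lemma hasDerivAt_curve (u : CurveSpace n q) (t : ℝ) :
    HasDerivAt (fun r : ℝ => u.curve (r : Circ)) (cvel u (t : Circ)) t := by
  have h1 := intervalIntegral.integral_hasDerivAt_right
    ((continuous_cvel_coe u).intervalIntegrable 0 t)
    (continuous_cvel_coe u).aestronglyMeasurable.stronglyMeasurableAtFilter
    (continuous_cvel_coe u).continuousAt
  refine (h1.const_add (u.curve ((0 : ℝ) : Circ))).congr_of_eventuallyEq (.of_forall fun r => ?_)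
  simp only
  rw [← curve_sub_eq_integral_cvel, add_sub_cancel]

lemma cvel_ne_zero {u : CurveSpace n q} (hu : u ∈ embeddedRegular n q) (x : Circ) :
    cvel u x ≠ 0 := by
  obtain ⟨t, rfl⟩ := QuotientAddGroup.mk_surjective x
  have := hu.2 t
  rwa [(hasDerivAt_curve u t).deriv] at this

lemma slobodeckij_le_wNorm (u : CurveSpace n q) :
    (slobodeckij (1 - 1 / q) q u.vel).toReal ≤ wNorm (1 - 1 / q) q u.vel :=
  le_add_of_nonneg_left ENNReal.toReal_nonneg

lemma wNorm_le_norm (u : CurveSpace n q) : wNorm (1 - 1 / q) q u.vel ≤ ‖u‖ :=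
  le_add_of_nonneg_left ENNReal.toReal_nonneg

lemma norm_cvel_le (u : CurveSpace n q) :
    ‖cvel u‖ ≤ morreyConst q * wNorm (1 - 1 / q) q u.vel :=
  (norm_cvel_le_slobodeckij u).trans
    (mul_le_mul_of_nonneg_left (slobodeckij_le_wNorm u) (morreyConst_pos hq.out).le)

/-- A closed set of full measure is everything, so an essential bound on the continuous
representative holds at every point. This links the `L^∞` norm in the final estimate to the sup norm
used throughout. -/
lemma norm_cvel_eq (u : CurveSpace n q) :
    ‖cvel u‖ = (eLpNorm u.vel ⊤ (volume : Measure Circ)).toReal := by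
  rw [← eLpNorm_congr_ae (cvel_ae_eq u)]
  apply le_antisymm
  · have htop : eLpNorm (cvel u) ⊤ (volume : Measure Circ) ≠ ∞ := (memLp_curve ⊤ (cvel u)).2.ne
    have h1 : ∀ᵐ x : Circ, ‖cvel u x‖ ≤ (eLpNorm (cvel u) ⊤ (volume : Measure Circ)).toReal := by
      have h2 := ae_le_eLpNormEssSup (f := cvel u) (μ := (volume : Measure Circ))
      filter_upwards [h2] with x hx
      rw [← toReal_enorm]
      exact ENNReal.toReal_mono htop (by rwa [eLpNorm_exponent_top])
    rw [ContinuousMap.norm_le _ ENNReal.toReal_nonneg]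
    have hclosed : IsClosed {x : Circ | ‖cvel u x‖ ≤
        (eLpNorm (cvel u) ⊤ (volume : Measure Circ)).toReal} :=
      isClosed_le (cvel u).continuous.norm continuous_const
    have hdense : Dense {x : Circ | ‖cvel u x‖ ≤
        (eLpNorm (cvel u) ⊤ (volume : Measure Circ)).toReal} := Measure.dense_of_ae h1
    intro x
    exact (hclosed.closure_eq ▸ hdense x : x ∈ {x : Circ | _})
  · apply ENNReal.toReal_le_of_le_ofReal (norm_nonneg _)
    refine (eLpNorm_le_of_ae_bound (C := ‖cvel u‖) (.of_forall fun x =>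
      (cvel u).norm_coe_le_norm x)).trans ?_
    simp

end ContinuousVelocity

/-! ### The first order Taylor remainder -/

section Remainder

variable {n : ℕ} {q : ℝ}

/-- Translation invariance gives the coordinates `h = x - y` in `(-1/2, 1/2]` and `y`, in which
`signedDif` is `h` and `|x - y|` is `|h|`. -/
lemma lintegral_torus_eq (G : Circ × Circ → ℝ≥0∞) (hG : Measurable G) :
    ∫⁻ p, G p = ∫⁻ y : Circ, ∫⁻ h in Ioc (-1 / 2 : ℝ) (-1 / 2 + 1), G ((h : Circ) + y, y) := by
  rw [Measure.volume_eq_prod, lintegral_prod_symm' _ hG]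
  refine lintegral_congr fun y => ?_
  rw [UnitAddCircle.lintegral_preimage (-1 / 2) fun z => G (z + y, y)]
  exact (lintegral_add_right_eq_self (fun z => G (z, y)) y).symm

lemma signedDif_coe_add {h : ℝ} (hh : h ∈ Ioc (-1 / 2 : ℝ) (-1 / 2 + 1)) (y : Circ) :
    signedDif ((h : Circ) + y, y) = h := by
  rw [signedDif, add_sub_cancel_right]
  exact AddCircle.equivIoc_coe_of_mem hh

lemma signedDif_mem (p : Circ × Circ) : signedDif p ∈ Ioc (-1 / 2 : ℝ) (-1 / 2 + 1) :=
  (AddCircle.equivIoc (1 : ℝ) (-1 / 2) (p.1 - p.2)).2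

lemma coe_signedDif (p : Circ × Circ) : (signedDif p : Circ) = p.1 - p.2 :=
  AddCircle.coe_equivIoc

lemma norm_coe_of_mem {h : ℝ} (hh : h ∈ Ioc (-1 / 2 : ℝ) (-1 / 2 + 1)) : ‖(h : Circ)‖ = |h| := by
  rw [AddCircle.norm_coe_eq_abs_iff (1 : ℝ) one_ne_zero, abs_one, abs_le]
  constructor <;> linarith [hh.1, hh.2]

lemma abs_signedDif (p : Circ × Circ) : |signedDif p| = ‖p.1 - p.2‖ := by
  rw [← coe_signedDif, norm_coe_of_mem (signedDif_mem p)]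

lemma signedDif_eq_zero_iff (p : Circ × Circ) : signedDif p = 0 ↔ p.1 = p.2 := by
  rw [← abs_eq_zero, abs_signedDif, norm_eq_zero, sub_eq_zero]

lemma measurable_signedDif : Measurable signedDif := by
  have h1 : Measurable fun z : Circ => ((AddCircle.equivIoc (1 : ℝ) (-1 / 2) z : ℝ)) :=
    measurable_subtype_coe.comp (AddCircle.measurableEquivIoc (1 : ℝ) (-1 / 2)).measurable
  have h2 : Continuous (fun p : Circ × Circ => p.1 - p.2) := by fun_prop
  exact h1.comp h2.measurable

/-- Averaging over dilations decreases a weighted integral. -/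
lemma lintegral_dilation_le {q : ℝ} (hq : 1 ≤ q) (ψ : ℝ → ℝ≥0∞) (hψ : Measurable ψ) :
    ∫⁻ h in Ioc (-1 / 2 : ℝ) (-1 / 2 + 1), ((‖h‖ₑ ^ q)⁻¹ * ∫⁻ s in Ioc (0 : ℝ) 1, ψ (h * s)) ≤
      ∫⁻ h in Ioc (-1 / 2 : ℝ) (-1 / 2 + 1), (‖h‖ₑ ^ q)⁻¹ * ψ h := by
  have h0 : 0 < q := by linarith
  set A := Ioc (-1 / 2 : ℝ) (-1 / 2 + 1) with hA
  have hw : Measurable fun h : ℝ => (‖h‖ₑ ^ q)⁻¹ := (measurable_enorm.pow_const _).inv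
  have hinner : ∀ h : ℝ, (‖h‖ₑ ^ q)⁻¹ * ∫⁻ s in Ioc (0 : ℝ) 1, ψ (h * s) =
      ∫⁻ s in Ioc (0 : ℝ) 1, (‖h‖ₑ ^ q)⁻¹ * ψ (h * s) := fun h =>
    (lintegral_const_mul _ (by fun_prop)).symm
  simp only [hinner]
  rw [lintegral_lintegral_swap (by
    apply Measurable.aemeasurable
    exact (hw.comp measurable_fst).mul (hψ.comp (measurable_fst.mul measurable_snd)))]
  have hs : ∀ s ∈ Ioc (0 : ℝ) 1, ∫⁻ h in A, (‖h‖ₑ ^ q)⁻¹ * ψ (h * s) ≤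
      ∫⁻ h in A, (‖h‖ₑ ^ q)⁻¹ * ψ h := by
    intro s hs
    set F : ℝ → ℝ≥0∞ := A.indicator fun h => (‖h‖ₑ ^ q)⁻¹ * ψ h with hF
    have hFm : Measurable F := (hw.mul hψ).indicator measurableSet_Ioc
    -- The interval `A` contains the origin and is stable under multiplication by `s ∈ (0, 1]`; the
    -- weight scales by `s ^ q`.
    have hpt : ∀ h, A.indicator (fun h => (‖h‖ₑ ^ q)⁻¹ * ψ (h * s)) h ≤
        ENNReal.ofReal s ^ q * F (s * h) := by
      intro h
      by_cases hh : h ∈ A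
      · have hsh : s * h ∈ A := by
          constructor
          · nlinarith [hh.1, hh.2, hs.1, hs.2]
          · nlinarith [hh.1, hh.2, hs.1, hs.2]
        rw [indicator_of_mem hh, hF, indicator_of_mem hsh, mul_comm s h, ← mul_assoc]
        gcongr
        have hs1 : ‖s‖ₑ = ENNReal.ofReal s := Real.enorm_of_nonneg hs.1.le
        have hs0 : ENNReal.ofReal s ^ q ≠ 0 := by
          rw [Ne, ENNReal.rpow_eq_zero_iff_of_pos h0]
          simpa using hs.1
        have hst : ENNReal.ofReal s ^ q ≠ ∞ :=
          ENNReal.rpow_ne_top_of_nonneg h0.le ENNReal.ofReal_ne_top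
        rw [enorm_mul, hs1, ENNReal.mul_rpow_of_nonneg _ _ h0.le,
          ENNReal.mul_inv (Or.inr hst) (Or.inr hs0), mul_comm (‖h‖ₑ ^ q)⁻¹, ← mul_assoc,
          ENNReal.mul_inv_cancel hs0 hst, one_mul]
      · rw [indicator_of_notMem hh]
        exact zero_le
    calc ∫⁻ h in A, (‖h‖ₑ ^ q)⁻¹ * ψ (h * s)
        = ∫⁻ h, A.indicator (fun h => (‖h‖ₑ ^ q)⁻¹ * ψ (h * s)) h :=
          (lintegral_indicator measurableSet_Ioc _).symm
      _ ≤ ∫⁻ h, ENNReal.ofReal s ^ q * F (s * h) := lintegral_mono hpt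
      _ = ENNReal.ofReal s ^ q * ∫⁻ h, F (s * h) := lintegral_const_mul _ (by fun_prop)
      _ = ENNReal.ofReal s ^ q * (ENNReal.ofReal |s⁻¹| * ∫⁻ h, F h) := by
          rw [← lintegral_map hFm (measurable_const_mul s), Real.map_volume_mul_left hs.1.ne',
            lintegral_smul_measure, smul_eq_mul]
      _ = (ENNReal.ofReal s ^ q * ENNReal.ofReal |s⁻¹|) * ∫⁻ h, F h := (mul_assoc _ _ _).symm
      -- The factor `s ^ q` of the weight times the Jacobian `1 / s` is `s ^ (q - 1) ≤ 1`.
      _ ≤ 1 * ∫⁻ h, F h := by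
          gcongr
          rw [ENNReal.ofReal_rpow_of_pos hs.1, ← ENNReal.ofReal_mul (by have := hs.1; positivity),
            abs_of_pos (inv_pos.2 hs.1), ← Real.rpow_neg_one, ← Real.rpow_add hs.1]
          apply ENNReal.ofReal_le_one.2
          exact Real.rpow_le_one hs.1.le hs.2 (by linarith)
      _ = _ := by rw [one_mul, hF, lintegral_indicator measurableSet_Ioc]
  calc ∫⁻ s in Ioc (0 : ℝ) 1, ∫⁻ h in A, (‖h‖ₑ ^ q)⁻¹ * ψ (h * s)
      ≤ ∫⁻ s in Ioc (0 : ℝ) 1, ∫⁻ h in A, (‖h‖ₑ ^ q)⁻¹ * ψ h :=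
        lintegral_mono_ae ((ae_restrict_mem measurableSet_Ioc).mono hs)
    _ = _ := by simp

variable [hq : Fact (2 < q)]

/-- The difference quotient of `u` is an average of its velocity. -/
lemma dif_coe_add (u : CurveSpace n q) (h b : ℝ) :
    dif u ((h : Circ) + (b : Circ), (b : Circ)) =
      h • ∫ s in (0 : ℝ)..1, cvel u ((b + h * s : ℝ) : Circ) := by
  rw [intervalIntegral.smul_integral_comp_add_mul (fun t : ℝ => cvel u (t : Circ)),
    ← curve_sub_eq_integral_cvel, dif]
  simp [add_comm]

/-- The scaled Taylor remainder `(u(x) - u(y) - (x - y) u'(y)) / (x - y)²`. -/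
def remainder (u : CurveSpace n q) (p : Circ × Circ) : Euc n :=
  (signedDif p ^ 2)⁻¹ • (dif u p - signedDif p • cvel u p.2)

lemma measurable_dif (u : CurveSpace n q) : Measurable (dif u) := by
  have : Continuous (dif u) := by unfold dif; fun_prop
  exact this.measurable

lemma measurable_remainder (u : CurveSpace n q) : Measurable (remainder u) := by
  have h1 : Measurable fun p : Circ × Circ => cvel u p.2 :=
    (cvel u).continuous.measurable.comp measurable_snd
  exact ((measurable_signedDif.pow_const 2).inv).smul
    ((measurable_dif u).sub (measurable_signedDif.smul h1))

/-- The remainder at step `h` is `h⁻¹` times the average over `s ∈ (0, 1]` of `u'(y + h s) - u'(y)`;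
Jensen's inequality moves the power `q` inside the average. -/
lemma enorm_remainder_rpow_le (u : CurveSpace n q) {h : ℝ}
    (hh : h ∈ Ioc (-1 / 2 : ℝ) (-1 / 2 + 1)) (b : ℝ) :
    ‖remainder u ((h : Circ) + (b : Circ), (b : Circ))‖ₑ ^ q ≤ (‖h‖ₑ ^ q)⁻¹ *
      ∫⁻ s in Ioc (0 : ℝ) 1, ‖cvel u ((b + h * s : ℝ) : Circ) - cvel u (b : Circ)‖ₑ ^ q := by
  have h0 : 0 < q := by linarith [hq.out]
  have hcont : Continuous fun s : ℝ => cvel u ((b + h * s : ℝ) : Circ) :=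
    (continuous_cvel_coe u).comp (by fun_prop)
  have hrem : remainder u ((h : Circ) + (b : Circ), (b : Circ)) = h⁻¹ •
      ∫ s in (0 : ℝ)..1, (cvel u ((b + h * s : ℝ) : Circ) - cvel u (b : Circ)) := by
    rw [remainder, signedDif_coe_add hh, dif_coe_add, ← smul_sub,
      intervalIntegral.integral_sub (hcont.intervalIntegrable _ _) intervalIntegrable_const,
      intervalIntegral.integral_const, sub_zero, one_smul, smul_smul]
    congr 1
    by_cases hz : h = 0
    · simp [hz]
    · field_simp
  rw [hrem]
  by_cases hz : h = 0
  · subst hz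
    simp [h0]
  set F : ℝ → Euc n := fun s => cvel u ((b + h * s : ℝ) : Circ) - cvel u (b : Circ) with hF
  have hFc : Continuous F := hcont.sub continuous_const
  have hprob : IsProbabilityMeasure ((volume : Measure ℝ).restrict (Ioc 0 1)) := ⟨by simp⟩
  have h1 : ‖∫ s in (0 : ℝ)..1, F s‖ₑ ^ q ≤ ∫⁻ s in Ioc (0 : ℝ) 1, ‖F s‖ₑ ^ q := by
    rw [intervalIntegral.integral_of_le zero_le_one]
    have h2 : ‖∫ s in Ioc (0 : ℝ) 1, F s‖ₑ ≤
        eLpNorm F (ENNReal.ofReal q) ((volume : Measure ℝ).restrict (Ioc 0 1)) :=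
      calc _ ≤ ∫⁻ s in Ioc (0 : ℝ) 1, ‖F s‖ₑ := enorm_integral_le_lintegral_enorm _
        _ = eLpNorm F 1 ((volume : Measure ℝ).restrict (Ioc 0 1)) :=
          eLpNorm_one_eq_lintegral_enorm.symm
        _ ≤ _ := eLpNorm_le_eLpNorm_of_exponent_le Fact.out hFc.aestronglyMeasurable
    rw [lintegral_rpow_eq_eLpNorm h0]
    gcongr
  rw [enorm_smul, ENNReal.mul_rpow_of_nonneg _ _ h0.le, enorm_inv hz, ENNReal.inv_rpow]
  gcongr

lemma slobodeckij_rpow_eq (u : CurveSpace n q) : slobodeckij (1 - 1 / q) q u.vel ^ q =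
    ∫⁻ y : Circ, ∫⁻ h in Ioc (-1 / 2 : ℝ) (-1 / 2 + 1),
      (‖h‖ₑ ^ q)⁻¹ * ‖cvel u ((h : Circ) + y) - cvel u y‖ₑ ^ q := by
  have h0 : 0 < q := by linarith [hq.out]
  have hexp : 1 + (1 - 1 / q) * q = q := by field_simp; ring
  rw [← slobodeckij_congr (cvel_ae_eq u), slobodeckij, ← ENNReal.rpow_mul,
    one_div_mul_cancel h0.ne', ENNReal.rpow_one, hexp, lintegral_torus_eq]
  · refine lintegral_congr fun y => setLIntegral_congr_fun measurableSet_Ioc fun h hh => ?_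
    simp only [add_sub_cancel_right]
    rw [← ofReal_norm (h : Circ), norm_coe_of_mem hh, ← Real.norm_eq_abs, ofReal_norm,
      div_eq_mul_inv, mul_comm]
  · have h2 : Continuous (fun p : Circ × Circ => p.1 - p.2) := by fun_prop
    have h3 : Continuous (fun p : Circ × Circ => cvel u p.1 - cvel u p.2) := by fun_prop
    exact (h3.enorm.measurable.pow_const _).div (h2.enorm.measurable.pow_const _)

/-- The pointwise bound involves velocity differences at the shortened steps `h s`. The dilation
inequality replaces `h s` by `h` without loss, and what is left is the Slobodeckij integral. -/
lemma lintegral_remainder_le (u : CurveSpace n q) :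
    ∫⁻ p, ‖remainder u p‖ₑ ^ q ≤ slobodeckij (1 - 1 / q) q u.vel ^ q := by
  rw [slobodeckij_rpow_eq, lintegral_torus_eq _ ((measurable_remainder u).enorm.pow_const _)]
  refine lintegral_mono fun y => ?_
  obtain ⟨b, rfl⟩ := QuotientAddGroup.mk_surjective y
  change ∫⁻ h in Ioc (-1 / 2 : ℝ) (-1 / 2 + 1),
    ‖remainder u ((h : Circ) + (b : Circ), (b : Circ))‖ₑ ^ q ≤
    ∫⁻ h in Ioc (-1 / 2 : ℝ) (-1 / 2 + 1),
      (‖h‖ₑ ^ q)⁻¹ * ‖cvel u ((h : Circ) + (b : Circ)) - cvel u (b : Circ)‖ₑ ^ q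
  set ψ : ℝ → ℝ≥0∞ := fun t => ‖cvel u ((b + t : ℝ) : Circ) - cvel u (b : Circ)‖ₑ ^ q with hψ
  have hψm : Measurable ψ := by
    have h1 : Continuous fun t : ℝ => cvel u ((b + t : ℝ) : Circ) - cvel u (b : Circ) :=
      ((continuous_cvel_coe u).comp (by fun_prop)).sub continuous_const
    exact h1.enorm.measurable.pow_const _
  calc _ ≤ ∫⁻ h in Ioc (-1 / 2 : ℝ) (-1 / 2 + 1),
        ((‖h‖ₑ ^ q)⁻¹ * ∫⁻ s in Ioc (0 : ℝ) 1, ψ (h * s)) :=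
        lintegral_mono_ae ((ae_restrict_mem measurableSet_Ioc).mono fun h hh =>
          enorm_remainder_rpow_le u hh b)
    _ ≤ ∫⁻ h in Ioc (-1 / 2 : ℝ) (-1 / 2 + 1), (‖h‖ₑ ^ q)⁻¹ * ψ h :=
        lintegral_dilation_le (by linarith [hq.out]) ψ hψm
    _ = _ := by
        refine lintegral_congr fun h => ?_
        simp only [hψ, AddCircle.coe_add, add_comm (b : Circ)]

lemma eLpNorm_remainder_le (u : CurveSpace n q) :
    eLpNorm (remainder u) (ENNReal.ofReal q) volume ≤ slobodeckij (1 - 1 / q) q u.vel := by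
  have h0 : 0 < q := by linarith [hq.out]
  have h := lintegral_remainder_le u
  rw [lintegral_rpow_eq_eLpNorm h0] at h
  exact (ENNReal.rpow_le_rpow_iff h0).1 h

lemma memLp_remainder (u : CurveSpace n q) :
    MemLp (remainder u) (ENNReal.ofReal q) volume :=
  ⟨(measurable_remainder u).aestronglyMeasurable,
    (eLpNorm_remainder_le u).trans_lt (slobodeckij_vel_ne_top u).lt_top⟩

lemma dif_add (u v : CurveSpace n q) (p : Circ × Circ) : dif (u + v) p = dif u p + dif v p := by
  simp only [dif, curve_add, ContinuousMap.add_apply]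
  abel

lemma dif_smul (c : ℝ) (u : CurveSpace n q) (p : Circ × Circ) : dif (c • u) p = c • dif u p := by
  simp only [dif, curve_smul, ContinuousMap.smul_apply, smul_sub]

lemma remainder_add (u v : CurveSpace n q) (p : Circ × Circ) :
    remainder (u + v) p = remainder u p + remainder v p := by
  simp only [remainder, dif_add, cvel_add, ContinuousMap.add_apply]
  module

lemma remainder_smul (c : ℝ) (u : CurveSpace n q) (p : Circ × Circ) :
    remainder (c • u) p = c • remainder u p := by
  simp only [remainder, dif_smul, cvel_smul, ContinuousMap.smul_apply]
  module

end Remainder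

/-! ### Difference quotients -/

section Secant

variable {n : ℕ} {q : ℝ} [hq : Fact (2 < q)]

/-- The difference quotient `(u(x) - u(y)) / (x - y)`, which equals `u'(y)` on the diagonal. -/
def secant (u : CurveSpace n q) (p : Circ × Circ) : Euc n :=
  ∫ s in (0 : ℝ)..1, cvel u (p.2 + ((signedDif p * s : ℝ) : Circ))

lemma continuous_cvel_add_coe (u : CurveSpace n q) (y : Circ) (h : ℝ) :
    Continuous fun s : ℝ => cvel u (y + ((h * s : ℝ) : Circ)) :=
  (cvel u).continuous.comp (continuous_const.add
    ((AddCircle.continuous_mk' 1).comp (continuous_const.mul continuous_id)))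

lemma dif_eq_smul_secant (u : CurveSpace n q) (p : Circ × Circ) :
    dif u p = signedDif p • secant u p := by
  obtain ⟨x, y⟩ := p
  obtain ⟨b, rfl⟩ := QuotientAddGroup.mk_surjective y
  have h1 : ((signedDif (x, (b : Circ)) : ℝ) : Circ) + (b : Circ) = x := by
    rw [coe_signedDif]; simp
  have h2 := dif_coe_add u (signedDif (x, (b : Circ))) b
  rw [h1] at h2
  change dif u (x, (b : Circ)) = signedDif (x, (b : Circ)) • secant u (x, (b : Circ))
  rw [h2, secant]
  simp only [AddCircle.coe_add]

lemma secant_add (u v : CurveSpace n q) (p : Circ × Circ) :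
    secant (u + v) p = secant u p + secant v p := by
  rw [secant, secant, secant, ← intervalIntegral.integral_add
    ((continuous_cvel_add_coe u _ _).intervalIntegrable _ _)
    ((continuous_cvel_add_coe v _ _).intervalIntegrable _ _)]
  simp only [cvel_add, ContinuousMap.add_apply]

lemma secant_smul (c : ℝ) (u : CurveSpace n q) (p : Circ × Circ) :
    secant (c • u) p = c • secant u p := by
  rw [secant, secant, ← intervalIntegral.integral_smul]
  simp only [cvel_smul, ContinuousMap.smul_apply]

lemma norm_secant_le (u : CurveSpace n q) (p : Circ × Circ) : ‖secant u p‖ ≤ ‖cvel u‖ := by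
  have h := intervalIntegral.norm_integral_le_of_norm_le_const (a := 0) (b := 1) (C := ‖cvel u‖)
    (f := fun s : ℝ => cvel u (p.2 + ((signedDif p * s : ℝ) : Circ)))
    fun s _ => (cvel u).norm_coe_le_norm _
  rwa [sub_zero, abs_one, mul_one] at h

lemma secant_of_eq (u : CurveSpace n q) {p : Circ × Circ} (hp : p.1 = p.2) :
    secant u p = cvel u p.2 := by
  simp [secant, (signedDif_eq_zero_iff p).2 hp]

/-- Near the diagonal the average runs over short arcs, and `u'` is uniformly continuous. Continuity
off the diagonal is not asserted: where `signedDif` jumps between `1/2` and `-1/2`, the secant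
changes sign. -/
lemma continuousAt_secant (u : CurveSpace n q) {p : Circ × Circ} (hp : p.1 = p.2) :
    ContinuousAt (secant u) p := by
  have hdiff : Tendsto (fun r => secant u r - cvel u r.2) (𝓝 p) (𝓝 0) := by
    have huc : UniformContinuous (cvel u) :=
      CompactSpace.uniformContinuous_of_continuous (cvel u).continuous
    rw [NormedAddGroup.tendsto_nhds_zero]
    intro ε hε
    obtain ⟨δ, hδ, hd⟩ := Metric.uniformContinuous_iff.1 huc (ε / 2) (half_pos hε)
    have hc : Continuous (fun r : Circ × Circ => ‖r.1 - r.2‖) := by fun_prop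
    have hev : ∀ᶠ r in 𝓝 p, ‖r.1 - r.2‖ < δ :=
      (hc.tendsto' p 0 (by simp [hp])).eventually (gt_mem_nhds hδ)
    filter_upwards [hev] with r hr
    have h1 : secant u r - cvel u r.2 = ∫ s in (0 : ℝ)..1,
        (cvel u (r.2 + ((signedDif r * s : ℝ) : Circ)) - cvel u r.2) := by
      rw [intervalIntegral.integral_sub ((continuous_cvel_add_coe u _ _).intervalIntegrable _ _)
        intervalIntegrable_const]
      simp [secant]
    rw [h1]
    have h2 := intervalIntegral.norm_integral_le_of_norm_le_const (a := 0) (b := 1) (C := ε / 2)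
      (f := fun s : ℝ => cvel u (r.2 + ((signedDif r * s : ℝ) : Circ)) - cvel u r.2)
      fun s hs => by
        rw [uIoc_of_le zero_le_one] at hs
        rw [← dist_eq_norm]
        refine (hd ?_).le
        rw [dist_eq_norm, add_sub_cancel_left]
        refine (norm_coe_le_abs _).trans_lt ?_
        rw [abs_mul, abs_signedDif, abs_of_pos hs.1]
        nlinarith [hs.1, hs.2, norm_nonneg (r.1 - r.2)]
    rw [sub_zero, abs_one, mul_one] at h2
    linarith
  have hc : Continuous fun r : Circ × Circ => cvel u r.2 := by fun_prop
  have h := hdiff.add (hc.tendsto p)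
  rw [ContinuousAt, secant_of_eq u hp]
  simpa using h

/-- The sign jump of `secant` cancels in a product of two secants: off the diagonal the product is
`⟨Du, Dv⟩ / |x - y|²`, which involves only the continuous distance. -/
lemma continuous_inner_secant (u v : CurveSpace n q) :
    Continuous fun p => (inner ℝ (secant u p) (secant v p) : ℝ) := by
  rw [continuous_iff_continuousAt]
  intro p
  by_cases hp : p.1 = p.2
  · exact (continuousAt_secant u hp).inner (𝕜 := ℝ) (continuousAt_secant v hp)
  · have h1 : Continuous fun p : Circ × Circ => (inner ℝ (dif u p) (dif v p) : ℝ) := by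
      unfold dif; fun_prop
    have h2 : Continuous fun p : Circ × Circ => ‖p.1 - p.2‖ ^ 2 := by fun_prop
    have h3 : ‖p.1 - p.2‖ ^ 2 ≠ 0 := by
      simpa [sub_eq_zero] using hp
    refine (h1.continuousAt.div h2.continuousAt h3).congr ?_
    filter_upwards [h2.continuousAt.eventually_ne h3] with r hr
    simp only [Pi.div_apply]
    rw [← abs_signedDif, sq_abs] at hr
    rw [← abs_signedDif, sq_abs, dif_eq_smul_secant, dif_eq_smul_secant, real_inner_smul_left,
      real_inner_smul_right]
    field_simp [pow_ne_zero_iff two_ne_zero |>.1 hr]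

/-- The inner product of two difference quotients, as a continuous function. -/
def metricForm (u v : CurveSpace n q) : C(Circ × Circ, ℝ) :=
  ⟨fun p => inner ℝ (secant u p) (secant v p), continuous_inner_secant u v⟩

lemma metricForm_apply (u v : CurveSpace n q) (p : Circ × Circ) :
    metricForm u v p = inner ℝ (secant u p) (secant v p) := rfl

lemma norm_metricForm_le (u v : CurveSpace n q) : ‖metricForm u v‖ ≤ ‖cvel u‖ * ‖cvel v‖ := by
  rw [ContinuousMap.norm_le _ (by positivity)]
  intro p
  refine (norm_inner_le_norm (𝕜 := ℝ) (secant u p) (secant v p)).trans ?_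
  gcongr <;> exact norm_secant_le _ _

lemma metricForm_comm (u v : CurveSpace n q) : metricForm u v = metricForm v u := by
  ext p
  exact real_inner_comm (secant v p) (secant u p)

lemma norm_cvel_le_norm (u : CurveSpace n q) : ‖cvel u‖ ≤ morreyConst q * ‖u‖ :=
  (norm_cvel_le u).trans
    (mul_le_mul_of_nonneg_left (wNorm_le_norm u) (morreyConst_pos hq.out).le)

/-- `metricForm` as a continuous bilinear map. -/
def metricCLM : CurveSpace n q →L[ℝ] CurveSpace n q →L[ℝ] C(Circ × Circ, ℝ) :=
  (LinearMap.mk₂ ℝ metricForm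
    (fun u v w => by ext p; simp [metricForm_apply, secant_add, inner_add_left])
    (fun c u w => by ext p; simp [metricForm_apply, secant_smul, real_inner_smul_left])
    (fun u v w => by ext p; simp [metricForm_apply, secant_add, inner_add_right])
    (fun c u w => by ext p; simp [metricForm_apply, secant_smul, real_inner_smul_right])).mkContinuous₂
    (morreyConst q ^ 2) fun u v => by
      refine (norm_metricForm_le u v).trans ?_
      have := (morreyConst_pos hq.out).le
      calc _ ≤ (morreyConst q * ‖u‖) * (morreyConst q * ‖v‖) := by
            gcongr <;> exact norm_cvel_le_norm _
        _ = _ := by ring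

/-! ### The bi-Lipschitz constant -/

lemma secant_ne_zero {u : CurveSpace n q} (hu : u ∈ embeddedRegular n q) (p : Circ × Circ) :
    secant u p ≠ 0 := by
  by_cases hp : p.1 = p.2
  · rw [secant_of_eq u hp]
    exact cvel_ne_zero hu _
  · intro h
    have h1 := dif_eq_smul_secant u p
    rw [h, smul_zero, dif, sub_eq_zero] at h1
    exact hp (hu.1 h1)

/-- Injectivity keeps the secant nonzero off the diagonal and regularity keeps it nonzero on it. For
differentiability and for the formula of the second variation, this is the only property of embedded
regular curves that is used. -/
lemma isUnit_metricForm {u : CurveSpace n q} (hu : u ∈ embeddedRegular n q) :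
    IsUnit (metricForm u u) := by
  rw [ContinuousMap.isUnit_iff_forall_ne_zero]
  intro p
  rw [metricForm_apply, Ne, inner_self_eq_zero]
  exact secant_ne_zero hu p

lemma inverse_metricForm_apply {u : CurveSpace n q} (hu : IsUnit (metricForm u u))
    (p : Circ × Circ) : Ring.inverse (metricForm u u) p = (metricForm u u p)⁻¹ := by
  have h := congrArg (fun f : C(Circ × Circ, ℝ) => f p) (Ring.inverse_mul_cancel _ hu)
  exact eq_inv_of_mul_eq_one_left h

lemma ae_fst_ne_snd : ∀ᵐ p : Circ × Circ, p.1 ≠ p.2 := by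
  have hm : MeasurableSet {p : Circ × Circ | p.1 ≠ p.2} :=
    (isClosed_eq continuous_fst continuous_snd).measurableSet.compl
  rw [Measure.volume_eq_prod, Measure.ae_prod_iff_ae_ae hm]
  refine .of_forall fun x => ?_
  have h0 : (volume : Measure Circ) {x} = 0 := by
    have h1 := AddCircle.volume_closedBall (1 : ℝ) (x := x) 0
    simpa [Metric.closedBall_zero] using h1
  rw [ae_iff]
  simpa [eq_comm, ofPred_eq_eq_singleton] using h0

lemma norm_secant_sq (u : CurveSpace n q) (p : Circ × Circ) :
    ‖dif u p‖ ^ 2 = signedDif p ^ 2 * metricForm u u p := by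
  rw [dif_eq_smul_secant, metricForm_apply, norm_smul, real_inner_self_eq_norm_sq, mul_pow,
    Real.norm_eq_abs, sq_abs]

/-- By compactness `1 / σ(u, u)` is bounded, and each quotient in `bil` is the square root of one of
its values. Hence `(bil u).toReal` loses nothing. -/
lemma bil_ne_top {u : CurveSpace n q} (hu : u ∈ embeddedRegular n q) : bil u ≠ ∞ := by
  have hunit := isUnit_metricForm hu
  have hle : bil u ≤ ENNReal.ofReal √‖Ring.inverse (metricForm u u)‖ := by
    refine iSup_le fun x => iSup_le fun y => iSup_le fun hxy => ?_
    have hdif : 0 < ‖u.curve x - u.curve y‖ :=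
      norm_pos_iff.2 (sub_ne_zero.2 fun h => hxy (hu.1 h))
    rw [← ofReal_norm, ← ofReal_norm, ← ENNReal.ofReal_div_of_pos hdif]
    apply ENNReal.ofReal_le_ofReal
    apply Real.le_sqrt_of_sq_le
    have h1 := (Ring.inverse (metricForm u u)).norm_coe_le_norm (x, y)
    have h3 := secant_ne_zero hu (x, y)
    have h4 : 0 < metricForm u u (x, y) := real_inner_self_pos.2 h3
    rw [inverse_metricForm_apply hunit, Real.norm_of_nonneg (inv_nonneg.2 h4.le)] at h1
    refine le_trans (le_of_eq ?_) h1
    have h2 := norm_secant_sq u (x, y)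
    have h5 : signedDif (x, y) ≠ 0 := fun h => hxy ((signedDif_eq_zero_iff _).1 h)
    have h6 : ‖x - y‖ = |signedDif (x, y)| := (abs_signedDif (x, y)).symm
    have h7 : ‖u.curve x - u.curve y‖ = ‖dif u (x, y)‖ := rfl
    rw [div_pow, h7, h2, h6, sq_abs, div_mul_eq_div_div, div_self (pow_ne_zero 2 h5), one_div]
  exact (hle.trans_lt ENNReal.ofReal_lt_top).ne

lemma norm_sub_le_bil {u : CurveSpace n q} (hu : u ∈ embeddedRegular n q) (p : Circ × Circ) :
    |signedDif p| ≤ (bil u).toReal * ‖dif u p‖ := by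
  by_cases hp : p.1 = p.2
  · simp [(signedDif_eq_zero_iff p).2 hp]
    positivity
  · have h1 : ‖p.1 - p.2‖ₑ / ‖u.curve p.1 - u.curve p.2‖ₑ ≤ bil u :=
      le_iSup_of_le p.1 (le_iSup_of_le p.2 (le_iSup_of_le hp le_rfl))
    have hdif : 0 < ‖u.curve p.1 - u.curve p.2‖ :=
      norm_pos_iff.2 (sub_ne_zero.2 fun h => hp (hu.1 h))
    have h2 := ENNReal.toReal_mono (bil_ne_top hu) h1
    rw [ENNReal.toReal_div, toReal_enorm, toReal_enorm, div_le_iff₀ hdif] at h2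
    rw [abs_signedDif]
    exact h2

/-- Off the diagonal this is the definition of `bil`. The inequality defines a closed set of full
measure, hence a dense one, which therefore also contains the diagonal. -/
lemma norm_inverse_metricForm_le {u : CurveSpace n q} (hu : u ∈ embeddedRegular n q) :
    ‖Ring.inverse (metricForm u u)‖ ≤ (bil u).toReal ^ 2 := by
  have hunit := isUnit_metricForm hu
  have hclosed : IsClosed {p | 1 ≤ (bil u).toReal ^ 2 * metricForm u u p} :=
    isClosed_le continuous_const (continuous_const.mul (metricForm u u).continuous)
  have hdense : Dense {p | 1 ≤ (bil u).toReal ^ 2 * metricForm u u p} := by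
    refine Measure.dense_of_ae (ae_fst_ne_snd.mono fun p hp => ?_)
    have h1 := norm_sub_le_bil hu p
    have h2 : |signedDif p| ^ 2 ≤ ((bil u).toReal * ‖dif u p‖) ^ 2 := by gcongr
    have h3 : 0 < signedDif p ^ 2 := by
      have : signedDif p ≠ 0 := fun h => hp ((signedDif_eq_zero_iff _).1 h)
      positivity
    rw [sq_abs, mul_pow, norm_secant_sq] at h2
    nlinarith
  rw [ContinuousMap.norm_le _ (by positivity)]
  intro p
  have h1 : 1 ≤ (bil u).toReal ^ 2 * metricForm u u p := by
    have h := hdense p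
    rwa [hclosed.closure_eq] at h
  have h4 : 0 < metricForm u u p := real_inner_self_pos.2 (secant_ne_zero hu p)
  rw [inverse_metricForm_apply hunit, Real.norm_of_nonneg (inv_nonneg.2 h4.le)]
  rwa [inv_le_iff_one_le_mul₀ h4]

/-- Submultiplicativity of the norm applied to `1 = σ(u, u)⁻¹ σ(u, u)` gives the square of the
claim. It serves to supply missing powers of `bil` and `‖u'‖_∞` in the final bound. -/
lemma one_le_bil_mul_norm_cvel {u : CurveSpace n q} (hu : u ∈ embeddedRegular n q) :
    1 ≤ (bil u).toReal * ‖cvel u‖ := by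
  have hunit := isUnit_metricForm hu
  have h1 : (1 : ℝ) ≤ ‖Ring.inverse (metricForm u u)‖ * ‖metricForm u u‖ := by
    have h := norm_mul_le (Ring.inverse (metricForm u u)) (metricForm u u)
    rwa [Ring.inverse_mul_cancel _ hunit, norm_one] at h
  have h2 : (1 : ℝ) ^ 2 ≤ ((bil u).toReal * ‖cvel u‖) ^ 2 := by
    calc (1 : ℝ) ^ 2 = 1 := one_pow 2
      _ ≤ ‖Ring.inverse (metricForm u u)‖ * ‖metricForm u u‖ := h1
      _ ≤ (bil u).toReal ^ 2 * (‖cvel u‖ * ‖cvel u‖) := by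
        gcongr
        · exact norm_inverse_metricForm_le hu
        · exact norm_metricForm_le u u
      _ = _ := by ring
  exact le_of_sq_le_sq h2 (by positivity)

end Secant

/-! ### The exterior product -/

section Wedge

variable {n : ℕ}

/-- The space of `n × n` matrices with the Hilbert–Schmidt inner product, which contains the
bivectors as the skew-symmetric matrices. -/
abbrev Biv (n : ℕ) : Type := EuclideanSpace ℝ (Fin n × Fin n)

/-- The bivector `a ∧ b`, as the skew-symmetric matrix `(a ⊗ b - b ⊗ a) / √2`. -/
def wedge (a b : Euc n) : Biv n :=
  WithLp.toLp 2 fun ij => (√2)⁻¹ * (a ij.1 * b ij.2 - a ij.2 * b ij.1)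

lemma wedge_apply (a b : Euc n) (ij : Fin n × Fin n) :
    wedge a b ij = (√2)⁻¹ * (a ij.1 * b ij.2 - a ij.2 * b ij.1) := rfl

/-- The Hilbert–Schmidt product counts every unordered pair of indices twice, which the factor
`(√2)⁻¹` in `wedge` compensates. Thus `wedgeNorm` comes from a Hilbert norm, and the calculus of
`‖x‖ ^ q` applies to bivectors. -/
lemma inner_wedge (a b c d : Euc n) : inner ℝ (wedge a b) (wedge c d) = wedgeInner a b c d := by
  have h2 : (√2)⁻¹ * (√2)⁻¹ = (1 / 2 : ℝ) := by
    rw [← mul_inv, Real.mul_self_sqrt (by norm_num)]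
    norm_num
  simp only [wedgeInner, PiLp.inner_apply, RCLike.inner_apply, conj_trivial,
    Fintype.sum_prod_type, wedge_apply]
  simp only [Finset.sum_mul_sum]
  rw [Finset.sum_comm (f := fun i j => d i * a i * (c j * b j)), ← Finset.sum_sub_distrib]
  have hsymm : ∑ i, ∑ j, (c i * a i * (d j * b j) - d j * a j * (c i * b i)) =
      ∑ i, ∑ j, (c j * a j * (d i * b i) - d i * a i * (c j * b j)) := Finset.sum_comm
  have hsum : ∑ i, ∑ j, ((√2)⁻¹ * (c i * d j - c j * d i)) * ((√2)⁻¹ * (a i * b j - a j * b i)) =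
      (1 / 2) * (∑ i, ∑ j, (c i * a i * (d j * b j) - d j * a j * (c i * b i)) +
        ∑ i, ∑ j, (c j * a j * (d i * b i) - d i * a i * (c j * b j))) := by
    rw [← Finset.sum_add_distrib, Finset.mul_sum]
    refine Finset.sum_congr rfl fun i _ => ?_
    rw [← Finset.sum_add_distrib, Finset.mul_sum]
    refine Finset.sum_congr rfl fun j _ => ?_
    rw [← h2]
    ring
  rw [hsum, ← hsymm]
  simp only [Finset.sum_sub_distrib]
  ring

lemma norm_wedge (a b : Euc n) : ‖wedge a b‖ = wedgeNorm a b := by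
  rw [wedgeNorm, ← inner_wedge, real_inner_self_eq_norm_sq, Real.sqrt_sq (norm_nonneg _)]

lemma norm_wedge_le (a b : Euc n) : ‖wedge a b‖ ≤ ‖a‖ * ‖b‖ := by
  rw [norm_wedge, wedgeNorm]
  apply Real.sqrt_le_iff.2 ⟨by positivity, ?_⟩
  rw [wedgeInner, real_inner_self_eq_norm_sq, real_inner_self_eq_norm_sq, real_inner_comm b a]
  nlinarith [mul_self_nonneg (inner ℝ a b : ℝ)]

lemma wedge_add_left (a b c : Euc n) : wedge (a + b) c = wedge a c + wedge b c := by
  ext ij; simp [wedge_apply]; ring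

lemma wedge_add_right (a b c : Euc n) : wedge a (b + c) = wedge a b + wedge a c := by
  ext ij; simp [wedge_apply]; ring

lemma wedge_smul_left (t : ℝ) (a b : Euc n) : wedge (t • a) b = t • wedge a b := by
  ext ij; simp [wedge_apply]; ring

lemma wedge_smul_right (t : ℝ) (a b : Euc n) : wedge a (t • b) = t • wedge a b := by
  ext ij; simp [wedge_apply]; ring

lemma wedge_sub_right (a b c : Euc n) : wedge a (b - c) = wedge a b - wedge a c := by
  ext ij; simp [wedge_apply]; ring

lemma wedge_comm (a b : Euc n) : wedge a b = -wedge b a := by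
  ext ij; simp [wedge_apply]; ring

lemma wedge_self (a : Euc n) : wedge a a = 0 := by
  ext ij; simp [wedge_apply]; ring_nf

/-- The exterior product as a continuous bilinear map. -/
def wedgeCLM : Euc n →L[ℝ] Euc n →L[ℝ] Biv n :=
  (LinearMap.mk₂ ℝ wedge wedge_add_left wedge_smul_left wedge_add_right
    wedge_smul_right).mkContinuous₂ 1 fun a b => by simpa using norm_wedge_le a b

end Wedge

/-! ### Multiplication of `Lp` functions by continuous functions -/

section Multiplication

variable {Q : Type*} [TopologicalSpace Q] [CompactSpace Q] [MeasurableSpace Q] [BorelSpace Q]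
  {μ : Measure Q} {H : Type*} [NormedAddCommGroup H] [NormedSpace ℝ H] {r : ℝ≥0∞}

lemma memLp_continuousMap_smul (a : C(Q, ℝ)) {f : Q → H} (hf : MemLp f r μ) :
    MemLp (fun x => a x • f x) r μ :=
  hf.of_le_mul (a.continuous.aestronglyMeasurable.smul hf.1) (c := ‖a‖) (.of_forall fun x => by
    rw [norm_smul]
    gcongr
    exact a.norm_coe_le_norm x)

/-- Multiplication of an `Lp` function by a continuous function. -/
def mulLp (a : C(Q, ℝ)) (f : Lp H r μ) : Lp H r μ :=
  (memLp_continuousMap_smul a (Lp.memLp f)).toLp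

lemma coeFn_mulLp (a : C(Q, ℝ)) (f : Lp H r μ) : mulLp a f =ᵐ[μ] fun x => a x • f x :=
  MemLp.coeFn_toLp _

lemma norm_mulLp_le (a : C(Q, ℝ)) (f : Lp H r μ) : ‖mulLp a f‖ ≤ ‖a‖ * ‖f‖ := by
  apply Lp.norm_le_mul_norm_of_ae_le_mul
  filter_upwards [coeFn_mulLp a f] with x hx
  rw [hx, norm_smul]
  gcongr
  exact a.norm_coe_le_norm x

variable [Fact (1 ≤ r)]

/-- `mulLp` as a continuous bilinear map. -/
def mulLpCLM : C(Q, ℝ) →L[ℝ] Lp H r μ →L[ℝ] Lp H r μ :=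
  (LinearMap.mk₂ ℝ mulLp
    (fun a b f => by
      apply Lp.ext
      filter_upwards [coeFn_mulLp (a + b) f, coeFn_mulLp a f, coeFn_mulLp b f,
        Lp.coeFn_add (mulLp a f) (mulLp b f)] with x h1 h2 h3 h4
      rw [h1, h4, Pi.add_apply, h2, h3, ContinuousMap.add_apply, add_smul])
    (fun c a f => by
      apply Lp.ext
      filter_upwards [coeFn_mulLp (c • a) f, coeFn_mulLp a f,
        Lp.coeFn_smul c (mulLp a f)] with x h1 h2 h3
      rw [h1, h3, Pi.smul_apply, h2, ContinuousMap.smul_apply, smul_assoc])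
    (fun a f g => by
      apply Lp.ext
      filter_upwards [coeFn_mulLp a (f + g), coeFn_mulLp a f, coeFn_mulLp a g,
        Lp.coeFn_add (mulLp a f) (mulLp a g), Lp.coeFn_add f g] with x h1 h2 h3 h4 h5
      rw [h1, h4, Pi.add_apply, h2, h3, h5, Pi.add_apply, smul_add])
    (fun c a f => by
      apply Lp.ext
      filter_upwards [coeFn_mulLp a (c • f), coeFn_mulLp a f,
        Lp.coeFn_smul c (mulLp a f), Lp.coeFn_smul c f] with x h1 h2 h3 h4
      rw [h1, h3, Pi.smul_apply, h2, h4, Pi.smul_apply, smul_comm])).mkContinuous₂ 1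
    fun a f => by simpa using norm_mulLp_le a f

end Multiplication

/-! ### The wedge of velocity and remainder as a bounded bilinear map into `Lp` -/

section WedgeRemainder

variable {n : ℕ} {q : ℝ} [hq : Fact (2 < q)]

lemma norm_wedge_remainder_le (u v : CurveSpace n q) (p : Circ × Circ) :
    ‖wedge (cvel u p.2) (remainder v p)‖ ≤ ‖cvel u‖ * ‖remainder v p‖ := by
  refine (norm_wedge_le _ _).trans ?_
  gcongr
  exact (cvel u).norm_coe_le_norm _

lemma memLp_wedge_remainder (u v : CurveSpace n q) :
    MemLp (fun p : Circ × Circ => wedge (cvel u p.2) (remainder v p)) (ENNReal.ofReal q) volume := by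
  refine (memLp_remainder v).of_le_mul ?_ (.of_forall (norm_wedge_remainder_le u v))
  have h1 : AEStronglyMeasurable (fun p : Circ × Circ => cvel u p.2) volume := by
    have : Continuous fun p : Circ × Circ => cvel u p.2 := by fun_prop
    exact this.aestronglyMeasurable
  exact wedgeCLM.aestronglyMeasurable_comp₂ h1 (memLp_remainder v).1

/-- The `L^q` function `u'(y) ∧ (v(x) - v(y) - (x - y) v'(y)) / (x - y)²`. -/
def wedgeRem (u v : CurveSpace n q) :
    Lp (Biv n) (ENNReal.ofReal q) (volume : Measure (Circ × Circ)) :=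
  (memLp_wedge_remainder u v).toLp

lemma coeFn_wedgeRem (u v : CurveSpace n q) :
    wedgeRem u v =ᵐ[volume] fun p => wedge (cvel u p.2) (remainder v p) :=
  MemLp.coeFn_toLp _

lemma norm_wedgeRem_le (u v : CurveSpace n q) :
    ‖wedgeRem u v‖ ≤ ‖cvel u‖ * wNorm (1 - 1 / q) q v.vel := by
  have h1 : eLpNorm (wedgeRem u v) (ENNReal.ofReal q) volume ≤
      ENNReal.ofReal ‖cvel u‖ * eLpNorm (remainder v) (ENNReal.ofReal q) volume := by
    rw [eLpNorm_congr_ae (coeFn_wedgeRem u v)]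
    exact eLpNorm_le_mul_eLpNorm_of_ae_le_mul (.of_forall (norm_wedge_remainder_le u v)) _
  have h2 : eLpNorm (wedgeRem u v) (ENNReal.ofReal q) volume ≤
      ENNReal.ofReal ‖cvel u‖ * slobodeckij (1 - 1 / q) q v.vel :=
    h1.trans (by gcongr; exact eLpNorm_remainder_le v)
  have h3 := ENNReal.toReal_mono
    (ENNReal.mul_ne_top ENNReal.ofReal_ne_top (slobodeckij_vel_ne_top v)) h2
  rw [ENNReal.toReal_mul, ENNReal.toReal_ofReal (norm_nonneg _)] at h3
  rw [Lp.norm_def]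
  refine h3.trans ?_
  gcongr
  exact slobodeckij_le_wNorm v

/-- `wedgeRem` as a continuous bilinear map. -/
def wedgeRemCLM : CurveSpace n q →L[ℝ] CurveSpace n q →L[ℝ]
    Lp (Biv n) (ENNReal.ofReal q) (volume : Measure (Circ × Circ)) :=
  (LinearMap.mk₂ ℝ wedgeRem
    (fun u v w => by
      apply Lp.ext
      filter_upwards [coeFn_wedgeRem (u + v) w, coeFn_wedgeRem u w, coeFn_wedgeRem v w,
        Lp.coeFn_add (wedgeRem u w) (wedgeRem v w)] with x h1 h2 h3 h4
      rw [h1, h4, Pi.add_apply, h2, h3, cvel_add, ContinuousMap.add_apply, wedge_add_left])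
    (fun c u w => by
      apply Lp.ext
      filter_upwards [coeFn_wedgeRem (c • u) w, coeFn_wedgeRem u w,
        Lp.coeFn_smul c (wedgeRem u w)] with x h1 h2 h3
      rw [h1, h3, Pi.smul_apply, h2, cvel_smul, ContinuousMap.smul_apply, wedge_smul_left])
    (fun u v w => by
      apply Lp.ext
      filter_upwards [coeFn_wedgeRem u (v + w), coeFn_wedgeRem u v, coeFn_wedgeRem u w,
        Lp.coeFn_add (wedgeRem u v) (wedgeRem u w)] with x h1 h2 h3 h4
      rw [h1, h4, Pi.add_apply, h2, h3, remainder_add, wedge_add_right])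
    (fun c u w => by
      apply Lp.ext
      filter_upwards [coeFn_wedgeRem u (c • w), coeFn_wedgeRem u w,
        Lp.coeFn_smul c (wedgeRem u w)] with x h1 h2 h3
      rw [h1, h3, Pi.smul_apply, h2, remainder_smul, wedge_smul_right])).mkContinuous₂
    (morreyConst q) fun u v => by
      refine (norm_wedgeRem_le u v).trans ?_
      exact mul_le_mul (norm_cvel_le_norm u) (wNorm_le_norm v) (wNorm_nonneg _ _ _)
        (mul_nonneg (morreyConst_pos hq.out).le (norm_nonneg u))

end WedgeRemainder

/-! ### Second derivatives of quotients of quadratic maps -/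

section QuadraticQuotient

variable {X A Y : Type*} [NormedAddCommGroup X] [NormedSpace ℝ X] [NormedCommRing A]
  [NormedAlgebra ℝ A] [CompleteSpace A] [NormedAddCommGroup Y] [NormedSpace ℝ Y]
  (σ : X →L[ℝ] X →L[ℝ] A) (β : X →L[ℝ] X →L[ℝ] Y) (m : A →L[ℝ] Y →L[ℝ] Y)

/-- The quotient `β(u, u) / σ(u, u)`. -/
def quadQuot (u : X) : Y := m (Ring.inverse (σ u u)) (β u u)

/-- The first derivative of `quadQuot`. -/
def quadQuot₁ (u v : X) : Y :=
  m (Ring.inverse (σ u u)) (β u v + β v u) -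
    (2 : ℝ) • m (Ring.inverse (σ u u) ^ 2 * σ u v) (β u u)

/-- The second derivative of `quadQuot`. -/
def quadQuot₂ (u v w : X) : Y :=
  m (Ring.inverse (σ u u)) (β v w + β w v) -
    (2 : ℝ) • m (Ring.inverse (σ u u) ^ 2 * σ u v) (β u w + β w u) -
    (2 : ℝ) • m (Ring.inverse (σ u u) ^ 2 * σ u w) (β u v + β v u) -
    (2 : ℝ) • m (Ring.inverse (σ u u) ^ 2 * σ v w) (β u u) +
    (8 : ℝ) • m (Ring.inverse (σ u u) ^ 3 * (σ u v * σ u w)) (β u u)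

lemma hasDerivAt_line (u v : X) : HasDerivAt (fun t : ℝ => u + t • v) v 0 := by
  simpa using ((hasDerivAt_id (0 : ℝ)).smul_const v).const_add u

lemma hasDerivAt_bilin_line {Z : Type*} [NormedAddCommGroup Z] [NormedSpace ℝ Z]
    (b : X →L[ℝ] X →L[ℝ] Z) (u v : X) :
    HasDerivAt (fun t : ℝ => b (u + t • v) (u + t • v)) (b u v + b v u) 0 := by
  have h1 : HasDerivAt (fun t : ℝ => b (u + t • v)) (b v) 0 :=
    b.hasFDerivAt.comp_hasDerivAt 0 (hasDerivAt_line u v)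
  have h2 := h1.clm_apply (hasDerivAt_line u v)
  simpa [add_comm] using h2

/-- The derivative of inversion is `h ↦ -a⁻¹ h a⁻¹`; symmetry of `σ` produces the factor `2` and
commutativity collects the inverses. No symmetry is required of `β`, whose two slots play different
roles. -/
lemma hasDerivAt_inverse_line (hσ : ∀ u v, σ u v = σ v u) {u : X} (hu : IsUnit (σ u u)) (v : X) :
    HasDerivAt (fun t : ℝ => Ring.inverse (σ (u + t • v) (u + t • v)))
      (-(2 : ℝ) • (Ring.inverse (σ u u) ^ 2 * σ u v)) 0 := by
  obtain ⟨a, ha⟩ := hu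
  have h1 := hasDerivAt_bilin_line σ u v
  have h2 : HasFDerivAt Ring.inverse
      (-ContinuousLinearMap.mulLeftRight ℝ A ↑a⁻¹ ↑a⁻¹) (σ (u + (0 : ℝ) • v) (u + (0 : ℝ) • v)) := by
    rw [zero_smul, add_zero, ← ha]
    exact hasFDerivAt_ringInverse a
  have h3 := h2.comp_hasDerivAt (0 : ℝ) h1
  refine h3.congr_deriv ?_
  rw [← ha, Ring.inverse_unit, hσ v u, ← two_smul ℝ]
  simp only [neg_apply, map_smul, ContinuousLinearMap.mulLeftRight_apply, neg_smul]
  rw [smul_neg, show (↑a⁻¹ : A) * σ u v * ↑a⁻¹ = ↑a⁻¹ ^ 2 * σ u v by ring]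

lemma hasDerivAt_quadQuot (hσ : ∀ u v, σ u v = σ v u) {u : X} (hu : IsUnit (σ u u)) (v : X) :
    HasDerivAt (fun t : ℝ => quadQuot σ β m (u + t • v)) (quadQuot₁ σ β m u v) 0 := by
  have h1 := m.hasFDerivAt.comp_hasDerivAt (0 : ℝ) (hasDerivAt_inverse_line σ hσ hu v)
  have h2 := h1.clm_apply (hasDerivAt_bilin_line β u v)
  refine h2.congr_deriv ?_
  simp only [Function.comp, zero_smul, add_zero, map_smul, smul_apply, quadQuot₁]
  module

lemma hasDerivAt_quadQuot₁ (hσ : ∀ u v, σ u v = σ v u) {u : X} (hu : IsUnit (σ u u)) (v w : X) :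
    HasDerivAt (fun t : ℝ => quadQuot₁ σ β m (u + t • v) w) (quadQuot₂ σ β m u v w) 0 := by
  have hi := hasDerivAt_inverse_line σ hσ hu v
  have h1 := m.hasFDerivAt.comp_hasDerivAt (0 : ℝ) hi
  have hβ1 : HasDerivAt (fun t : ℝ => β (u + t • v) w + β w (u + t • v)) (β v w + β w v) 0 :=
    (((ContinuousLinearMap.apply ℝ Y w).comp β).hasFDerivAt.comp_hasDerivAt 0
      (hasDerivAt_line u v)).add ((β w).hasFDerivAt.comp_hasDerivAt 0 (hasDerivAt_line u v))
  have hσ1 : HasDerivAt (fun t : ℝ => σ (u + t • v) w) (σ v w) 0 :=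
    ((ContinuousLinearMap.apply ℝ A w).comp σ).hasFDerivAt.comp_hasDerivAt 0 (hasDerivAt_line u v)
  have h2 := h1.clm_apply hβ1
  have h3 := m.hasFDerivAt.comp_hasDerivAt (0 : ℝ) ((hi.mul hi).mul hσ1)
  have h4 := h3.clm_apply (hasDerivAt_bilin_line β u v)
  have h5 := h2.sub (h4.const_smul (2 : ℝ))
  refine (h5.congr_deriv ?_).congr_of_eventuallyEq (.of_forall fun t => ?_)
  · simp only [Function.comp, Pi.mul_apply, zero_smul, add_zero, quadQuot₂]
    set i := Ring.inverse (σ u u) with hi'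
    -- Differentiating `i²` gives `-4 i³ σ(u, v)`; with the prefactor `-2` from the first derivative
    -- this is the coefficient `8`.
    have e : ((-(2 : ℝ)) • (i ^ 2 * σ u v) * i + i * (-(2 : ℝ)) • (i ^ 2 * σ u v)) * σ u w +
        i * i * σ v w = (-(4 : ℝ)) • (i ^ 3 * (σ u v * σ u w)) + i ^ 2 * σ v w := by
      simp only [smul_mul_assoc, mul_smul_comm]
      rw [show i ^ 2 * σ u v * i = i ^ 3 * σ u v by ring,
        show i * (i ^ 2 * σ u v) = i ^ 3 * σ u v by ring, ← add_smul, smul_mul_assoc]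
      norm_num
      ring_nf
    rw [e, ← pow_two]
    simp only [map_add, map_smul, add_apply, smul_apply]
    module
  · simp only [Function.comp, Pi.sub_apply, Pi.smul_apply, Pi.mul_apply, quadQuot₁, pow_two]

lemma contDiffAt_quadQuot {u : X} (hu : IsUnit (σ u u)) {k : WithTop ℕ∞} :
    ContDiffAt ℝ k (quadQuot σ β m) u := by
  obtain ⟨a, ha⟩ := hu
  have h1 : ContDiffAt ℝ k (fun u => σ u u) u := (σ.contDiff.clm_apply contDiff_id).contDiffAt
  have h2 : ContDiffAt ℝ k (fun u => Ring.inverse (σ u u)) u := by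
    have h := contDiffAt_ringInverse ℝ (n := k) a
    rw [ha] at h
    exact ContDiffAt.comp (g := Ring.inverse) (f := fun u => σ u u) u h h1
  have h3 : ContDiffAt ℝ k (fun u => m (Ring.inverse (σ u u))) u :=
    ContDiffAt.comp (g := m) (f := fun u => Ring.inverse (σ u u)) u m.contDiff.contDiffAt h2
  exact h3.clm_apply (β.contDiff.clm_apply contDiff_id).contDiffAt

/-- Units form an open set in a complete normed ring, so the formulas at `u` hold in a neighbourhood
and may be differentiated again. -/
lemma eventually_isUnit_quad {u : X} (hu : IsUnit (σ u u)) : ∀ᶠ z in 𝓝 u, IsUnit (σ z z) := by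
  have h1 : Continuous fun u => σ u u := (σ.contDiff (n := 0).clm_apply contDiff_id).continuous
  exact h1.continuousAt.eventually (Units.isOpen.mem_nhds hu)

/-- Since smoothness is known abstractly, derivatives can be computed along lines; the explicit
expressions for the derivatives need not be packaged as operators. -/
lemma fderiv_apply_eq_of_line {Z : Type*} [NormedAddCommGroup Z] [NormedSpace ℝ Z] {f : X → Z}
    {u v : X} {z : Z} (hf : DifferentiableAt ℝ f u)
    (h : HasDerivAt (fun t : ℝ => f (u + t • v)) z 0) : fderiv ℝ f u v = z := by
  have h1 : HasFDerivAt f (fderiv ℝ f u) (u + (0 : ℝ) • v) := by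
    rw [zero_smul, add_zero]
    exact hf.hasFDerivAt
  exact (h1.comp_hasDerivAt (0 : ℝ) (hasDerivAt_line u v)).unique h

variable {E : Y → ℝ} {E₁ : Y → Y →L[ℝ] ℝ} {E₂ : Y → Y →L[ℝ] Y →L[ℝ] ℝ}

lemma fderiv_comp_quadQuot (hσ : ∀ u v, σ u v = σ v u) (hE₁ : ∀ f, HasFDerivAt E (E₁ f) f)
    {u : X} (hu : IsUnit (σ u u)) (w : X) :
    fderiv ℝ (fun z => E (quadQuot σ β m z)) u w = E₁ (quadQuot σ β m u) (quadQuot₁ σ β m u w) := by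
  have hF : DifferentiableAt ℝ (quadQuot σ β m) u :=
    (contDiffAt_quadQuot σ β m hu (k := 1)).differentiableAt one_ne_zero
  have h1 := ((hE₁ (quadQuot σ β m u)).comp u hF.hasFDerivAt).fderiv
  have h2 : fderiv ℝ (fun z => E (quadQuot σ β m z)) u =
    (E₁ (quadQuot σ β m u)).comp (fderiv ℝ (quadQuot σ β m) u) := h1
  rw [h2, ContinuousLinearMap.comp_apply,
    fderiv_apply_eq_of_line hF (hasDerivAt_quadQuot σ β m hσ hu w)]

lemma fderiv_fderiv_comp_quadQuot (hσ : ∀ u v, σ u v = σ v u) (hE : ContDiff ℝ 2 E)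
    (hE₁ : ∀ f, HasFDerivAt E (E₁ f) f) (hE₂ : ∀ f, HasFDerivAt E₁ (E₂ f) f)
    {u : X} (hu : IsUnit (σ u u)) (v w : X) :
    fderiv ℝ (fun y => fderiv ℝ (fun z => E (quadQuot σ β m z)) y) u v w =
      E₂ (quadQuot σ β m u) (quadQuot₁ σ β m u v) (quadQuot₁ σ β m u w) +
        E₁ (quadQuot σ β m u) (quadQuot₂ σ β m u v w) := by
  have hJ : ContDiffAt ℝ 2 (fun z => E (quadQuot σ β m z)) u :=
    hE.contDiffAt.comp u (contDiffAt_quadQuot σ β m hu)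
  have hJ' : DifferentiableAt ℝ (fun y => fderiv ℝ (fun z => E (quadQuot σ β m z)) y) u :=
    (hJ.fderiv_right (m := 1) (by norm_num)).differentiableAt one_ne_zero
  -- Evaluation at `w` is linear and commutes with the outer derivative, so only a scalar function
  -- has to be differentiated in the direction `v`.
  have h1 : fderiv ℝ (fun y => fderiv ℝ (fun z => E (quadQuot σ β m z)) y) u v w =
      fderiv ℝ (fun y => fderiv ℝ (fun z => E (quadQuot σ β m z)) y w) u v := by
    have h2 := ((ContinuousLinearMap.apply ℝ ℝ w).hasFDerivAt.comp u hJ'.hasFDerivAt).fderiv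
    have h3 : fderiv ℝ (fun y => fderiv ℝ (fun z => E (quadQuot σ β m z)) y w) u =
      (ContinuousLinearMap.apply ℝ ℝ w).comp
        (fderiv ℝ (fun y => fderiv ℝ (fun z => E (quadQuot σ β m z)) y) u) := h2
    rw [h3]
    rfl
  have hJw : DifferentiableAt ℝ (fun y => fderiv ℝ (fun z => E (quadQuot σ β m z)) y w) u :=
    hJ'.clm_apply (differentiableAt_const w)
  rw [h1]
  refine fderiv_apply_eq_of_line hJw ?_
  have hline : Tendsto (fun t : ℝ => u + t • v) (𝓝 0) (𝓝 u) := by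
    have h := (hasDerivAt_line u v).continuousAt.tendsto
    simpa using h
  have h4 : HasDerivAt (fun t : ℝ => E₁ (quadQuot σ β m (u + t • v)))
      (E₂ (quadQuot σ β m u) (quadQuot₁ σ β m u v)) 0 := by
    have h5 : HasFDerivAt E₁ (E₂ (quadQuot σ β m u)) (quadQuot σ β m (u + (0 : ℝ) • v)) := by
      rw [zero_smul, add_zero]
      exact hE₂ _
    exact h5.comp_hasDerivAt (0 : ℝ) (hasDerivAt_quadQuot σ β m hσ hu v)
  have h6 := h4.clm_apply (hasDerivAt_quadQuot₁ σ β m hσ hu v w)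
  simp only [zero_smul, add_zero] at h6
  refine h6.congr_of_eventuallyEq ?_
  filter_upwards [hline.eventually (eventually_isUnit_quad σ hu)] with t ht
  exact fderiv_comp_quadQuot σ β m hσ hE₁ ht w

end QuadraticQuotient

/-! ### The pointwise form of the energy and of its second derivative -/

section Pointwise

variable {H : Type*} [NormedAddCommGroup H] [InnerProductSpace ℝ H]

lemma rpow_two_mul_add {ρ : ℝ} (hρ : 0 < ρ) (q : ℝ) (k : ℕ) :
    ρ ^ (2 * q + k) = (ρ ^ 2) ^ q * ρ ^ k := by
  rw [Real.rpow_add hρ, Real.rpow_mul hρ.le, Real.rpow_natCast, Real.rpow_two]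

lemma norm_inv_smul_rpow {D : ℝ} (hD : 0 < D) (W : H) (r : ℝ) :
    ‖D⁻¹ • W‖ ^ r = ‖W‖ ^ r / D ^ r := by
  rw [norm_smul, norm_inv, Real.norm_of_nonneg hD.le, ← div_eq_inv_mul,
    Real.div_rpow (norm_nonneg _) hD.le]

/-- The second derivative of `‖W / |D|²‖ ^ q / q`, where the derivatives of `W` in the directions
`v` and `w` are `V₁ + V₂` and `W₁ + W₂`, the mixed second derivative of `W` is `T₁ + T₂`, and
those of `|D|²` are `2 a`, `2 b` and `2 c`. -/
lemma powHess_add_powGrad_quotient {q : ℝ} (hq : 2 < q) {ρ : ℝ} (hρ : 0 < ρ) (a b c : ℝ)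
    (W V₁ V₂ W₁ W₂ T₁ T₂ : H) {D : ℝ} (hD : D = ρ ^ 2) :
    1 / q * (powHess q (D⁻¹ • W) (D⁻¹ • (V₁ + V₂) - (2 : ℝ) • (D⁻¹ ^ 2 * a) • W)
        (D⁻¹ • (W₁ + W₂) - (2 : ℝ) • (D⁻¹ ^ 2 * b) • W) +
      powGrad q (D⁻¹ • W) (D⁻¹ • (T₁ + T₂) - (2 : ℝ) • (D⁻¹ ^ 2 * a) • (W₁ + W₂) -
        (2 : ℝ) • (D⁻¹ ^ 2 * b) • (V₁ + V₂) - (2 : ℝ) • (D⁻¹ ^ 2 * c) • W +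
        (8 : ℝ) • (D⁻¹ ^ 3 * (a * b)) • W)) =
    (q - 2) * (‖W‖ ^ (q - 4) / ρ ^ (2 * q) * inner ℝ W V₁ * inner ℝ W W₂ +
        ‖W‖ ^ (q - 4) / ρ ^ (2 * q) * inner ℝ W V₁ * inner ℝ W W₁ +
        ‖W‖ ^ (q - 4) / ρ ^ (2 * q) * inner ℝ W V₂ * inner ℝ W W₂ +
        ‖W‖ ^ (q - 4) / ρ ^ (2 * q) * inner ℝ W V₂ * inner ℝ W W₁) +
      ‖W‖ ^ (q - 4) / ρ ^ (2 * q) * inner ℝ W W * inner ℝ W₂ V₁ +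
      ‖W‖ ^ (q - 4) / ρ ^ (2 * q) * inner ℝ W W * inner ℝ W₁ V₁ +
      ‖W‖ ^ (q - 4) / ρ ^ (2 * q) * inner ℝ W W * inner ℝ W₂ V₂ +
      ‖W‖ ^ (q - 4) / ρ ^ (2 * q) * inner ℝ W W * inner ℝ W₁ V₂ -
      2 * q * (‖W‖ ^ (q - 2) / ρ ^ (2 * q + 2) * inner ℝ W V₁ * b +
        ‖W‖ ^ (q - 2) / ρ ^ (2 * q + 2) * inner ℝ W V₂ * b) +
      ‖W‖ ^ (q - 2) / ρ ^ (2 * q) * inner ℝ W T₁ + ‖W‖ ^ (q - 2) / ρ ^ (2 * q) * inner ℝ W T₂ -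
      2 * q * (‖W‖ ^ (q - 2) / ρ ^ (2 * q + 4) * a * inner ℝ W W₂ * ρ ^ 2 +
        ‖W‖ ^ (q - 2) / ρ ^ (2 * q + 4) * a * inner ℝ W W₁ * ρ ^ 2) +
      4 * (q + 1) * (‖W‖ ^ (q - 2) / ρ ^ (2 * q + 4) * a * inner ℝ W W * b) -
      2 * (‖W‖ ^ q / ρ ^ (2 * q + 2) * c) := by
  -- At `W = 0` every term contains an inner product with `W` or a positive power of `‖W‖`, so the
  -- value assigned to `0 ^ (q - 4)` is irrelevant.
  rcases eq_or_ne W 0 with rfl | hW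
  · have h1 : (0 : ℝ) ^ (q - 2) = 0 := Real.zero_rpow (by linarith)
    have h2 : (0 : ℝ) ^ q = 0 := Real.zero_rpow (by linarith)
    simp [powHess_apply, powGrad_apply, h1, h2]
  have hn : 0 < ‖W‖ := norm_pos_iff.2 hW
  have hD0 : 0 < D := hD ▸ by positivity
  have e1 : ‖W‖ ^ (q - 2) = ‖W‖ ^ (q - 4) * ‖W‖ ^ 2 := by
    rw [← Real.rpow_natCast, ← Real.rpow_add hn]; congr 1; push_cast; ring
  have e2 : ‖W‖ ^ q = ‖W‖ ^ (q - 4) * ‖W‖ ^ 4 := by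
    rw [← Real.rpow_natCast, ← Real.rpow_add hn]; congr 1; push_cast; ring
  have e3 : D ^ (q - 4) = D ^ q / D ^ 4 := by
    rw [Real.rpow_sub hD0]; norm_cast
  have e4 : D ^ (q - 2) = D ^ q / D ^ 2 := by
    rw [Real.rpow_sub hD0]; norm_cast
  have r0 : ρ ^ (2 * q) = D ^ q := by rw [Real.rpow_mul hρ.le, Real.rpow_two, hD]
  have r2 : ρ ^ (2 * q + 2) = D ^ q * D := by
    have := rpow_two_mul_add hρ q 2; rw [← hD] at this; exact_mod_cast this
  have r4 : ρ ^ (2 * q + 4) = D ^ q * D ^ 2 := by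
    have := rpow_two_mul_add hρ q 4
    rw [hD, ← pow_mul]; exact_mod_cast this
  have hDq : 0 < D ^ q := Real.rpow_pos_of_pos hD0 q
  have hq0 : q ≠ 0 := by linarith
  simp only [powHess_apply, powGrad_apply, norm_inv_smul_rpow hD0, r0, r2, r4, ← hD, e3, e4, e1, e2,
    inner_add_left, inner_add_right, inner_sub_left, inner_sub_right, real_inner_smul_left,
    real_inner_smul_right, real_inner_self_eq_norm_sq, real_inner_comm W V₁,
    real_inner_comm W V₂, real_inner_comm W₁ V₁,
    real_inner_comm W₁ V₂, real_inner_comm W₂ V₁, real_inner_comm W₂ V₂]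
  -- All real powers are now multiples of `‖W‖ ^ (q - 4)` and `D ^ q`, so a rational identity
  -- remains. The coefficient of `a b ‖W‖²` is `4 + 4 (q - 2) + 8 = 4 (q + 1)`, and that of the
  -- mixed terms is `-2 - 2 (q - 2) - 2 = -2 q`.
  generalize ‖W‖ ^ (q - 4) = ω
  generalize D ^ q = Δ at *
  field_simp
  ring

end Pointwise

/-! ### The tangent-point functional as an energy of a quotient of quadratic maps -/

section TangentPointQuotient

variable {n : ℕ} {q : ℝ} [hq : Fact (2 < q)]

/-- The `L^q` function `u'(y) ∧ Du / |Du|²`. -/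
def tpQuot (u : CurveSpace n q) : Lp (Biv n) (ENNReal.ofReal q) (volume : Measure (Circ × Circ)) :=
  quadQuot metricCLM wedgeRemCLM mulLpCLM u

/-- The derivative of `tpQuot` at `u` in the direction `v`. -/
def tpQuot₁ (u v : CurveSpace n q) :
    Lp (Biv n) (ENNReal.ofReal q) (volume : Measure (Circ × Circ)) :=
  quadQuot₁ metricCLM wedgeRemCLM mulLpCLM u v

/-- The second derivative of `tpQuot` at `u` in the directions `v` and `w`. -/
def tpQuot₂ (u v w : CurveSpace n q) :
    Lp (Biv n) (ENNReal.ofReal q) (volume : Measure (Circ × Circ)) :=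
  quadQuot₂ metricCLM wedgeRemCLM mulLpCLM u v w

lemma velY_ae_eq (u : CurveSpace n q) : ∀ᵐ p : Circ × Circ, velY u p = cvel u p.2 := by
  filter_upwards [Measure.quasiMeasurePreserving_snd.ae (cvel_ae_eq u)] with p hp
  exact hp.symm

lemma sq_smul_wedge_remainder (u v : CurveSpace n q) {p : Circ × Circ} (hp : p.1 ≠ p.2) :
    signedDif p ^ 2 • wedge (cvel u p.2) (remainder v p) =
      wedge (cvel u p.2) (dif v p - signedDif p • cvel v p.2) := by
  have h : signedDif p ^ 2 ≠ 0 := pow_ne_zero 2 fun h => hp ((signedDif_eq_zero_iff p).1 h)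
  rw [remainder, ← wedge_smul_right, smul_inv_smul₀ h]

/-- The corrections `(x - y) u' ∧ v'` and `(x - y) v' ∧ u'` cancel by antisymmetry, so only the
plain differences `Du` and `Dv` appear in the first derivative. -/
lemma sq_smul_wedge_remainder_add (u v : CurveSpace n q) {p : Circ × Circ} (hp : p.1 ≠ p.2) :
    signedDif p ^ 2 • (wedge (cvel u p.2) (remainder v p) + wedge (cvel v p.2) (remainder u p)) =
      wedge (cvel u p.2) (dif v p) + wedge (cvel v p.2) (dif u p) := by
  rw [smul_add, sq_smul_wedge_remainder u v hp, sq_smul_wedge_remainder v u hp, wedge_sub_right,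
    wedge_sub_right, wedge_smul_right, wedge_smul_right, wedge_comm (cvel v p.2) (cvel u p.2)]
  module

/-- The correction is a multiple of `u' ∧ u' = 0`. This is the gain of one order that makes the
tangent-point integrand accessible to the remainder estimate. -/
lemma sq_smul_wedge_remainder_self (u : CurveSpace n q) {p : Circ × Circ} (hp : p.1 ≠ p.2) :
    signedDif p ^ 2 • wedge (cvel u p.2) (remainder u p) = wedge (cvel u p.2) (dif u p) := by
  rw [sq_smul_wedge_remainder u u hp, wedge_sub_right, wedge_smul_right, wedge_self, smul_zero,
    sub_zero]

lemma inner_dif (u v : CurveSpace n q) (p : Circ × Circ) :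
    inner ℝ (dif u p) (dif v p) = signedDif p ^ 2 * metricForm u v p := by
  rw [dif_eq_smul_secant, dif_eq_smul_secant, real_inner_smul_left, real_inner_smul_right,
    metricForm_apply]
  ring

lemma metricForm_self_ne_zero {u : CurveSpace n q} (hu : IsUnit (metricForm u u))
    (p : Circ × Circ) : metricForm u u p ≠ 0 :=
  (ContinuousMap.isUnit_iff_forall_ne_zero _).1 hu p

lemma norm_dif_pos {u : CurveSpace n q} (hu : IsUnit (metricForm u u)) {p : Circ × Circ}
    (hp : p.1 ≠ p.2) : 0 < ‖dif u p‖ := by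
  rw [norm_pos_iff]
  intro h0
  have h := norm_secant_sq u p
  rw [h0, norm_zero, zero_pow two_ne_zero, eq_comm, mul_eq_zero] at h
  exact h.elim (pow_ne_zero 2 fun h => hp ((signedDif_eq_zero_iff p).1 h))
    (metricForm_self_ne_zero hu p)

lemma coeFn_tpQuot {u : CurveSpace n q} (hu : IsUnit (metricForm u u)) :
    ∀ᵐ p, tpQuot u p = (‖dif u p‖ ^ 2)⁻¹ • wedge (velY u p) (dif u p) := by
  have h0 : tpQuot u = mulLp (Ring.inverse (metricForm u u)) (wedgeRem u u) := rfl
  rw [h0]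
  filter_upwards [coeFn_mulLp (Ring.inverse (metricForm u u)) (wedgeRem u u), coeFn_wedgeRem u u,
    ae_fst_ne_snd, velY_ae_eq u] with p h1 h2 hp hv
  have h : signedDif p ≠ 0 := fun h => hp ((signedDif_eq_zero_iff p).1 h)
  have hs := metricForm_self_ne_zero hu p
  rw [h1, h2, hv, inverse_metricForm_apply hu, norm_secant_sq, ← sq_smul_wedge_remainder_self u hp]
  match_scalars
  field_simp

lemma coeFn_tpQuot₁ {u : CurveSpace n q} (hu : IsUnit (metricForm u u)) (v : CurveSpace n q) :
    ∀ᵐ p, tpQuot₁ u v p =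
      (‖dif u p‖ ^ 2)⁻¹ • (wedge (velY u p) (dif v p) + wedge (velY v p) (dif u p)) -
      (2 : ℝ) • ((‖dif u p‖ ^ 2)⁻¹ ^ 2 * inner ℝ (dif u p) (dif v p)) •
        wedge (velY u p) (dif u p) := by
  set i := Ring.inverse (metricForm u u) with hi
  have h0 : tpQuot₁ u v = mulLp i (wedgeRem u v + wedgeRem v u) -
    (2 : ℝ) • mulLp (i ^ 2 * metricForm u v) (wedgeRem u u) := rfl
  rw [h0]
  filter_upwards [Lp.coeFn_sub (mulLp i (wedgeRem u v + wedgeRem v u))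
      ((2 : ℝ) • mulLp (i ^ 2 * metricForm u v) (wedgeRem u u)),
    Lp.coeFn_smul (2 : ℝ) (mulLp (i ^ 2 * metricForm u v) (wedgeRem u u)),
    coeFn_mulLp i (wedgeRem u v + wedgeRem v u), Lp.coeFn_add (wedgeRem u v) (wedgeRem v u),
    coeFn_mulLp (i ^ 2 * metricForm u v) (wedgeRem u u), coeFn_wedgeRem u u, coeFn_wedgeRem u v,
    coeFn_wedgeRem v u, ae_fst_ne_snd, velY_ae_eq u, velY_ae_eq v]
    with p e1 e2 e3 e4 e5 e6 e7 e8 hp hvu hvv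
  have h : signedDif p ≠ 0 := fun h => hp ((signedDif_eq_zero_iff p).1 h)
  have hs := metricForm_self_ne_zero hu p
  simp only [e1, Pi.sub_apply, e2, Pi.smul_apply, e3, e4, Pi.add_apply, e5, e6, e7, e8, hvu, hvv,
    ContinuousMap.mul_apply, ContinuousMap.pow_apply]
  simp only [hi, inverse_metricForm_apply hu, norm_secant_sq, inner_dif]
  rw [← sq_smul_wedge_remainder_self u hp, ← sq_smul_wedge_remainder_add u v hp]
  match_scalars <;> field_simp

/-- The corrections disappear as before in every term that contains `u`. In the term built from `v`
and `w` alone they are kept, to match `integrandM`. -/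
lemma coeFn_tpQuot₂ {u : CurveSpace n q} (hu : IsUnit (metricForm u u)) (v w : CurveSpace n q) :
    ∀ᵐ p, tpQuot₂ u v w p =
      (‖dif u p‖ ^ 2)⁻¹ • (wedge (velY v p) (dif w p - signedDif p • velY w p) +
        wedge (velY w p) (dif v p - signedDif p • velY v p)) -
      (2 : ℝ) • ((‖dif u p‖ ^ 2)⁻¹ ^ 2 * inner ℝ (dif u p) (dif v p)) •
        (wedge (velY u p) (dif w p) + wedge (velY w p) (dif u p)) -
      (2 : ℝ) • ((‖dif u p‖ ^ 2)⁻¹ ^ 2 * inner ℝ (dif u p) (dif w p)) •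
        (wedge (velY u p) (dif v p) + wedge (velY v p) (dif u p)) -
      (2 : ℝ) • ((‖dif u p‖ ^ 2)⁻¹ ^ 2 * inner ℝ (dif v p) (dif w p)) •
        wedge (velY u p) (dif u p) +
      (8 : ℝ) • ((‖dif u p‖ ^ 2)⁻¹ ^ 3 *
        (inner ℝ (dif u p) (dif v p) * inner ℝ (dif u p) (dif w p))) •
        wedge (velY u p) (dif u p) := by
  set i := Ring.inverse (metricForm u u) with hi
  have h0 : tpQuot₂ u v w = mulLp i (wedgeRem v w + wedgeRem w v) -
    (2 : ℝ) • mulLp (i ^ 2 * metricForm u v) (wedgeRem u w + wedgeRem w u) -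
    (2 : ℝ) • mulLp (i ^ 2 * metricForm u w) (wedgeRem u v + wedgeRem v u) -
    (2 : ℝ) • mulLp (i ^ 2 * metricForm v w) (wedgeRem u u) +
    (8 : ℝ) • mulLp (i ^ 3 * (metricForm u v * metricForm u w)) (wedgeRem u u) := rfl
  rw [h0]
  set A := mulLp i (wedgeRem v w + wedgeRem w v) with hA
  set B := mulLp (i ^ 2 * metricForm u v) (wedgeRem u w + wedgeRem w u) with hB
  set C := mulLp (i ^ 2 * metricForm u w) (wedgeRem u v + wedgeRem v u) with hC
  set D := mulLp (i ^ 2 * metricForm v w) (wedgeRem u u) with hD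
  set E := mulLp (i ^ 3 * (metricForm u v * metricForm u w)) (wedgeRem u u) with hE
  have key : ∀ᵐ p, (A - (2 : ℝ) • B - (2 : ℝ) • C - (2 : ℝ) • D + (8 : ℝ) • E : Lp (Biv n) _ _) p =
      A p - (2 : ℝ) • B p - (2 : ℝ) • C p - (2 : ℝ) • D p + (8 : ℝ) • E p := by
    filter_upwards [Lp.coeFn_add (A - (2 : ℝ) • B - (2 : ℝ) • C - (2 : ℝ) • D) ((8 : ℝ) • E),
      Lp.coeFn_sub (A - (2 : ℝ) • B - (2 : ℝ) • C) ((2 : ℝ) • D),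
      Lp.coeFn_sub (A - (2 : ℝ) • B) ((2 : ℝ) • C), Lp.coeFn_sub A ((2 : ℝ) • B),
      Lp.coeFn_smul (2 : ℝ) B, Lp.coeFn_smul (2 : ℝ) C, Lp.coeFn_smul (2 : ℝ) D,
      Lp.coeFn_smul (8 : ℝ) E] with p e1 e2 e3 e4 e5 e6 e7 e8
    simp only [e1, e2, e3, e4, e5, e6, e7, e8, Pi.add_apply, Pi.sub_apply, Pi.smul_apply]
  have keyA : ∀ᵐ p, A p = i p • (wedge (cvel v p.2) (remainder w p) +
      wedge (cvel w p.2) (remainder v p)) := by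
    filter_upwards [coeFn_mulLp i (wedgeRem v w + wedgeRem w v),
      Lp.coeFn_add (wedgeRem v w) (wedgeRem w v), coeFn_wedgeRem v w, coeFn_wedgeRem w v]
      with p e1 e2 e3 e4
    simp only [hA, e1, e2, e3, e4, Pi.add_apply]
  have keyB : ∀ᵐ p, B p = (i p ^ 2 * metricForm u v p) • (wedge (cvel u p.2) (remainder w p) +
      wedge (cvel w p.2) (remainder u p)) := by
    filter_upwards [coeFn_mulLp (i ^ 2 * metricForm u v) (wedgeRem u w + wedgeRem w u),
      Lp.coeFn_add (wedgeRem u w) (wedgeRem w u), coeFn_wedgeRem u w, coeFn_wedgeRem w u]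
      with p e1 e2 e3 e4
    simp only [hB, e1, e2, e3, e4, Pi.add_apply, ContinuousMap.mul_apply, ContinuousMap.pow_apply]
  have keyC : ∀ᵐ p, C p = (i p ^ 2 * metricForm u w p) • (wedge (cvel u p.2) (remainder v p) +
      wedge (cvel v p.2) (remainder u p)) := by
    filter_upwards [coeFn_mulLp (i ^ 2 * metricForm u w) (wedgeRem u v + wedgeRem v u),
      Lp.coeFn_add (wedgeRem u v) (wedgeRem v u), coeFn_wedgeRem u v, coeFn_wedgeRem v u]
      with p e1 e2 e3 e4
    simp only [hC, e1, e2, e3, e4, Pi.add_apply, ContinuousMap.mul_apply, ContinuousMap.pow_apply]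
  have keyD : ∀ᵐ p, D p = (i p ^ 2 * metricForm v w p) • wedge (cvel u p.2) (remainder u p) := by
    filter_upwards [coeFn_mulLp (i ^ 2 * metricForm v w) (wedgeRem u u), coeFn_wedgeRem u u]
      with p e1 e2
    simp only [hD, e1, e2, ContinuousMap.mul_apply, ContinuousMap.pow_apply]
  have keyE : ∀ᵐ p, E p = (i p ^ 3 * (metricForm u v p * metricForm u w p)) •
      wedge (cvel u p.2) (remainder u p) := by
    filter_upwards [coeFn_mulLp (i ^ 3 * (metricForm u v * metricForm u w)) (wedgeRem u u),
      coeFn_wedgeRem u u] with p e1 e2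
    simp only [hE, e1, e2, ContinuousMap.mul_apply, ContinuousMap.pow_apply]
  filter_upwards [key, keyA, keyB, keyC, keyD, keyE, ae_fst_ne_snd, velY_ae_eq u, velY_ae_eq v,
    velY_ae_eq w] with p e1 e2 e3 e4 e5 e6 hp hvu hvv hvw
  have h : signedDif p ≠ 0 := fun h => hp ((signedDif_eq_zero_iff p).1 h)
  have hs := metricForm_self_ne_zero hu p
  simp only [e1, e2, e3, e4, e5, e6, hvu, hvv, hvw, hi, inverse_metricForm_apply hu,
    norm_secant_sq, inner_dif]
  rw [← sq_smul_wedge_remainder_self u hp, ← sq_smul_wedge_remainder_add u v hp, ← sq_smul_wedge_remainder_add u w hp,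
    ← sq_smul_wedge_remainder v w hp, ← sq_smul_wedge_remainder w v hp]
  match_scalars <;> field_simp

lemma energyIntegrand_ae_eq {u : CurveSpace n q} (hu : IsUnit (metricForm u u)) :
    energyIntegrand u =ᵐ[volume] fun p => ‖tpQuot u p‖ ^ q := by
  filter_upwards [coeFn_tpQuot hu, ae_fst_ne_snd] with p h1 hp
  have hD := norm_dif_pos hu hp
  rw [h1, norm_inv_smul_rpow (by positivity), norm_wedge, energyIntegrand, wdg, Real.rpow_mul hD.le,
    Real.rpow_two]

lemma TP_eq {u : CurveSpace n q} (hu : IsUnit (metricForm u u)) :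
    TP u = 1 / q * lpEnergy (tpQuot u) := by
  rw [TP, lpEnergy, integral_congr_ae (energyIntegrand_ae_eq hu)]

lemma integrable_energyIntegrand {u : CurveSpace n q} (hu : IsUnit (metricForm u u)) :
    Integrable (energyIntegrand u) :=
  (integrable_norm_rpow_Lp (tpQuot u)).congr (energyIntegrand_ae_eq hu).symm

lemma secondVariationIntegrand_ae_eq {u : CurveSpace n q} (hu : IsUnit (metricForm u u))
    (v w : CurveSpace n q) :
    secondVariationIntegrand u v w =ᵐ[volume] fun p =>
      1 / q * (powHess q (tpQuot u p) (tpQuot₁ u v p) (tpQuot₁ u w p) +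
        powGrad q (tpQuot u p) (tpQuot₂ u v w p)) := by
  filter_upwards [coeFn_tpQuot hu, coeFn_tpQuot₁ hu v, coeFn_tpQuot₁ hu w, coeFn_tpQuot₂ hu v w,
    ae_fst_ne_snd] with p h1 h2 h3 h4 hp
  have hD := norm_dif_pos hu hp
  rw [h1, h2, h3, h4, powHess_add_powGrad_quotient hq.out hD _ _ _ _ _ _ _ _ _ _ rfl]
  simp only [secondVariationIntegrand, integrandN, integrandP, integrandM, integrandB, integrandA,
    wdg, inner_wedge, norm_wedge, real_inner_self_eq_norm_sq (dif u p)]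

end TangentPointQuotient

/-! ### Second derivative of the tangent-point functional -/

section SecondVariation

variable {n : ℕ} {q : ℝ} [hq : Fact (2 < q)]

/-- The representation of `TP` through the quotient is available only where `σ(z, z)` is a unit; as
this is an open condition, both sides have the same derivatives at `u`. -/
lemma TP_eventuallyEq {u : CurveSpace n q} (hu : IsUnit (metricForm u u)) :
    TP =ᶠ[𝓝 u] fun z => 1 / q * lpEnergy (quadQuot metricCLM wedgeRemCLM mulLpCLM z :
      Lp (Biv n) (ENNReal.ofReal q) (volume : Measure (Circ × Circ))) := by
  have h : ∀ᶠ z in 𝓝 u, IsUnit (metricCLM z z) := eventually_isUnit_quad metricCLM hu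
  filter_upwards [h] with z hz
  exact TP_eq hz

lemma contDiffAt_TP {u : CurveSpace n q} (hu : IsUnit (metricForm u u)) :
    ContDiffAt ℝ 2 (TP : CurveSpace n q → ℝ) u := by
  have h1 : ContDiffAt ℝ 2 (quadQuot metricCLM wedgeRemCLM mulLpCLM : CurveSpace n q →
      Lp (Biv n) (ENNReal.ofReal q) (volume : Measure (Circ × Circ))) u :=
    contDiffAt_quadQuot metricCLM wedgeRemCLM mulLpCLM hu
  have h2 : ContDiffAt ℝ 2 (fun z => lpEnergy (quadQuot metricCLM wedgeRemCLM mulLpCLM z :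
      Lp (Biv n) (ENNReal.ofReal q) (volume : Measure (Circ × Circ)))) u :=
    contDiff_lpEnergy.contDiffAt.comp u h1
  exact (contDiffAt_const.mul h2).congr_of_eventuallyEq (TP_eventuallyEq hu)

lemma secondVariation_eq {u : CurveSpace n q} (hu : IsUnit (metricForm u u))
    (v w : CurveSpace n q) :
    secondVariation u v w = 1 / q * (lpEnergyDeriv₂ (tpQuot u) (tpQuot₁ u v) (tpQuot₁ u w) +
      lpEnergyDeriv (tpQuot u) (tpQuot₂ u v w)) := by
  have h1 : fderiv ℝ (fun z : CurveSpace n q => fderiv ℝ TP z) u =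
      fderiv ℝ (fun z : CurveSpace n q => fderiv ℝ (fun y => 1 / q *
        lpEnergy (quadQuot metricCLM wedgeRemCLM mulLpCLM y :
        Lp (Biv n) (ENNReal.ofReal q) (volume : Measure (Circ × Circ)))) z) u :=
    (TP_eventuallyEq hu).fderiv.fderiv_eq
  have h2 := fderiv_fderiv_comp_quadQuot (metricCLM (n := n) (q := q)) wedgeRemCLM mulLpCLM
    (E := fun f : Lp (Biv n) (ENNReal.ofReal q) (volume : Measure (Circ × Circ)) =>
      1 / q * lpEnergy f)
    (E₁ := fun f => (1 / q) • lpEnergyDeriv f) (E₂ := fun f => (1 / q) • lpEnergyDeriv₂ f)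
    metricForm_comm (contDiff_const.mul contDiff_lpEnergy)
    (fun f => (hasFDerivAt_lpEnergy f).const_mul (1 / q))
    (fun f => (hasFDerivAt_lpEnergyDeriv f).const_smul (1 / q)) hu v w
  rw [secondVariation, h1, h2, mul_add]
  rfl

lemma integrable_secondVariationIntegrand {u : CurveSpace n q} (hu : IsUnit (metricForm u u))
    (v w : CurveSpace n q) : Integrable (secondVariationIntegrand u v w) :=
  (((integrable_powHess (tpQuot u) (tpQuot₁ u v) (tpQuot₁ u w)).add
    (integrable_powGrad (tpQuot u) (tpQuot₂ u v w))).const_mul (1 / q)).congr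
    (secondVariationIntegrand_ae_eq hu v w).symm

lemma secondVariation_eq_integral {u : CurveSpace n q} (hu : IsUnit (metricForm u u))
    (v w : CurveSpace n q) :
    secondVariation u v w = ∫ p : Circ × Circ, secondVariationIntegrand u v w p := by
  rw [integral_congr_ae (secondVariationIntegrand_ae_eq hu v w), integral_const_mul,
    integral_add (integrable_powHess _ _ _) (integrable_powGrad _ _), secondVariation_eq hu,
    lpEnergyDeriv₂_apply, lpEnergyDeriv_apply]

end SecondVariation

/-! ### The bound on the second variation -/

section Bound

variable {n : ℕ} {q : ℝ} [hq : Fact (2 < q)]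

lemma norm_mulLp_inverse_le {u : CurveSpace n q} (hu : u ∈ embeddedRegular n q) {κ : ℝ}
    (hκ : κ = (bil u).toReal)
    (f : Lp (Biv n) (ENNReal.ofReal q) (volume : Measure (Circ × Circ))) :
    ‖mulLp (Ring.inverse (metricForm u u)) f‖ ≤ κ ^ 2 * ‖f‖ := by
  refine (norm_mulLp_le _ f).trans ?_
  gcongr
  exact hκ ▸ norm_inverse_metricForm_le hu

lemma norm_mulLp_inverse_pow_le {u : CurveSpace n q} (hu : u ∈ embeddedRegular n q) {κ : ℝ}
    (hκ : κ = (bil u).toReal) (k : ℕ) (a : C(Circ × Circ, ℝ))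
    (f : Lp (Biv n) (ENNReal.ofReal q) (volume : Measure (Circ × Circ))) :
    ‖mulLp (Ring.inverse (metricForm u u) ^ k * a) f‖ ≤ (κ ^ 2) ^ k * ‖a‖ * ‖f‖ := by
  refine (norm_mulLp_le _ f).trans ?_
  gcongr
  refine (norm_mul_le _ _).trans ?_
  gcongr
  refine (norm_pow_le _ k).trans ?_
  gcongr
  exact hκ ▸ norm_inverse_metricForm_le hu

lemma norm_wedgeRem_add_le (u v : CurveSpace n q) :
    ‖wedgeRem u v + wedgeRem v u‖ ≤ ‖cvel u‖ * wNorm (1 - 1 / q) q v.vel +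
      ‖cvel v‖ * wNorm (1 - 1 / q) q u.vel :=
  (norm_add_le _ _).trans (add_le_add (norm_wedgeRem_le u v) (norm_wedgeRem_le v u))

lemma norm_tpQuot_le {u : CurveSpace n q} (hu : u ∈ embeddedRegular n q) :
    ‖tpQuot u‖ ≤ (bil u).toReal ^ 2 * ‖cvel u‖ * wNorm (1 - 1 / q) q u.vel := by
  rw [mul_assoc]
  refine (norm_mulLp_inverse_le hu rfl (wedgeRem u u)).trans ?_
  gcongr
  exact norm_wedgeRem_le u u

/-- The summand without a derivative of `1 / σ` carries only `bil²`; multiplying it by `bil² ‖u'‖_∞²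
≥ 1` brings it to the form of the other one. Sup norms of `v'` are replaced by Morrey's bound. -/
lemma norm_tpQuot₁_le {u : CurveSpace n q} (hu : u ∈ embeddedRegular n q) (v : CurveSpace n q) :
    ‖tpQuot₁ u v‖ ≤ 4 * morreyConst q * ((bil u).toReal ^ 4 * ‖cvel u‖ ^ 2 *
      wNorm (1 - 1 / q) q u.vel * wNorm (1 - 1 / q) q v.vel) := by
  have h1 : ‖tpQuot₁ u v‖ ≤ ‖mulLp (Ring.inverse (metricForm u u)) (wedgeRem u v + wedgeRem v u)‖ +
      2 * ‖mulLp (Ring.inverse (metricForm u u) ^ 2 * metricForm u v) (wedgeRem u u)‖ := by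
    refine (norm_sub_le _ _).trans (add_le_add le_rfl ?_)
    rw [norm_smul, Real.norm_ofNat]
    rfl
  have h2 := norm_mulLp_inverse_le hu rfl (wedgeRem u v + wedgeRem v u)
  have h3 := norm_mulLp_inverse_pow_le hu rfl 2 (metricForm u v) (wedgeRem u u)
  have hM := morreyConst_pos hq.out
  have hL := norm_cvel_le u
  have hV := norm_cvel_le v
  have hκ := one_le_bil_mul_norm_cvel hu
  have hκ0 : 0 ≤ (bil u).toReal := ENNReal.toReal_nonneg
  have hU0 := wNorm_nonneg (1 - 1 / q) q u.vel
  have hV0 := wNorm_nonneg (1 - 1 / q) q v.vel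
  have hL0 : 0 ≤ ‖cvel u‖ := norm_nonneg _
  have b1 := norm_wedgeRem_add_le u v
  have b2 := norm_wedgeRem_le u u
  have b3 := norm_metricForm_le u v
  set κ := (bil u).toReal
  set L := ‖cvel u‖
  set M := morreyConst q
  set U := wNorm (1 - 1 / q) q u.vel
  set V := wNorm (1 - 1 / q) q v.vel
  have hκ2 : 1 ≤ κ ^ 2 * L ^ 2 := by rw [← mul_pow]; exact one_le_pow₀ hκ
  calc ‖tpQuot₁ u v‖ ≤ κ ^ 2 * ((M * U) * V + (M * V) * U) +
        2 * ((κ ^ 2) ^ 2 * (L * (M * V)) * (L * U)) := by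
        refine h1.trans (add_le_add (h2.trans ?_) (mul_le_mul_of_nonneg_left (h3.trans ?_) (by norm_num)))
        · gcongr
          exact b1.trans (by gcongr)
        · gcongr
          exact b3.trans (by gcongr)
    _ = 2 * M * κ ^ 2 * U * V * 1 + 2 * M * κ ^ 4 * L ^ 2 * U * V := by ring
    _ ≤ 2 * M * κ ^ 2 * U * V * (κ ^ 2 * L ^ 2) + 2 * M * κ ^ 4 * L ^ 2 * U * V := by gcongr
    _ = _ := by ring

/-- Every summand is raised to the common form `κ ^ 6 L ^ 3 U V W` using `1 ≤ κ L`; the first one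
also lacks a factor `U`, which is obtained from `L ≤ M U`. The constant is `2 + 10 + 8 = 20`. -/
lemma second_quotient_bound {κ L M U V W : ℝ} (hM : 0 < M) (hL0 : 0 ≤ L)
    (hU0 : 0 ≤ U) (hV0 : 0 ≤ V) (hW0 : 0 ≤ W) (hκ : 1 ≤ κ * L) (hL : L ≤ M * U) :
    κ ^ 2 * ((M * V) * W + (M * W) * V) +
        2 * ((κ ^ 2) ^ 2 * (L * (M * V)) * ((M * U) * W + (M * W) * U)) +
        2 * ((κ ^ 2) ^ 2 * (L * (M * W)) * ((M * U) * V + (M * V) * U)) +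
        2 * ((κ ^ 2) ^ 2 * ((M * V) * (M * W)) * (L * U)) +
        8 * ((κ ^ 2) ^ 3 * ((L * (M * V)) * (L * (M * W))) * (L * U)) ≤
      20 * M ^ 2 * (κ ^ 6 * L ^ 3 * U * V * W) := by
  have hκ2 : 1 ≤ κ ^ 2 * L ^ 2 := by rw [← mul_pow]; exact one_le_pow₀ hκ
  have hκ4 : 1 ≤ κ ^ 4 * L ^ 3 * (M * U) :=
    calc (1 : ℝ) ≤ (κ * L) ^ 4 := one_le_pow₀ hκ
      _ = κ ^ 4 * L ^ 3 * L := by ring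
      _ ≤ κ ^ 4 * L ^ 3 * (M * U) := by gcongr
  calc _ = 2 * M * κ ^ 2 * V * W * 1 + 10 * M ^ 2 * κ ^ 4 * L * U * V * W * 1 +
        8 * M ^ 2 * κ ^ 6 * L ^ 3 * U * V * W := by ring
    _ ≤ 2 * M * κ ^ 2 * V * W * (κ ^ 4 * L ^ 3 * (M * U)) +
        10 * M ^ 2 * κ ^ 4 * L * U * V * W * (κ ^ 2 * L ^ 2) +
        8 * M ^ 2 * κ ^ 6 * L ^ 3 * U * V * W := by gcongr
    _ = _ := by ring

lemma norm_tpQuot₂_le_sum (u v w : CurveSpace n q) {i : C(Circ × Circ, ℝ)}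
    (hi : i = Ring.inverse (metricForm u u)) :
    ‖tpQuot₂ u v w‖ ≤ ‖mulLp i (wedgeRem v w + wedgeRem w v)‖ +
      2 * ‖mulLp (i ^ 2 * metricForm u v) (wedgeRem u w + wedgeRem w u)‖ +
      2 * ‖mulLp (i ^ 2 * metricForm u w) (wedgeRem u v + wedgeRem v u)‖ +
      2 * ‖mulLp (i ^ 2 * metricForm v w) (wedgeRem u u)‖ +
      8 * ‖mulLp (i ^ 3 * (metricForm u v * metricForm u w)) (wedgeRem u u)‖ := by
  subst hi
  have hsm : ∀ (c : ℝ) (_ : 0 ≤ c) (f : Lp (Biv n) (ENNReal.ofReal q)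
      (volume : Measure (Circ × Circ))), ‖c • f‖ ≤ c * ‖f‖ := fun c hc f => by
    rw [norm_smul, Real.norm_of_nonneg hc]
  refine (norm_add_le _ _).trans (add_le_add ?_ (hsm 8 (by norm_num) _))
  refine (norm_sub_le _ _).trans (add_le_add ?_ (hsm 2 (by norm_num) _))
  refine (norm_sub_le _ _).trans (add_le_add ?_ (hsm 2 (by norm_num) _))
  exact (norm_sub_le _ _).trans (add_le_add le_rfl (hsm 2 (by norm_num) _))

lemma norm_wedgeRem_add_le_wNorm (u v : CurveSpace n q) :
    ‖wedgeRem u v + wedgeRem v u‖ ≤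
      morreyConst q * wNorm (1 - 1 / q) q u.vel * wNorm (1 - 1 / q) q v.vel +
      morreyConst q * wNorm (1 - 1 / q) q v.vel * wNorm (1 - 1 / q) q u.vel :=
  (norm_wedgeRem_add_le u v).trans (add_le_add
    (mul_le_mul_of_nonneg_right (norm_cvel_le u) (wNorm_nonneg _ _ _))
    (mul_le_mul_of_nonneg_right (norm_cvel_le v) (wNorm_nonneg _ _ _)))

lemma norm_metricForm_le_wNorm (u v : CurveSpace n q) :
    ‖metricForm u v‖ ≤ ‖cvel u‖ * (morreyConst q * wNorm (1 - 1 / q) q v.vel) :=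
  (norm_metricForm_le u v).trans (mul_le_mul_of_nonneg_left (norm_cvel_le v) (norm_nonneg _))

lemma norm_tpQuot₂_le {u : CurveSpace n q} (hu : u ∈ embeddedRegular n q) (v w : CurveSpace n q) :
    ‖tpQuot₂ u v w‖ ≤ 20 * morreyConst q ^ 2 * ((bil u).toReal ^ 6 * ‖cvel u‖ ^ 3 *
      wNorm (1 - 1 / q) q u.vel * wNorm (1 - 1 / q) q v.vel * wNorm (1 - 1 / q) q w.vel) := by
  have hM := morreyConst_pos hq.out
  have hU0 := wNorm_nonneg (1 - 1 / q) q u.vel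
  have hV0 := wNorm_nonneg (1 - 1 / q) q v.vel
  have hW0 := wNorm_nonneg (1 - 1 / q) q w.vel
  have hL0 : 0 ≤ ‖cvel u‖ := norm_nonneg _
  refine ((norm_tpQuot₂_le_sum u v w rfl).trans ?_).trans
    (second_quotient_bound hM hL0 hU0 hV0 hW0 (one_le_bil_mul_norm_cvel hu) (norm_cvel_le u))
  have c3 := (norm_metricForm_le_wNorm v w).trans
    (mul_le_mul_of_nonneg_right (norm_cvel_le v) (by positivity))
  have c4 := (norm_mul_le (metricForm u v) (metricForm u w)).trans
    (mul_le_mul (norm_metricForm_le_wNorm u v) (norm_metricForm_le_wNorm u w) (norm_nonneg _)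
      (by positivity))
  refine add_le_add (add_le_add (add_le_add (add_le_add ?_
    (mul_le_mul_of_nonneg_left ?_ zero_le_two)) (mul_le_mul_of_nonneg_left ?_ zero_le_two))
    (mul_le_mul_of_nonneg_left ?_ zero_le_two)) (mul_le_mul_of_nonneg_left ?_ (by norm_num))
  · exact (norm_mulLp_inverse_le hu rfl _).trans
      (mul_le_mul_of_nonneg_left (norm_wedgeRem_add_le_wNorm v w) (by positivity))
  · exact (norm_mulLp_inverse_pow_le hu rfl 2 _ _).trans
      (mul_le_mul (mul_le_mul_of_nonneg_left (norm_metricForm_le_wNorm u v) (by positivity))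
        (norm_wedgeRem_add_le_wNorm u w) (norm_nonneg _) (by positivity))
  · exact (norm_mulLp_inverse_pow_le hu rfl 2 _ _).trans
      (mul_le_mul (mul_le_mul_of_nonneg_left (norm_metricForm_le_wNorm u w) (by positivity))
        (norm_wedgeRem_add_le_wNorm u v) (norm_nonneg _) (by positivity))
  · exact (norm_mulLp_inverse_pow_le hu rfl 2 _ _).trans
      (mul_le_mul (mul_le_mul_of_nonneg_left c3 (by positivity))
        (norm_wedgeRem_le u u) (norm_nonneg _) (by positivity))
  · exact (norm_mulLp_inverse_pow_le hu rfl 3 _ _).trans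
      (mul_le_mul (mul_le_mul_of_nonneg_left c4 (by positivity))
        (norm_wedgeRem_le u u) (norm_nonneg _) (by positivity))

/-- With `X = κ² L U` bounding `‖tpQuot u‖`, the bounds on the first derivatives multiply to `16 M²
X² κ⁴ L² V W` and the bound on the second derivative is `20 M² X κ⁴ L² V W`. Hölder's inequality
contributes `X ^ (q - 2)` and `X ^ (q - 1)`, so both terms contain `X ^ q κ⁴ L²`, the product of
powers in the claim. -/
lemma abs_secondVariation_le {u : CurveSpace n q} (hu : u ∈ embeddedRegular n q)
    (v w : CurveSpace n q) :
    |secondVariation u v w| ≤ (16 * (q - 1) + 20) * morreyConst q ^ 2 *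
      (bil u).toReal ^ (2 * q + 4) * ‖cvel u‖ ^ (q + 2) * wNorm (1 - 1 / q) q u.vel ^ q *
      wNorm (1 - 1 / q) q v.vel * wNorm (1 - 1 / q) q w.vel := by
  have hq2 := hq.out
  have hq0 : 0 < q := by linarith
  have hM := morreyConst_pos hq.out
  have hκL := one_le_bil_mul_norm_cvel hu
  have hκ0 : 0 ≤ (bil u).toReal := ENNReal.toReal_nonneg
  have hL0 : 0 ≤ ‖cvel u‖ := norm_nonneg _
  have hLU := norm_cvel_le u
  have hU0 := wNorm_nonneg (1 - 1 / q) q u.vel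
  have hV0 := wNorm_nonneg (1 - 1 / q) q v.vel
  have hW0 := wNorm_nonneg (1 - 1 / q) q w.vel
  have n0 := norm_tpQuot_le hu
  have n1 := norm_tpQuot₁_le hu v
  have n2 := norm_tpQuot₁_le hu w
  have n3 := norm_tpQuot₂_le hu v w
  have e1 := abs_lpEnergyDeriv₂_le (tpQuot u) (tpQuot₁ u v) (tpQuot₁ u w)
  have e2 := abs_lpEnergyDeriv_le (tpQuot u) (tpQuot₂ u v w)
  rw [secondVariation_eq (isUnit_metricForm hu), abs_mul, abs_of_pos (by positivity : 0 < 1 / q)]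
  set κ := (bil u).toReal
  set L := ‖cvel u‖
  set M := morreyConst q
  set U := wNorm (1 - 1 / q) q u.vel
  set V := wNorm (1 - 1 / q) q v.vel
  set W := wNorm (1 - 1 / q) q w.vel
  -- Strict positivity, needed for the laws of real powers, follows from `1 ≤ κ L` and `L ≤ M U`.
  have hκ : 0 < κ := hκ0.lt_of_ne fun h => by rw [← h, zero_mul] at hκL; linarith
  have hL : 0 < L := hL0.lt_of_ne fun h => by rw [← h, mul_zero] at hκL; linarith
  have hU : 0 < U := hU0.lt_of_ne fun h => by rw [← h, mul_zero] at hLU; linarith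
  have hX : 0 < κ ^ 2 * L * U := by positivity
  have hpow : (κ ^ 2 * L * U) ^ q * (κ ^ 4 * L ^ 2) =
      κ ^ (2 * q + 4) * L ^ (q + 2) * U ^ q := by
    have k4 := rpow_two_mul_add hκ q 4
    have l2 : L ^ (q + 2) = L ^ q * L ^ 2 := by rw [Real.rpow_add hL, Real.rpow_two]
    rw [Nat.cast_ofNat] at k4
    rw [k4, l2, Real.mul_rpow (by positivity) hU.le, Real.mul_rpow (by positivity) hL.le]
    ring
  have x1 : (κ ^ 2 * L * U) ^ (q - 1) * (κ ^ 2 * L * U) = (κ ^ 2 * L * U) ^ q := by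
    rw [Real.rpow_sub_one hX.ne', div_mul_cancel₀ _ hX.ne']
  have x2 : (κ ^ 2 * L * U) ^ (q - 2) * (κ ^ 2 * L * U) ^ 2 = (κ ^ 2 * L * U) ^ q := by
    rw [Real.rpow_sub hX, Real.rpow_two, div_mul_cancel₀ _ (by positivity)]
  have hq1 : 0 ≤ q - 1 := by linarith
  calc 1 / q * |lpEnergyDeriv₂ (tpQuot u) (tpQuot₁ u v) (tpQuot₁ u w) +
        lpEnergyDeriv (tpQuot u) (tpQuot₂ u v w)|
      ≤ 1 / q * (q * (q - 1) * (κ ^ 2 * L * U) ^ (q - 2) * (4 * M * (κ ^ 4 * L ^ 2 * U * V)) *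
          (4 * M * (κ ^ 4 * L ^ 2 * U * W)) + q * (κ ^ 2 * L * U) ^ (q - 1) *
          (20 * M ^ 2 * (κ ^ 6 * L ^ 3 * U * V * W))) := by
        refine mul_le_mul_of_nonneg_left ((abs_add_le _ _).trans
          (add_le_add (e1.trans ?_) (e2.trans ?_))) (by positivity)
        · have hr : ‖tpQuot u‖ ^ (q - 2) ≤ (κ ^ 2 * L * U) ^ (q - 2) :=
            Real.rpow_le_rpow (norm_nonneg _) n0 (by linarith)
          gcongr
        · have hr : ‖tpQuot u‖ ^ (q - 1) ≤ (κ ^ 2 * L * U) ^ (q - 1) :=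
            Real.rpow_le_rpow (norm_nonneg _) n0 hq1
          gcongr
    _ = (q - 1) * (16 * M ^ 2) * ((κ ^ 2 * L * U) ^ (q - 2) * (κ ^ 2 * L * U) ^ 2) *
          (κ ^ 4 * L ^ 2) * V * W + 20 * M ^ 2 * ((κ ^ 2 * L * U) ^ (q - 1) * (κ ^ 2 * L * U)) *
          (κ ^ 4 * L ^ 2) * V * W := by
        generalize (κ ^ 2 * L * U) ^ (q - 2) = α
        generalize (κ ^ 2 * L * U) ^ (q - 1) = γ
        field_simp
        ring
    _ = (16 * (q - 1) + 20) * M ^ 2 * ((κ ^ 2 * L * U) ^ q * (κ ^ 4 * L ^ 2)) * V * W := by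
        rw [x1, x2]
        ring
    _ = _ := by
        rw [hpow]
        ring

end Bound

end TangentPoint

end

/-! ### The theorem -/

theorem proposition3p7 (n : ℕ) (q : ℝ) [Fact (2 < q)] :
    (∀ u ∈ TangentPoint.embeddedRegular n q,
      MeasureTheory.Integrable (TangentPoint.energyIntegrand u) ∧
      ContDiffAt ℝ 2 (TangentPoint.TP : TangentPoint.CurveSpace n q → ℝ) u ∧
      ∀ v w : TangentPoint.CurveSpace n q,
        MeasureTheory.Integrable (TangentPoint.secondVariationIntegrand u v w) ∧
        TangentPoint.secondVariation u v w =
          ∫ p : TangentPoint.Circ × TangentPoint.Circ,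
            TangentPoint.secondVariationIntegrand u v w p) ∧
    ∃ C : ℝ, 0 < C ∧ ∀ u ∈ TangentPoint.embeddedRegular n q,
      ∀ v w : TangentPoint.CurveSpace n q,
        |TangentPoint.secondVariation u v w| ≤
          C * (TangentPoint.bil u).toReal ^ (2 * q + 4)
            * (MeasureTheory.eLpNorm u.vel ⊤ MeasureTheory.volume).toReal ^ (q + 2)
            * TangentPoint.wNorm (1 - 1 / q) q u.vel ^ q
            * TangentPoint.wNorm (1 - 1 / q) q v.vel
            * TangentPoint.wNorm (1 - 1 / q) q w.vel := by
  refine ⟨fun u hu => ?_, (16 * (q - 1) + 20) * TangentPoint.morreyConst q ^ 2, ?_,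
    fun u hu v w => ?_⟩
  · have h := TangentPoint.isUnit_metricForm hu
    exact ⟨TangentPoint.integrable_energyIntegrand h, TangentPoint.contDiffAt_TP h, fun v w =>
      ⟨TangentPoint.integrable_secondVariationIntegrand h v w,
        TangentPoint.secondVariation_eq_integral h v w⟩⟩
  · have hq : 2 < q := Fact.out
    have hM := TangentPoint.morreyConst_pos hq
    have h1 : 0 < 16 * (q - 1) + 20 := by linarith
    positivity
  · rw [← TangentPoint.norm_cvel_eq u]
    exact TangentPoint.abs_secondVariation_le hu v w
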